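/- **Setting.** Let $\Omega$ be a smooth Riemannian $3$-manifold (Hausdorff, second countable; for instance an open subset of an orientable Riemannian $3$-manifold), and let $\Sigma\subset\Omega$ be an embedded smooth surface (without boundary). Let $N\Sigma$ be its normal bundle and $\exp^\perp$ its normal exponential map. For $A\subset\Sigma$ and $\epsilon>0$ let $U_\epsilon(A)$ be the set of $(x,\mathbf v)\in N\Sigma$ with $x\in A$, $|\mathbf v|<\epsilon$, and $\mathcal N_\epsilon(A)=\exp^\perp(U_\epsilon(A))$. It is *regular* if $\exp^\perp$ is a diffeomorphism from some open $V\subset N\Sigma$ with $V\supset U_\epsilon(A)$ onto an open subset of $\Omega$; then $\Pi_\Sigma:\exp^\perp(x,\mathbf v)\mapsto x$ is the projection. A tangent vector $\mathbf v=\mathbf v^\perp+\mathbf v^T$ at a point of $\exp^\perp(V)$, with $\mathbf v^\perp$ tangent and $\mathbf v^T$ perpendicular to the fibre of $\Pi_\Sigma$, is *$\delta$-parallel* to $\Sigma$ if $|\mathbf v^\perp|\le\delta|\mathbf v|$ and $\frac1{1+\delta}|\mathbf v^T|\le|d\Pi_\Sigma(\mathbf v)|\le(1+\delta)|\mathbf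 v^T|$. Let $U\subset\Sigma$ be open. An embedded surface $\Gamma$ is a *$\delta$-graph* over $U$ if, for some $\epsilon>0$, $\mathcal N_\epsilon(U)$ is regular, $\Gamma$ is a relatively closed subset of $\mathcal N_\epsilon(U)$ or of $\mathcal N_\epsilon(U)\setminus U$, and all tangent vectors of $\Gamma$ are $\delta$-parallel; it is a *$\delta$-cover* of $U$ if moreover it is connected and $\Pi_\Sigma(\Gamma)=U$. A *$\delta$-lift* of a (piecewise) smooth curve $\gamma:[0,1]\to\Sigma$ is a piecewise smooth curve $\widehat\gamma:[0,1]\to\mathcal N_\delta(\gamma)$ such that $\mathcal N_\delta(\gamma)$ is regular, $\Pi_\Sigma\circ\widehat\gamma=\gamma$, and all (one-sided) velocities of $\widehat\gamma$ are $\delta$-parallel. (A curve and its image are denoted by the same letter.) Let $\gamma_1,\dots,\gamma_n$ ($n\ge1$) be curves lying in a pre-compact open $U\subset\Sigma$ and passing through $p$. A *generalised simple $\delta$-lift* of them in $U$, pointed at $(p,q)$, consists of $\delta$-lifts $\widehat\gamma_i$ of $\gamma_i$ for which there are $\epsilon>0$ and an embedded (open) disk $\Delta\subset\Omega$ such that: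 (1) $\widehat\gamma_i\subset\Delta\cap\mathcal N_\epsilon(U)$; (2) $\Delta\cap\mathcal N_\epsilon(U)$ is a $\delta$-graph over $U$; (3) $q\in\mathcal N_\epsilon(p)\cap\Delta$ and $q\in\widehat\gamma_i$ for all $i$; (4) the connected component of $\Delta\cap\mathcal N_\epsilon(U)$ containing $\widehat\gamma_i$ is a $\delta$-cover of $U$. The surface $\Sigma$ has the *generalised simple lift property* if for every non-empty connected pre-compact open $U\subset\Sigma$ there is $\delta_1>0$ such that for all $0<\delta<\delta_1$, all $p\in U$ and all $n\ge 1$, any smooth curves $\gamma_1,\dots,\gamma_n:[0,1]\to U$ passing through $p$ have a generalised simple $\delta$-lift in $U$ pointed at $(p,q)$ for some $q$. Below, a *generalised simple $\delta$-lift* of a single curve $\gamma$ is one in some pre-compact open $U\supset\gamma$, pointed at some $(p',q)$ with $p'\in\gamma$. A closed curve $\gamma$ in $\Sigma$ has the *open lift property* if there is $\delta_0>0$ such that for no $0<\delta<\delta_0$ does $\gamma$ have a closed generalised simple $\delta$-lift; otherwise it has the *closed lift property*. It has the *embedded lift property* (resp. *embedded closed lift property*) if for some sequence $\delta_i\to0$,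 $\delta_i>0$, it has generalised simple $\delta_i$-lifts (resp. closed generalised simple $\delta_i$-lifts) without self-intersections (other than the coincidence of the two end points of a closed lift). **Proposition (Lifting lemma).** Let $\Sigma\subset\Omega$ be an embedded surface with the generalised simple lift property, and let $\alpha,\beta:[0,1]\to\Sigma$ be smooth closed curves such that 1. both $\alpha$ and $\beta$ have the open lift property; 2. $\alpha\cap\beta=\{p\}$, where $p=\alpha(0)=\beta(0)$; 3. there is a two-sided (i.e. with trivial normal bundle) pre-compact open set $U\subset\Sigma$ with $\alpha\cup\beta\subset U$. Then the curve $\mu:=\alpha\beta\alpha^{-1}\beta^{-1}$ (first $\alpha$, then $\beta$, then $\alpha$ and $\beta$ backwards) has the closed lift property. If, in addition, $\alpha$ and $\beta$ are Jordan curves and have the embedded lift property, then one of the curves $\mu$, $\alpha\beta$, $\beta\alpha^{-1}$ has the embedded closed lift property. -/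

import Mathlib

open Set Filter Topology Bundle
open scoped Manifold ContDiff

noncomputable section

namespace LiftProperty

/-- The model space of three-dimensional manifolds. -/
abbrev E3 : Type := EuclideanSpace ℝ (Fin 3)

section Basic

variable {Ω : Type*} [TopologicalSpace Ω] [ChartedSpace E3 Ω]

/-- The velocity vector at time `t` of the curve `c`, regarded as a curve on `J ⊆ ℝ`
(a one-sided velocity when `t` is an end point of an interval `J`). -/
def velocity (c : ℝ → Ω) (J : Set ℝ) (t : ℝ) : TangentBundle (𝓡 3) Ω :=
  ⟨c t, mfderivWithin 𝓘(ℝ, ℝ) (𝓡 3) c J t (1 : ℝ)⟩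

/-- `c` restricted to `[0,1]` is a smooth curve with values in `S`. -/
def IsSmoothCurveIn (S : Set Ω) (c : ℝ → Ω) : Prop :=
  ContMDiffOn 𝓘(ℝ, ℝ) (𝓡 3) ∞ c (Icc 0 1) ∧ MapsTo c (Icc 0 1) S

/-- The image of the curve `c : [0,1] → Ω`. -/
def curveImage (c : ℝ → Ω) : Set Ω := c '' Icc 0 1

/-- The curve `c : [0,1] → Ω` is closed. -/
def IsClosedCurve (c : ℝ → Ω) : Prop := c 0 = c 1

/-- The curve `c : [0,1] → Ω` has no self-intersections, except that its two end points may
coincide. For a closed curve this says that it is a Jordan curve. -/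
def IsEmbeddedCurve (c : ℝ → Ω) : Prop :=
  ∀ s ∈ Icc (0 : ℝ) 1, ∀ t ∈ Icc (0 : ℝ) 1, c s = c t →
    s = t ∨ (s = 0 ∧ t = 1) ∨ (s = 1 ∧ t = 0)

/-- Concatenation: first run through `c`, then through `d`. -/
def concatCurve (c d : ℝ → Ω) : ℝ → Ω := fun t => if t ≤ 1 / 2 then c (2 * t) else d (2 * t - 1)

/-- The curve `c` run backwards. -/
def revCurve (c : ℝ → Ω) : ℝ → Ω := fun t => c (1 - t)

/-- The commutatorCurve: `c`, then `d`, then `c` backwards, then `d` backwards. -/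
def commutatorCurve (c d : ℝ → Ω) : ℝ → Ω := concatCurve (concatCurve c d) (concatCurve (revCurve c) (revCurve d))

/-- `S` is an embedded smooth surface (two-dimensional embedded submanifold without boundary,
not necessarily closed or connected): near each of its points it is a coordinate plane in a suitable
smooth chart. -/
def IsEmbeddedSurface (S : Set Ω) : Prop :=
  ∀ x ∈ S, ∃ e ∈ IsManifold.maximalAtlas (𝓡 3) ∞ Ω, x ∈ e.source ∧
    e '' (S ∩ e.source) = e.target ∩ {y : E3 | y 2 = 0}

/-- `D` is an embedded disk: the image of a smooth embedding of the plane (equivalently, of the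
open unit disk). -/
def IsEmbeddedDisk (D : Set Ω) : Prop :=
  ∃ f : EuclideanSpace ℝ (Fin 2) → Ω, Manifold.IsSmoothEmbedding (𝓡 2) (𝓡 3) ∞ f ∧ range f = D

/-- `U` is a pre-compact open subset of the surface `S`. -/
def IsPrecompactOpenIn (S U : Set Ω) : Prop :=
  (∃ W : Set Ω, IsOpen W ∧ U = W ∩ S) ∧ ∃ K : Set Ω, IsCompact K ∧ K ⊆ S ∧ U ⊆ K

/-- The tangent bundle of an embedded surface `S`, as a set of tangent vectors of the ambient
manifold: the velocities of smooth curves in `S`. -/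
def tangentSet (S : Set Ω) : Set (TangentBundle (𝓡 3) Ω) :=
  {v | ∃ (c : ℝ → Ω) (r : ℝ), 0 < r ∧ ContMDiffOn 𝓘(ℝ, ℝ) (𝓡 3) ∞ c (Ioo (-r) r) ∧
    MapsTo c (Ioo (-r) r) S ∧ velocity c (Ioo (-r) r) 0 = v}

end Basic

section Riemannian

variable {Ω : Type*} [TopologicalSpace Ω] [ChartedSpace E3 Ω] [IsManifold (𝓡 3) ∞ Ω]
  [RiemannianBundle (fun x : Ω => TangentSpace (𝓡 3) x)]

/-- The normal bundle `NS` of an embedded surface `S`. -/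
def normalSet (S : Set Ω) : Set (TangentBundle (𝓡 3) Ω) :=
  {v | v.proj ∈ S ∧ ∀ w : TangentSpace (𝓡 3) v.proj,
    (⟨v.proj, w⟩ : TangentBundle (𝓡 3) Ω) ∈ tangentSet S → inner ℝ v.2 w = 0}

/-- The open subset `U` of `S` is two-sided: the normal line bundle of `S` is trivial over `U`,
that is, it has a continuous nowhere vanishing section over `U`. -/
def IsTwoSided (S U : Set Ω) : Prop :=
  ∃ ν : (x : Ω) → TangentSpace (𝓡 3) x,
    ContinuousOn (fun x => (⟨x, ν x⟩ : TangentBundle (𝓡 3) Ω)) U ∧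
    ∀ x ∈ U, (⟨x, ν x⟩ : TangentBundle (𝓡 3) Ω) ∈ normalSet S ∧ ν x ≠ 0

/-- The Riemannian metric in the coordinates of the preferred chart at `x₀`, at the coordinate
point `y` and for coordinate vectors `v`, `w`. -/
def chartMetric (x₀ : Ω) (y v w : E3) : ℝ :=
  inner ℝ (mfderiv 𝓘(ℝ, E3) (𝓡 3) (extChartAt (𝓡 3) x₀).symm y v)
    (mfderiv 𝓘(ℝ, E3) (𝓡 3) (extChartAt (𝓡 3) x₀).symm y w)

/-- `c` is a geodesic on the open set `J` of times: it is smooth there, and in the coordinates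
`x = (x¹, x², x³)` of the chart at `c t` it satisfies at `t` the geodesic equation
`(d/dt) g_x(x', w) = (1/2) (∂_w g)_x(x', x')` for every constant coordinate vector `w`. This is
the equation `x'' + Γ(x', x') = 0`, with the upper index lowered by the metric. -/
def IsGeodesicOn (c : ℝ → Ω) (J : Set ℝ) : Prop :=
  ContMDiffOn 𝓘(ℝ, ℝ) (𝓡 3) ∞ c J ∧
  ∀ t ∈ J, ∀ w : E3,
    HasDerivAt
      (fun s => chartMetric (c t) (extChartAt (𝓡 3) (c t) (c s))
        (deriv (fun r => extChartAt (𝓡 3) (c t) (c r)) s) w)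
      (1 / 2 * fderiv ℝ
        (fun y => chartMetric (c t) y (deriv (fun r => extChartAt (𝓡 3) (c t) (c r)) t)
          (deriv (fun r => extChartAt (𝓡 3) (c t) (c r)) t))
        (extChartAt (𝓡 3) (c t) (c t)) w)
      t

/-- `q` is the point at time `1` of a geodesic, defined on a neighbourhood of `[0,1]`, with
initial velocity `v`. -/
def ExpRel (v : TangentBundle (𝓡 3) Ω) (q : Ω) : Prop :=
  ∃ (c : ℝ → Ω) (J : Set ℝ), IsOpen J ∧ Icc 0 1 ⊆ J ∧ IsGeodesicOn c J ∧
    velocity c J 0 = v ∧ c 1 = q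

/-- The domain of the exponential map. -/
def expDomain : Set (TangentBundle (𝓡 3) Ω) := {v | ∃ q, ExpRel v q}

open Classical in
/-- The exponential map (with the irrelevant value `v.proj` outside its domain). Its restriction to
`normalSet S` is the normal exponential map of `S`. -/
def expMap (v : TangentBundle (𝓡 3) Ω) : Ω :=
  if h : ∃ q, ExpRel v q then h.choose else v.proj

/-- The normal vectors of `S` of length less than `ε` with base point in `A`. -/
def normalDisc (S A : Set Ω) (ε : ℝ) : Set (TangentBundle (𝓡 3) Ω) :=
  {v | v ∈ normalSet S ∧ v.proj ∈ A ∧ ‖v.2‖ < ε}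

/-- The `ε`-neighbourhood of the subset `A` of `S`. -/
def tube (S A : Set Ω) (ε : ℝ) : Set Ω := expMap '' normalDisc S A ε

/-- `V` is an open subset of the normal bundle of `S` on which the normal exponential map is defined
and is a diffeomorphism onto an open subset of the ambient manifold.
(Smoothness of a map on the submanifold `V` of the tangent bundle of `Ω` is smoothness
within the set `V`.) -/
def IsRegularDomain (S : Set Ω) (V : Set (TangentBundle (𝓡 3) Ω)) : Prop :=
  (∃ W : Set (TangentBundle (𝓡 3) Ω), IsOpen W ∧ V = W ∩ normalSet S) ∧
  V ⊆ expDomain ∧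
  ContMDiffOn (𝓡 3).tangent (𝓡 3) ∞ (expMap : TangentBundle (𝓡 3) Ω → Ω) V ∧
  IsOpen (expMap '' V) ∧
  ∃ ψ : Ω → TangentBundle (𝓡 3) Ω,
    ContMDiffOn (𝓡 3) (𝓡 3).tangent ∞ ψ (expMap '' V) ∧ ∀ v ∈ V, ψ (expMap v) = v

open Classical in
/-- The projection `Π_S` onto `S` along the normal geodesics, for a regular domain `V`:
it sends `exp v` to the base point of `v`, for `v ∈ V`. -/
def footMap (V : Set (TangentBundle (𝓡 3) Ω)) (q : Ω) : Ω :=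
  if h : ∃ v ∈ V, expMap v = q then h.choose.proj else q

/-- The tangent vector `v` is `δ`-parallel to the surface: if `v = a + b` with `a` tangent to
the fibre of the projection and `b` perpendicular to that fibre, then `|a| ≤ δ |v|` and
`(1 + δ)⁻¹ |b| ≤ |dΠ v| ≤ (1 + δ) |b|`. -/
def IsParallel (V : Set (TangentBundle (𝓡 3) Ω)) (δ : ℝ) (v : TangentBundle (𝓡 3) Ω) : Prop :=
  ∃ a b : TangentSpace (𝓡 3) v.proj,
    v.2 = a + b ∧
    mfderiv (𝓡 3) (𝓡 3) (footMap V) v.proj a = 0 ∧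
    (∀ w : TangentSpace (𝓡 3) v.proj,
      mfderiv (𝓡 3) (𝓡 3) (footMap V) v.proj w = 0 → inner ℝ b w = 0) ∧
    ‖a‖ ≤ δ * ‖v.2‖ ∧
    1 / (1 + δ) * ‖b‖ ≤ ‖mfderiv (𝓡 3) (𝓡 3) (footMap V) v.proj v.2‖ ∧
    ‖mfderiv (𝓡 3) (𝓡 3) (footMap V) v.proj v.2‖ ≤ (1 + δ) * ‖b‖

/-- `G` is a smooth `δ`-graph over the open subset `U` of `S`, inside the regular
`ε`-neighbourhood of `U`, whose regularity is witnessed by `V`. A subset of a space is proper in it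
when it is relatively closed. -/
def IsDeltaGraphIn (S U : Set Ω) (δ ε : ℝ) (V : Set (TangentBundle (𝓡 3) Ω)) (G : Set Ω) : Prop :=
  IsRegularDomain S V ∧ normalDisc S U ε ⊆ V ∧
  IsEmbeddedSurface G ∧
  ((G ⊆ tube S U ε ∧ closure G ∩ tube S U ε ⊆ G) ∨
    (G ⊆ tube S U ε \ U ∧ closure G ∩ (tube S U ε \ U) ⊆ G)) ∧
  ∀ v ∈ tangentSet G, IsParallel V δ v

/-- `G` is a smooth `δ`-graph over the open subset `U` of `S`. -/
def IsDeltaGraph (S U : Set Ω) (δ : ℝ) (G : Set Ω) : Prop :=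
  ∃ ε > 0, ∃ V, IsDeltaGraphIn S U δ ε V G

/-- `G` is a smooth `δ`-cover of the open subset `U` of `S`: a connected `δ`-graph that projects
onto `U`. -/
def IsDeltaCover (S U : Set Ω) (δ : ℝ) (G : Set Ω) : Prop :=
  ∃ ε > 0, ∃ V, IsDeltaGraphIn S U δ ε V G ∧ IsConnected G ∧ footMap V '' G = U

/-- The curve `l : [0,1] → Ω` is a `δ`-lift of the (piecewise smooth) curve `c : [0,1] → S`:
the `δ`-neighbourhood of `c` is regular, `l` takes values in it and projects to `c`, and `l` is
piecewise smooth with `δ`-parallel (one-sided) velocities. -/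
def IsDeltaLift (S : Set Ω) (δ : ℝ) (c l : ℝ → Ω) : Prop :=
  ∃ V, IsRegularDomain S V ∧ normalDisc S (curveImage c) δ ⊆ V ∧
    MapsTo l (Icc 0 1) (tube S (curveImage c) δ) ∧
    (∀ t ∈ Icc (0 : ℝ) 1, footMap V (l t) = c t) ∧
    ∃ (k : ℕ) (s : ℕ → ℝ), s 0 = 0 ∧ s k = 1 ∧
      ∀ i < k, s i < s (i + 1) ∧
        ContMDiffOn 𝓘(ℝ, ℝ) (𝓡 3) ∞ l (Icc (s i) (s (i + 1))) ∧
        ∀ t ∈ Icc (s i) (s (i + 1)), IsParallel V δ (velocity l (Icc (s i) (s (i + 1))) t)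

/-- `l 0, …, l (n-1)` form a generalised simple `δ`-lift of the curves `c 0, …, c (n-1)`, pointed at
`(p, q)`, with respect to the open subset `U` of `S`, the number `ε` and the embedded disk `D`. -/
structure IsGenSimpleLift (S U : Set Ω) (δ ε : ℝ) (D : Set Ω) (p q : Ω) {n : ℕ}
    (c l : Fin n → ℝ → Ω) : Prop where
  disk : IsEmbeddedDisk D
  lift : ∀ i, IsDeltaLift S δ (c i) (l i)
  mapsTo : ∀ i, MapsTo (l i) (Icc 0 1) (D ∩ tube S U ε)
  graph : IsDeltaGraph S U δ (D ∩ tube S U ε)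
  point_mem : q ∈ tube S {p} ε ∩ D
  pointed : ∀ i, q ∈ curveImage (l i)
  cover : ∀ i, IsDeltaCover S U δ (connectedComponentIn (D ∩ tube S U ε) (l i 0))

/-- The generalised simple lift property of a surface `S`: for every non-empty connected pre-compact
open subset `U` of `S`, all sufficiently small `δ > 0` and every `p ∈ U`, every finite
non-empty family of smooth curves in `U` passing through `p` has a generalised simple `δ`-lift
pointed at `(p, q)` for some `q`. -/
def HasGenSimpleLiftProperty (S : Set Ω) : Prop :=
  ∀ U : Set Ω, IsPrecompactOpenIn S U → IsConnected U →
    ∃ δ₁ > 0, ∀ δ : ℝ, 0 < δ → δ < δ₁ → ∀ p ∈ U,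
      ∀ (n : ℕ) (c : Fin n → ℝ → Ω), 0 < n → (∀ i, IsSmoothCurveIn U (c i)) →
        (∀ i, p ∈ curveImage (c i)) →
        ∃ ε > 0, ∃ (D : Set Ω) (q : Ω) (l : Fin n → ℝ → Ω), IsGenSimpleLift S U δ ε D p q c l

/-- `l` is a generalised simple `δ`-lift of the single curve `c`. -/
def IsSimpleLift (S : Set Ω) (δ : ℝ) (c l : ℝ → Ω) : Prop :=
  ∃ U : Set Ω, IsPrecompactOpenIn S U ∧ curveImage c ⊆ U ∧
    ∃ ε > 0, ∃ (D : Set Ω) (p q : Ω), p ∈ curveImage c ∧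
      IsGenSimpleLift S U δ ε D p q (fun _ : Fin 1 => c) (fun _ : Fin 1 => l)

/-- The open lift property of a closed curve `c` in `S`. -/
def HasOpenLiftProperty (S : Set Ω) (c : ℝ → Ω) : Prop :=
  ∃ δ₀ > 0, ∀ δ : ℝ, 0 < δ → δ < δ₀ → ¬ ∃ l : ℝ → Ω, IsSimpleLift S δ c l ∧ IsClosedCurve l

/-- The closed lift property of a closed curve `c` in `S`. -/
def HasClosedLiftProperty (S : Set Ω) (c : ℝ → Ω) : Prop := ¬ HasOpenLiftProperty S c

/-- The embedded lift property of `c`: there are embedded generalised simple `δᵢ`-lifts of `c` for a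
sequence `δᵢ → 0`. -/
def HasEmbeddedLiftProperty (S : Set Ω) (c : ℝ → Ω) : Prop :=
  ∃ (δ : ℕ → ℝ) (l : ℕ → ℝ → Ω), (∀ i, 0 < δ i) ∧ Tendsto δ atTop (𝓝 0) ∧
    ∀ i, IsSimpleLift S (δ i) c (l i) ∧ IsEmbeddedCurve (l i)

/-- The embedded closed lift property of `c`: there are closed embedded generalised simple
`δᵢ`-lifts of `c` for a sequence `δᵢ → 0`. -/
def HasEmbeddedClosedLiftProperty (S : Set Ω) (c : ℝ → Ω) : Prop :=
  ∃ (δ : ℕ → ℝ) (l : ℕ → ℝ → Ω), (∀ i, 0 < δ i) ∧ Tendsto δ atTop (𝓝 0) ∧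
    ∀ i, IsSimpleLift S (δ i) c (l i) ∧ IsClosedCurve (l i) ∧ IsEmbeddedCurve (l i)

end Riemannian

end LiftProperty

end

open LiftProperty

/-!
Over a connected two-sided `U`, a `δ`-cover of `U` meets the normal fibre over each point in a
locally finite set of heights. Given two of its points over the same point of `U`, the sheets
between them can be counted with sign; as the cover is embedded and relatively closed, sheets
neither cross nor disappear, so this count does not change when both points are lifted along a
curve. Hence the monodromy of a loop moves every sheet up or down by one and the same number, and
monodromies of loops commute: lifts of the commutator of `α` and `β` close up. To lift the four legs
in a single cover, they are slowed down near their end points, which makes the commutator one smooth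
curve.

For embedded `α` and `β` without closed lifts, the lift of the commutator is a closed quadrilateral
whose consecutive vertices are distinct. If two opposite vertices coincide, two adjacent sides form
an embedded closed lift of `αβ` or `βα⁻¹`; otherwise the whole quadrilateral is embedded.
-/

namespace LiftProperty

section Velocity

variable {Ω : Type*} [TopologicalSpace Ω] [ChartedSpace E3 Ω]

theorem velocity_congr {c d : ℝ → Ω} {J : Set ℝ} {t : ℝ} (h : c =ᶠ[𝓝[J] t] d) (ht : c t = d t) :
    velocity c J t = velocity d J t := by
  have hderiv : (mfderivWithin 𝓘(ℝ, ℝ) (𝓡 3) c J t : ℝ →L[ℝ] E3) =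
      mfderivWithin 𝓘(ℝ, ℝ) (𝓡 3) d J t := h.mfderivWithin_eq ht
  exact TotalSpace.ext ht (heq_of_eq (congrArg (fun T : ℝ →L[ℝ] E3 => T 1) hderiv))

theorem velocity_comp {E : Type*} [NormedAddCommGroup E] [NormedSpace ℝ E] {f : E → Ω} {x : ℝ → E}
    {J : Set ℝ} {t : ℝ} {v : E} (hJ : UniqueDiffWithinAt ℝ J t)
    (hf : MDifferentiableAt 𝓘(ℝ, E) (𝓡 3) f (x t)) (hx : HasDerivWithinAt x v J t) :
    velocity (f ∘ x) J t = ⟨f (x t), mfderiv 𝓘(ℝ, E) (𝓡 3) f (x t) v⟩ := by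
  have hchain := mfderiv_comp_mfderivWithin t hf
    hx.differentiableWithinAt.mdifferentiableWithinAt
    (uniqueMDiffWithinAt_iff_uniqueDiffWithinAt.2 hJ)
  rw [mfderivWithin_eq_fderivWithin] at hchain
  rw [← hx.derivWithin hJ]
  exact TotalSpace.ext rfl (heq_of_eq (congrArg (fun T : ℝ →L[ℝ] E3 => T 1) hchain))

end Velocity

section ContMDiff

variable {E : Type*} [NormedAddCommGroup E] [NormedSpace ℝ E]
  {E' : Type*} [NormedAddCommGroup E'] [NormedSpace ℝ E'] {H : Type*} [TopologicalSpace H]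
  {I : ModelWithCorners ℝ E' H} {M : Type*} [TopologicalSpace M] [ChartedSpace H M]
  [IsManifold I ∞ M]

theorem contMDiffAt_mfderiv_apply {f : E → M} {s : Set E} (hs : IsOpen s)
    (hf : ContMDiffOn 𝓘(ℝ, E) I ∞ f s) {y : E} (hy : y ∈ s) (w : E) :
    ContMDiffAt 𝓘(ℝ, E) I.tangent ∞
      (fun m => (⟨f m, mfderiv 𝓘(ℝ, E) I f m w⟩ : TangentBundle I M)) y := by
  have hconst : ContMDiff 𝓘(ℝ, E) 𝓘(ℝ, E).tangent ∞
      (fun m : E => (⟨m, w⟩ : TangentBundle 𝓘(ℝ, E) E)) := by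
    intro m
    refine (contMDiffAt_section (E := TangentSpace 𝓘(ℝ, E)) (s := fun _ => w) m).2 ?_
    exact (contMDiffAt_const (c := w)).congr_of_eventuallyEq (.of_forall fun x => by simp)
  have htangent : ContMDiffOn 𝓘(ℝ, E) I.tangent ∞
      (fun m => tangentMapWithin 𝓘(ℝ, E) I f s (⟨m, w⟩ : TangentBundle 𝓘(ℝ, E) E)) s :=
    (hf.contMDiffOn_tangentMapWithin (m := ∞) (by simp) hs.uniqueMDiffOn).comp
      hconst.contMDiffOn fun _ hm => hm
  refine (htangent.contMDiffAt (hs.mem_nhds hy)).congr_of_eventuallyEq ?_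
  filter_upwards [hs.mem_nhds hy] with m hm
  simp only [tangentMapWithin, mfderivWithin_of_isOpen hs hm]

end ContMDiff

section Geodesics

variable {Ω : Type*} [TopologicalSpace Ω] [ChartedSpace E3 Ω]
  [RiemannianBundle (fun x : Ω => TangentSpace (𝓡 3) x)]

theorem chartMetric_self_eq (x₀ : Ω) (y u w : E3) :
    chartMetric x₀ y u u =
      2 * chartMetric x₀ y u w - chartMetric x₀ y w w + chartMetric x₀ y (u - w) (u - w) := by
  let T : E3 →L[ℝ] TangentSpace (𝓡 3) ((extChartAt (𝓡 3) x₀).symm y) :=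
    mfderiv 𝓘(ℝ, E3) (𝓡 3) (extChartAt (𝓡 3) x₀).symm y
  change inner ℝ (T u) (T u) =
    2 * inner ℝ (T u) (T w) - inner ℝ (T w) (T w) + inner ℝ (T (u - w)) (T (u - w))
  rw [map_sub, real_inner_sub_sub_self]
  ring

variable [IsManifold (𝓡 3) ∞ Ω]

theorem norm_sq_velocity_eventuallyEq {c : ℝ → Ω} {J : Set ℝ} {t : ℝ} (hJ : IsOpen J)
    (hc : ContMDiffOn 𝓘(ℝ, ℝ) (𝓡 3) ∞ c J) (ht : t ∈ J) :
    (fun s => ‖(velocity c J s).2‖ ^ 2) =ᶠ[𝓝 t]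
      fun s => chartMetric (c t) (extChartAt (𝓡 3) (c t) (c s))
        (deriv (fun r => extChartAt (𝓡 3) (c t) (c r)) s)
        (deriv (fun r => extChartAt (𝓡 3) (c t) (c r)) s) := by
  set φ := extChartAt (𝓡 3) (c t)
  set x : ℝ → E3 := fun r => φ (c r)
  have hsource : ∀ᶠ s in 𝓝 t, s ∈ J ∧ c s ∈ φ.source :=
    Filter.Eventually.and (hJ.mem_nhds ht)
      ((hc.contMDiffAt (hJ.mem_nhds ht)).continuousAt.eventually
        ((isOpen_extChartAt_source (c t)).mem_nhds (mem_extChartAt_source (c t))))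
  filter_upwards [hsource.eventually_nhds] with s hs
  obtain ⟨hsJ, hsφ⟩ := hs.self_of_nhds
  have hcoord : velocity c J s = velocity (φ.symm ∘ x) J s := by
    refine velocity_congr (nhdsWithin_le_nhds ?_) (φ.left_inv hsφ).symm
    filter_upwards [hs] with r hr using (φ.left_inv hr.2).symm
  have hx : ContDiffAt ℝ ∞ x s :=
    ((contMDiffAt_extChartAt' (by simpa [φ] using hsφ)).comp s
      (hc.contMDiffAt (hJ.mem_nhds hsJ))).contDiffAt
  have hφ : MDifferentiableAt 𝓘(ℝ, E3) (𝓡 3) φ.symm (x s) :=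
    ((contMDiffOn_extChartAt_symm (n := ∞) (c t)).contMDiffAt
      ((isOpen_extChartAt_target (c t)).mem_nhds (φ.map_source hsφ))).mdifferentiableAt (by simp)
  rw [hcoord, velocity_comp (hJ.uniqueDiffWithinAt hsJ) hφ
    (hx.differentiableAt (by simp)).hasDerivAt.hasDerivWithinAt, chartMetric,
    real_inner_self_eq_norm_sq]

variable [IsContMDiffRiemannianBundle (𝓡 3) ∞ E3 (fun x : Ω => TangentSpace (𝓡 3) x)]

instance instIsContinuousRiemannianBundleTangentSpace :
    IsContinuousRiemannianBundle E3 (fun x : Ω => TangentSpace (𝓡 3) x) := by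
  obtain ⟨g, hg, hinner⟩ := IsContMDiffRiemannianBundle.exists_contMDiff (IB := 𝓡 3) (n := ∞)
    (F := E3) (E := fun x : Ω => TangentSpace (𝓡 3) x)
  exact ⟨g, hg.continuous, hinner⟩

theorem contDiffAt_chartMetric (x₀ : Ω) {y : E3} (hy : y ∈ (extChartAt (𝓡 3) x₀).target)
    (v w : E3) : ContDiffAt ℝ ∞ (fun y => chartMetric x₀ y v w) y := by
  have hopen : IsOpen (extChartAt (𝓡 3) x₀).target := isOpen_extChartAt_target x₀
  have hsmooth := contMDiffOn_extChartAt_symm (I := 𝓡 3) (n := ∞) x₀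
  exact ((contMDiffAt_mfderiv_apply hopen hsmooth hy v).inner_bundle
    (contMDiffAt_mfderiv_apply hopen hsmooth hy w)).contDiffAt

theorem eventually_abs_chartMetric_le (x₀ : Ω) : ∃ C : ℝ, ∀ᶠ y in 𝓝 (extChartAt (𝓡 3) x₀ x₀),
    ∀ v : E3, |chartMetric x₀ y v v| ≤ C * ‖v‖ ^ 2 := by
  obtain ⟨C, -, hC⟩ := eventually_norm_mfderivWithin_symm_extChartAt_lt (𝓡 3) x₀
  simp only [ModelWithCorners.range_eq_univ, nhdsWithin_univ, mfderivWithin_univ] at hC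
  refine ⟨C ^ 2, ?_⟩
  filter_upwards [hC] with y hy v
  have hv : ‖mfderiv 𝓘(ℝ, E3) (𝓡 3) (extChartAt (𝓡 3) x₀).symm y v‖ ≤ C * ‖v‖ :=
    (ContinuousLinearMap.le_opNorm _ v).trans (by gcongr; exact hy.le)
  rw [chartMetric, real_inner_self_eq_norm_sq, abs_of_nonneg (by positivity), ← mul_pow]
  gcongr

theorem hasDerivAt_chartMetric_deriv_sub {x₀ : Ω} {x : ℝ → E3} {t : ℝ} (hx : ContDiffAt ℝ ∞ x t)
    (hxt : x t = extChartAt (𝓡 3) x₀ x₀) :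
    HasDerivAt (fun s => chartMetric x₀ (x s) (deriv x s - deriv x t) (deriv x s - deriv x t))
      0 t := by
  obtain ⟨C, hC⟩ := eventually_abs_chartMetric_le x₀
  have hdiff : DifferentiableAt ℝ (deriv x) t :=
    (ContDiffAt.derivWithin (m := ∞) hx (by simp)).differentiableAt (by simp)
  have hbound : (fun s => chartMetric x₀ (x s) (deriv x s - deriv x t) (deriv x s - deriv x t))
      =O[𝓝 t] fun s => ‖deriv x s - deriv x t‖ ^ 2 := by
    refine Asymptotics.IsBigO.of_bound C ?_
    filter_upwards [hx.continuousAt.eventually (by rwa [hxt])] with s hs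
    simpa using hs (deriv x s - deriv x t)
  have hquadratic : (fun s => chartMetric x₀ (x s) (deriv x s - deriv x t)
      (deriv x s - deriv x t)) =O[𝓝 t] fun s => ‖s - t‖ ^ 2 :=
    (hbound.trans (hdiff.isBigO_sub.norm_left.pow 2)).trans
      (by simpa using Asymptotics.isBigO_refl (fun s : ℝ => (s - t) ^ 2) (𝓝 t))
  simpa using (hquadratic.hasFDerivAt (𝕜 := ℝ) (by simp)).hasDerivAt

theorem hasDerivAt_chartMetric_deriv_self {x₀ : Ω} {x : ℝ → E3} {t a : ℝ}
    (hx : ContDiffAt ℝ ∞ x t) (hxt : x t = extChartAt (𝓡 3) x₀ x₀)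
    (ha : HasDerivAt (fun s => chartMetric x₀ (x s) (deriv x s) (deriv x t)) a t) :
    HasDerivAt (fun s => chartMetric x₀ (x s) (deriv x s) (deriv x s))
      (2 * a - fderiv ℝ (fun y => chartMetric x₀ y (deriv x t) (deriv x t)) (x t) (deriv x t))
      t := by
  have hfrozen : HasDerivAt (fun s => chartMetric x₀ (x s) (deriv x t) (deriv x t))
      (fderiv ℝ (fun y => chartMetric x₀ y (deriv x t) (deriv x t)) (x t) (deriv x t)) t :=
    ((contDiffAt_chartMetric x₀ (hxt ▸ mem_extChartAt_target x₀) _ _).differentiableAt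
      (by simp)).hasFDerivAt.comp_hasDerivAt t (hx.differentiableAt (by simp)).hasDerivAt
  have hsum := ((ha.const_mul 2).sub hfrozen).add (hasDerivAt_chartMetric_deriv_sub hx hxt)
  rw [add_zero] at hsum
  exact hsum.congr_of_eventuallyEq
    (.of_forall fun s => chartMetric_self_eq x₀ (x s) (deriv x s) (deriv x t))

theorem IsGeodesicOn.hasDerivAt_norm_sq_velocity {c : ℝ → Ω} {J : Set ℝ} (hJ : IsOpen J)
    (hc : IsGeodesicOn c J) {t : ℝ} (ht : t ∈ J) :
    HasDerivAt (fun s => ‖(velocity c J s).2‖ ^ 2) 0 t := by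
  have hx : ContDiffAt ℝ ∞ (fun r => extChartAt (𝓡 3) (c t) (c r)) t :=
    ((contMDiffAt_extChartAt (x := c t)).comp t (hc.1.contMDiffAt (hJ.mem_nhds ht))).contDiffAt
  have henergy := (hasDerivAt_chartMetric_deriv_self hx rfl (hc.2 t ht _)).congr_of_eventuallyEq
    (norm_sq_velocity_eventuallyEq hJ hc.1 ht)
  have hzero : ∀ r : ℝ, 2 * (1 / 2 * r) - r = 0 := fun r => by ring
  simpa only [hzero] using henergy

theorem IsGeodesicOn.norm_sq_velocity_eq {c : ℝ → Ω} {J : Set ℝ} {a b : ℝ} (hJ : IsOpen J)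
    (hc : IsGeodesicOn c J) (hab : Icc a b ⊆ J) {s : ℝ} (hs : s ∈ Icc a b) :
    ‖(velocity c J s).2‖ ^ 2 = ‖(velocity c J a).2‖ ^ 2 :=
  constant_of_has_deriv_right_zero (f := fun s => ‖(velocity c J s).2‖ ^ 2)
    (fun _ hr => (hc.hasDerivAt_norm_sq_velocity hJ (hab hr)).continuousAt.continuousWithinAt)
    (fun _ hr => (hc.hasDerivAt_norm_sq_velocity hJ
      (hab (Ico_subset_Icc_self hr))).hasDerivWithinAt) s hs

omit [IsContMDiffRiemannianBundle (𝓡 3) ∞ E3 (fun x : Ω => TangentSpace (𝓡 3) x)] in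
theorem eq_of_mfderiv_eq_zero [T2Space Ω]
    [IsContinuousRiemannianBundle E3 (fun x : Ω => TangentSpace (𝓡 3) x)] {c : ℝ → Ω} {a b : ℝ}
    (hab : a ≤ b) (hc : ContMDiffOn 𝓘(ℝ, ℝ) (𝓡 3) 1 c (Icc a b))
    (hderiv : ∀ s ∈ Icc a b, mfderiv 𝓘(ℝ, ℝ) (𝓡 3) c s (1 : ℝ) = 0) : c a = c b := by
  have : LocallyCompactSpace Ω := Manifold.locallyCompact_of_finiteDimensional (𝓡 3)
  have hlength : Manifold.pathELength (𝓡 3) c a b = 0 := by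
    rw [Manifold.pathELength_eq_lintegral_mfderiv_Icc]
    refine (MeasureTheory.setLIntegral_congr_fun (g := fun _ => 0) measurableSet_Icc
      fun s hs => ?_).trans (by simp)
    exact (congrArg (fun v : TangentSpace (𝓡 3) (c s) => ‖v‖ₑ) (hderiv s hs)).trans enorm_zero
  have hdist : Manifold.riemannianEDist (𝓡 3) (c a) (c b) = 0 :=
    le_antisymm (hlength ▸ Manifold.riemannianEDist_le_pathELength hc rfl rfl hab) bot_le
  by_contra hne
  obtain ⟨r, hr, hball⟩ := setOfPred_riemannianEDist_lt_subset_nhds' (𝓡 3)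
    (isOpen_compl_singleton.mem_nhds (hne : c a ∈ ({c b} : Set Ω)ᶜ))
  exact hball (show c b ∈ {y | Manifold.riemannianEDist (𝓡 3) (c a) y < r} by
    simpa [hdist] using hr) rfl

theorem ExpRel.eq_of_zero [T2Space Ω] {x q : Ω}
    (h : ExpRel (⟨x, 0⟩ : TangentBundle (𝓡 3) Ω) q) : q = x := by
  obtain ⟨c, J, hJ, hIJ, hc, hv, rfl⟩ := h
  refine (eq_of_mfderiv_eq_zero zero_le_one ((hc.1.mono hIJ).of_le (by simp))
    fun s hs => ?_).symm.trans (congrArg TotalSpace.proj hv)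
  have hspeed := hc.norm_sq_velocity_eq hJ hIJ hs
  rw [hv, norm_zero, zero_pow two_ne_zero, sq_eq_zero_iff, norm_eq_zero] at hspeed
  rw [← mfderivWithin_of_isOpen hJ (hIJ hs)]
  exact hspeed

theorem expMap_zero [T2Space Ω] {x : Ω}
    (h : (⟨x, 0⟩ : TangentBundle (𝓡 3) Ω) ∈ expDomain) :
    expMap (⟨x, 0⟩ : TangentBundle (𝓡 3) Ω) = x := by
  have hex : ∃ q, ExpRel (⟨x, 0⟩ : TangentBundle (𝓡 3) Ω) q := h
  rw [expMap, dif_pos hex]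
  exact hex.choose_spec.eq_of_zero

end Geodesics

section Surface

variable {Ω : Type*} [TopologicalSpace Ω] [ChartedSpace E3 Ω]

/-- A smooth chart of the ambient manifold in which `S` becomes the coordinate plane `y 2 = 0`. -/
structure IsSliceChart (S : Set Ω) (e : OpenPartialHomeomorph Ω E3) : Prop where
  mem_maximalAtlas : e ∈ IsManifold.maximalAtlas (𝓡 3) ∞ Ω
  image_eq : e '' (S ∩ e.source) = e.target ∩ {y : E3 | y 2 = 0}

variable {S : Set Ω} {e : OpenPartialHomeomorph Ω E3}

theorem IsEmbeddedSurface.exists_isSliceChart (hS : IsEmbeddedSurface S) {x : Ω} (hx : x ∈ S) :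
    ∃ e, IsSliceChart S e ∧ x ∈ e.source := by
  obtain ⟨e, he, hxe, himage⟩ := hS x hx
  exact ⟨e, ⟨he, himage⟩, hxe⟩

namespace IsSliceChart

theorem apply_mem_iff (he : IsSliceChart S e) {x : Ω} (hx : x ∈ e.source) :
    e x 2 = 0 ↔ x ∈ S := by
  have hmem : e x ∈ e '' (S ∩ e.source) ↔ x ∈ S ∩ e.source :=
    e.injOn.mem_image_iff inter_subset_right hx
  rw [he.image_eq] at hmem
  exact ⟨fun h => (hmem.1 ⟨e.map_source hx, h⟩).1, fun h => (hmem.2 ⟨h, hx⟩).2⟩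

theorem symm_mem_iff (he : IsSliceChart S e) {y : E3} (hy : y ∈ e.target) :
    e.symm y ∈ S ↔ y 2 = 0 := by
  rw [← he.apply_mem_iff (e.map_target hy), e.right_inv hy]

theorem contMDiffAt (he : IsSliceChart S e) {x : Ω} (hx : x ∈ e.source) :
    ContMDiffAt (𝓡 3) (𝓡 3) ∞ e x :=
  contMDiffAt_of_mem_maximalAtlas he.mem_maximalAtlas hx

theorem contMDiffAt_symm (he : IsSliceChart S e) {y : E3} (hy : y ∈ e.target) :
    ContMDiffAt (𝓡 3) (𝓡 3) ∞ e.symm y :=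
  contMDiffAt_symm_of_mem_maximalAtlas he.mem_maximalAtlas hy

theorem mdifferentiable (he : IsSliceChart S e) : e.MDifferentiable (𝓡 3) (𝓡 3) :=
  ⟨(contMDiffOn_of_mem_maximalAtlas he.mem_maximalAtlas).mdifferentiableOn (by simp),
    (contMDiffOn_symm_of_mem_maximalAtlas he.mem_maximalAtlas).mdifferentiableOn (by simp)⟩

theorem eventually_line_mem (he : IsSliceChart S e) {y : E3} (hy : y ∈ e.target) (hy2 : y 2 = 0)
    {w : E3} (hw : w 2 = 0) :
    ∀ᶠ s : ℝ in 𝓝 0, y + s • w ∈ e.target ∧ e.symm (y + s • w) ∈ S := by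
  have hline : ContinuousAt (fun s : ℝ => y + s • w) 0 := by fun_prop
  filter_upwards [hline.eventually_mem (e.open_target.mem_nhds (by simpa using hy))] with s hs
  exact ⟨hs, (he.symm_mem_iff hs).2 (by simp [hy2, hw])⟩

theorem mfderiv_symm_mem_tangentSet (he : IsSliceChart S e) {y : E3} (hy : y ∈ e.target)
    (hy2 : y 2 = 0) {w : E3} (hw : w 2 = 0) :
    (⟨e.symm y, mfderiv (𝓡 3) (𝓡 3) e.symm y w⟩ : TangentBundle (𝓡 3) Ω) ∈ tangentSet S := by
  obtain ⟨r, hr, hline⟩ := Metric.eventually_nhds_iff_ball.1 (he.eventually_line_mem hy hy2 hw)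
  rw [Real.ball_eq_Ioo, zero_sub, zero_add] at hline
  have hzero : (0 : ℝ) ∈ Ioo (-r) r := ⟨neg_lt_zero.2 hr, hr⟩
  refine ⟨e.symm ∘ fun s : ℝ => y + s • w, r, hr, fun s hs => ?_, fun s hs => (hline s hs).2, ?_⟩
  · have hsmooth : ContMDiffAt 𝓘(ℝ, ℝ) 𝓘(ℝ, E3) ∞ (fun s : ℝ => y + s • w) s := by
      rw [contMDiffAt_iff_contDiffAt]
      fun_prop
    exact ((he.contMDiffAt_symm (hline s hs).1).comp s hsmooth).contMDiffWithinAt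
  · have hderiv : HasDerivAt (fun s : ℝ => y + s • w) w 0 := by
      simpa using ((hasDerivAt_id (0 : ℝ)).smul_const w).const_add y
    have hvelocity := velocity_comp (f := e.symm) (isOpen_Ioo.uniqueDiffWithinAt hzero)
      ((he.contMDiffAt_symm (hline 0 hzero).1).mdifferentiableAt (by simp))
      hderiv.hasDerivWithinAt
    exact hvelocity.trans (congrArg
      (fun z => (⟨e.symm z, mfderiv (𝓡 3) (𝓡 3) e.symm z w⟩ : TangentBundle (𝓡 3) Ω)) (by simp))

theorem derivWithin_apply_two (he : IsSliceChart S e) {x : ℝ → E3} {J : Set ℝ} {t : ℝ} {v : E3}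
    (hJ : UniqueDiffWithinAt ℝ J t) (ht : t ∈ J) (hx : HasDerivWithinAt x v J t)
    (hxS : ∀ᶠ s in 𝓝[J] t, x s ∈ e.target ∧ e.symm (x s) ∈ S) : v 2 = 0 := by
  have hcoord : HasDerivWithinAt (fun s => x s 2) (v 2) J t :=
    (EuclideanSpace.proj (𝕜 := ℝ) (2 : Fin 3)).hasFDerivAt.comp_hasDerivWithinAt t hx
  have hzero : ∀ᶠ s in 𝓝[J] t, x s 2 = 0 := hxS.mono fun s hs => (he.symm_mem_iff hs.1).1 hs.2
  exact hJ.eq_deriv _ hcoord ((hasDerivWithinAt_const t J (0 : ℝ)).congr_of_eventuallyEq hzero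
    (hzero.self_of_nhdsWithin ht))

end IsSliceChart

theorem velocity_mem_tangentSet {G : Set Ω} (hG : IsEmbeddedSurface G) {l : ℝ → Ω} {J : Set ℝ}
    {t : ℝ} (hJ : UniqueDiffWithinAt ℝ J t) (ht : t ∈ J) (hlG : MapsTo l J G)
    (hl : MDifferentiableWithinAt 𝓘(ℝ, ℝ) (𝓡 3) l J t) : velocity l J t ∈ tangentSet G := by
  obtain ⟨e, he, hte⟩ := hG.exists_isSliceChart (hlG ht)
  have hsource : ∀ᶠ s in 𝓝[J] t, s ∈ J ∧ l s ∈ e.source :=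
    Filter.Eventually.and self_mem_nhdsWithin
      (hl.continuousWithinAt.eventually (e.open_source.mem_nhds hte))
  have hel : MDifferentiableWithinAt 𝓘(ℝ, ℝ) 𝓘(ℝ, E3) (e ∘ l) J t :=
    ((he.contMDiffAt hte).mdifferentiableAt (by simp)).comp_mdifferentiableWithinAt t hl
  have hderiv := hel.differentiableWithinAt.hasDerivWithinAt
  have htangent : derivWithin (e ∘ l) J t 2 = 0 := by
    refine he.derivWithin_apply_two hJ ht hderiv (hsource.mono fun s hs => ?_)
    exact ⟨e.map_source hs.2, by simpa only [Function.comp_apply, e.left_inv hs.2] using hlG hs.1⟩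
  have hy : (e ∘ l) t ∈ e.target := e.map_source hte
  have hcoord : velocity l J t = velocity (e.symm ∘ (e ∘ l)) J t := by
    refine velocity_congr ?_ (e.left_inv hte).symm
    filter_upwards [hsource] with s hs using (e.left_inv hs.2).symm
  rw [hcoord, velocity_comp (f := e.symm) hJ
    ((he.contMDiffAt_symm hy).mdifferentiableAt (by simp)) hderiv]
  exact he.mfderiv_symm_mem_tangentSet hy ((he.apply_mem_iff hte).2 (hlG ht)) htangent

end Surface

section Normal

theorem eq_smul_of_inner_map_ker_eq_zero {E F : Type*} [AddCommGroup E] [Module ℝ E]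
    [NormedAddCommGroup F] [InnerProductSpace ℝ F] {T : E →ₗ[ℝ] F} (hT : Function.Surjective T)
    (ℓ : E →ₗ[ℝ] ℝ) {ν v : F} (hν : ∀ w, ℓ w = 0 → inner ℝ ν (T w) = 0) (hν0 : ν ≠ 0)
    (hv : ∀ w, ℓ w = 0 → inner ℝ v (T w) = 0) : v = (inner ℝ v ν / inner ℝ ν ν) • ν := by
  set u := v - (inner ℝ v ν / inner ℝ ν ν) • ν with hu
  have hνν : inner ℝ ν ν ≠ 0 := inner_self_eq_zero.not.2 hν0
  have huν : inner ℝ u ν = 0 := by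
    rw [hu, inner_sub_left, real_inner_smul_left, div_mul_cancel₀ _ hνν, sub_self]
  have huT : ∀ w, ℓ w = 0 → inner ℝ u (T w) = 0 := fun w hw => by
    rw [hu, inner_sub_left, real_inner_smul_left, hv w hw, hν w hw, mul_zero, sub_zero]
  obtain ⟨n, rfl⟩ := hT ν
  obtain ⟨m, hm⟩ := hT u
  have hn : ℓ n ≠ 0 := fun h => hνν (hν n h)
  have huu := huT (m - (ℓ m / ℓ n) • n) (by simp [hn])
  rw [map_sub, map_smul, hm, inner_sub_right, real_inner_smul_right, huν, mul_zero, sub_zero,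
    inner_self_eq_zero] at huu
  exact sub_eq_zero.1 huu

variable {Ω : Type*} [TopologicalSpace Ω] [ChartedSpace E3 Ω]
  [RiemannianBundle (fun x : Ω => TangentSpace (𝓡 3) x)]

theorem eq_smul_of_mem_normalSet {S : Set Ω} (hS : IsEmbeddedSurface S) {x : Ω}
    {ν v : TangentSpace (𝓡 3) x} (hν : (⟨x, ν⟩ : TangentBundle (𝓡 3) Ω) ∈ normalSet S)
    (hν0 : ν ≠ 0) (hv : (⟨x, v⟩ : TangentBundle (𝓡 3) Ω) ∈ normalSet S) :
    v = (inner ℝ v ν / inner ℝ ν ν) • ν := by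
  obtain ⟨e, he, hxe⟩ := hS.exists_isSliceChart hν.1
  obtain ⟨y, hy, rfl⟩ : ∃ y ∈ e.target, e.symm y = x := ⟨e x, e.map_source hxe, e.left_inv hxe⟩
  have hy2 : y 2 = 0 := (he.symm_mem_iff hy).1 hν.1
  let T : E3 →L[ℝ] TangentSpace (𝓡 3) (e.symm y) := mfderiv (𝓡 3) (𝓡 3) e.symm y
  exact eq_smul_of_inner_map_ker_eq_zero (T := T.toLinearMap)
    (he.mdifferentiable.symm.mfderiv_surjective hy)
    (EuclideanSpace.proj (𝕜 := ℝ) (2 : Fin 3)).toLinearMap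
    (fun w hw => hν.2 _ (he.mfderiv_symm_mem_tangentSet hy hy2 hw)) hν0
    (fun w hw => hv.2 _ (he.mfderiv_symm_mem_tangentSet hy hy2 hw))

end Normal

section LocalInverse

variable {𝕜 : Type*} [RCLike 𝕜] {E : Type*} [NormedAddCommGroup E] [NormedSpace 𝕜 E]
  [FiniteDimensional 𝕜 E] {n : WithTop ℕ∞}

theorem exists_local_inverse_of_injective_fderiv {f : E → E} {y : E} (hf : ContDiffAt 𝕜 n f y)
    (hn : n ≠ 0) (hinj : Function.Injective (fderiv 𝕜 f y)) :
    ∃ g : E → E, ContDiffAt 𝕜 n g (f y) ∧ (∀ᶠ z in 𝓝 y, g (f z) = z) ∧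
      ∀ᶠ z in 𝓝 (f y), f (g z) = z := by
  have : CompleteSpace E := FiniteDimensional.complete 𝕜 E
  let L : E ≃L[𝕜] E :=
    (LinearEquiv.ofInjectiveEndo (fderiv 𝕜 f y : E →ₗ[𝕜] E) hinj).toContinuousLinearEquiv
  have hderiv : HasFDerivAt f (L : E →L[𝕜] E) y := (hf.differentiableAt hn).hasFDerivAt
  have hstrict : HasStrictFDerivAt f (L : E →L[𝕜] E) y := hf.hasStrictFDerivAt' hderiv hn
  exact ⟨hf.localInverse hderiv hn, hf.to_localInverse hderiv hn,
    hstrict.eventually_left_inverse, hstrict.eventually_right_inverse⟩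

theorem exists_local_inverse_on_ker {f : E → E} {y : E} (hf : ContDiffAt 𝕜 n f y) (hn : n ≠ 0)
    {ℓ : E →L[𝕜] 𝕜} {w : E} (hw : ℓ w = 1) (hfℓ : ∀ᶠ z in 𝓝 y, ℓ (f z) = 0) (hy : ℓ y = 0)
    (hinj : ∀ v, ℓ v = 0 → fderiv 𝕜 f y v = 0 → v = 0) :
    ∃ g : E → E, ContDiffAt 𝕜 n g (f y) ∧ (∀ᶠ z in 𝓝 y, ℓ z = 0 → g (f z) = z) ∧
      ∀ᶠ z in 𝓝 (f y), ℓ z = 0 → ℓ (g z) = 0 ∧ f (g z) = z := by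
  set F : E → E := fun z => f z + ℓ.smulRight w z with hF
  have hFy : F y = f y := by simp [hF, hy]
  have hFderiv : fderiv 𝕜 F y = fderiv 𝕜 f y + ℓ.smulRight w :=
    ((hf.differentiableAt hn).hasFDerivAt.add (ℓ.smulRight w).hasFDerivAt).fderiv
  have hℓderiv : ∀ v, ℓ (fderiv 𝕜 f y v) = 0 := by
    have hzero : HasFDerivAt (ℓ ∘ f) (0 : E →L[𝕜] 𝕜) y :=
      (hasFDerivAt_const (0 : 𝕜) y).congr_of_eventuallyEq hfℓ
    exact DFunLike.congr_fun
      ((ℓ.hasFDerivAt.comp y (hf.differentiableAt hn).hasFDerivAt).unique hzero)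
  have hFinj : Function.Injective (fderiv 𝕜 F y) := by
    refine (injective_iff_map_eq_zero _).2 fun v hv => ?_
    have hℓv : ℓ v = 0 := by simpa [hFderiv, hℓderiv, hw] using congrArg ℓ hv
    exact hinj v hℓv (by simpa [hFderiv, hℓv] using hv)
  obtain ⟨g, hg, hgF, hFg⟩ :=
    exists_local_inverse_of_injective_fderiv (hf.add (ℓ.smulRight w).contDiff.contDiffAt) hn hFinj
  change ∀ᶠ z in 𝓝 y, g (F z) = z at hgF
  change ContDiffAt 𝕜 n g (F y) at hg
  change ∀ᶠ z in 𝓝 (F y), F (g z) = z at hFg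
  have hgy : g (F y) = y := hgF.self_of_nhds
  have hfgℓ : ∀ᶠ z in 𝓝 (F y), ℓ (f (g z)) = 0 :=
    hg.continuousAt.eventually (p := fun z => ℓ (f z) = 0) (by rwa [hgy])
  rw [hFy] at hg hFg hfgℓ
  refine ⟨g, hg, ?_, ?_⟩
  · filter_upwards [hgF] with z hz hℓz
    simpa [hF, hℓz] using hz
  · filter_upwards [hFg, hfgℓ] with z hz hℓfg hℓz
    have hℓg : ℓ (g z) = 0 := by simpa [hF, hℓfg, hw, hℓz] using congrArg ℓ hz
    exact ⟨hℓg, by simpa [hF, hℓg] using hz⟩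

end LocalInverse

section LocalSection

variable {Ω : Type*} [TopologicalSpace Ω] [ChartedSpace E3 Ω]

theorem exists_local_section_of_mfderiv_injective {S G : Set Ω} (hS : IsEmbeddedSurface S)
    (hG : IsEmbeddedSurface G) {f : Ω → Ω} {q : Ω} (hqG : q ∈ G)
    (hf : ContMDiffAt (𝓡 3) (𝓡 3) ∞ f q) (hfS : ∀ᶠ y in 𝓝 q, f y ∈ S)
    (hinj : ∀ v : TangentSpace (𝓡 3) q, (⟨q, v⟩ : TangentBundle (𝓡 3) Ω) ∈ tangentSet G →
      mfderiv (𝓡 3) (𝓡 3) f q v = 0 → v = 0) :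
    ∃ σ : Ω → Ω, ContMDiffAt (𝓡 3) (𝓡 3) ∞ σ (f q) ∧
      (∀ᶠ y in 𝓝 q, y ∈ G → σ (f y) = y) ∧ ∀ᶠ x in 𝓝 (f q), x ∈ S → σ x ∈ G ∧ f (σ x) = x := by
  obtain ⟨e, he, hqe⟩ := hG.exists_isSliceChart hqG
  obtain ⟨e', he', hqe'⟩ := hS.exists_isSliceChart hfS.self_of_nhds
  obtain ⟨y, hy, rfl⟩ : ∃ y ∈ e.target, e.symm y = q := ⟨e q, e.map_source hqe, e.left_inv hqe⟩
  have hy2 : y 2 = 0 := (he.symm_mem_iff hy).1 hqG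
  have hes := he.contMDiffAt_symm hy
  have he's := he'.contMDiffAt hqe'
  have hF : ContMDiffAt (𝓡 3) (𝓡 3) ∞ (fun z => e' (f (e.symm z))) y :=
    he's.comp y (hf.comp y hes)
  have hFS : ∀ᶠ z in 𝓝 y, z ∈ e.target ∧ f (e.symm z) ∈ e'.source ∧ f (e.symm z) ∈ S :=
    (e.open_target.eventually_mem hy).and
      (((hf.continuousAt.comp hes.continuousAt).eventually_mem (e'.open_source.mem_nhds hqe')).and
        (hes.continuousAt.eventually hfS))
  have hFinj : ∀ v : E3, v 2 = 0 → fderiv ℝ (fun z => e' (f (e.symm z))) y v = 0 → v = 0 := by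
    intro v hv2 hv
    have hchain := ((he's.mdifferentiableAt (by simp)).hasMFDerivAt.comp y
      ((hf.mdifferentiableAt (by simp)).hasMFDerivAt.comp y
        (hes.mdifferentiableAt (by simp)).hasMFDerivAt)).mfderiv
    have hzero := (DFunLike.congr_fun hchain v).symm.trans
      ((congrArg (fun T : E3 →L[ℝ] E3 => T v) mfderiv_eq_fderiv).trans hv)
    exact (injective_iff_map_eq_zero _).1 (he.mdifferentiable.symm.mfderiv_injective hy) _
      (hinj _ (he.mfderiv_symm_mem_tangentSet hy hy2 hv2)
        ((injective_iff_map_eq_zero _).1 (he'.mdifferentiable.mfderiv_injective hqe') _ hzero))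
  obtain ⟨g, hg, hgF, hFg⟩ := exists_local_inverse_on_ker (𝕜 := ℝ) hF.contDiffAt (by simp)
    (ℓ := EuclideanSpace.proj (2 : Fin 3)) (w := EuclideanSpace.single 2 1) (by simp)
    (hFS.mono fun z hz => (he'.apply_mem_iff hz.2.1).2 hz.2.2) hy2 hFinj
  have hgy : g (e' (f (e.symm y))) = y := hgF.self_of_nhds hy2
  have hge' : ContMDiffAt (𝓡 3) (𝓡 3) ∞ (fun x => g (e' x)) (f (e.symm y)) :=
    hg.contMDiffAt.comp _ he's
  rw [← hgy] at hFS
  refine ⟨fun x => e.symm (g (e' x)), ContMDiffAt.comp _ (by rwa [hgy]) hge', ?_, ?_⟩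
  · filter_upwards [(e.continuousAt hqe).eventually (by rwa [e.right_inv hy]),
      e.open_source.mem_nhds hqe] with z hz hze hzG
    have hgz := hz ((he.apply_mem_iff hze).2 hzG)
    simp only [e.left_inv hze] at hgz
    rw [hgz, e.left_inv hze]
  · filter_upwards [he's.continuousAt.eventually hFg, hge'.continuousAt.eventually hFS,
      e'.open_source.mem_nhds hqe'] with x hx ⟨hxe, hfe', _⟩ hxe' hxS
    obtain ⟨hg2, hFgx⟩ := hx ((he'.apply_mem_iff hxe').2 hxS)
    exact ⟨(he.symm_mem_iff hxe).2 hg2, e'.injOn hfe' hxe' hFgx⟩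

end LocalSection

section RegularDomain

variable {Ω : Type*} [TopologicalSpace Ω] [ChartedSpace E3 Ω] [IsManifold (𝓡 3) ∞ Ω]
  [RiemannianBundle (fun x : Ω => TangentSpace (𝓡 3) x)]
  {S : Set Ω} {V V' : Set (TangentBundle (𝓡 3) Ω)}

open Classical in
/-- The inverse of the exponential map on `V` (with the irrelevant value `0` outside `exp V`). -/
noncomputable def normalLog (V : Set (TangentBundle (𝓡 3) Ω)) (q : Ω) : TangentBundle (𝓡 3) Ω :=
  if h : ∃ v ∈ V, expMap v = q then h.choose else ⟨q, 0⟩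

omit [IsManifold (𝓡 3) ∞ Ω] in
theorem proj_normalLog (V : Set (TangentBundle (𝓡 3) Ω)) (q : Ω) :
    (normalLog V q).proj = footMap V q := by
  rw [normalLog, footMap]
  split_ifs <;> rfl

namespace IsRegularDomain

theorem injOn (hV : IsRegularDomain S V) : InjOn expMap V := by
  obtain ⟨-, -, -, -, ψ, -, hψ⟩ := hV
  exact LeftInvOn.injOn hψ

theorem subset_normalSet (hV : IsRegularDomain S V) : V ⊆ normalSet S := by
  obtain ⟨⟨W, -, rfl⟩, -⟩ := hV
  exact inter_subset_right

theorem isOpen_image (hV : IsRegularDomain S V) : IsOpen (expMap '' V) := hV.2.2.2.1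

theorem normalLog_expMap (hV : IsRegularDomain S V) {v : TangentBundle (𝓡 3) Ω} (hv : v ∈ V) :
    normalLog V (expMap v) = v := by
  have hex : ∃ w ∈ V, expMap w = expMap v := ⟨v, hv, rfl⟩
  rw [normalLog, dif_pos hex, hV.injOn hex.choose_spec.1 hv hex.choose_spec.2]

theorem contMDiffOn_normalLog (hV : IsRegularDomain S V) :
    ContMDiffOn (𝓡 3) (𝓡 3).tangent ∞ (normalLog V) (expMap '' V) := by
  obtain ⟨-, -, -, -, ψ, hψ, hψexp⟩ := id hV
  refine hψ.congr ?_
  rintro _ ⟨v, hv, rfl⟩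
  rw [hV.normalLog_expMap hv, hψexp v hv]

theorem footMap_expMap (hV : IsRegularDomain S V) {v : TangentBundle (𝓡 3) Ω} (hv : v ∈ V) :
    footMap V (expMap v) = v.proj := by
  rw [← proj_normalLog, hV.normalLog_expMap hv]

theorem footMap_mem (hV : IsRegularDomain S V) {q : Ω} (hq : q ∈ expMap '' V) :
    footMap V q ∈ S := by
  obtain ⟨v, hv, rfl⟩ := hq
  rw [hV.footMap_expMap hv]
  exact (hV.subset_normalSet hv).1

theorem contMDiffAt_footMap (hV : IsRegularDomain S V) {q : Ω} (hq : q ∈ expMap '' V) :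
    ContMDiffAt (𝓡 3) (𝓡 3) ∞ (footMap V) q := by
  rw [← funext (proj_normalLog V)]
  exact (contMDiff_proj (TangentSpace (𝓡 3) : Ω → Type _)).contMDiffAt.comp q
    (hV.contMDiffOn_normalLog.contMDiffAt (hV.isOpen_image.mem_nhds hq))

theorem footMap_eventuallyEq (hV : IsRegularDomain S V) (hV' : IsRegularDomain S V')
    {v : TangentBundle (𝓡 3) Ω} (hv : v ∈ V) (hv' : v ∈ V') :
    footMap V =ᶠ[𝓝 (expMap v)] footMap V' := by
  obtain ⟨⟨W', hW', rfl⟩, -⟩ := id hV'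
  have hexp : ∀ᶠ y in 𝓝 (expMap v), y ∈ expMap '' V :=
    hV.isOpen_image.mem_nhds (mem_image_of_mem _ hv)
  have hlogW' : ∀ᶠ y in 𝓝 (expMap v), normalLog V y ∈ W' :=
    (hV.contMDiffOn_normalLog.continuousOn.continuousAt hexp).eventually_mem
      (hW'.mem_nhds (by rw [hV.normalLog_expMap hv]; exact hv'.1))
  filter_upwards [hlogW', hexp] with y hyW' hy
  obtain ⟨w, hw, rfl⟩ := hy
  rw [hV.normalLog_expMap hw] at hyW'
  rw [hV.footMap_expMap hw, hV'.footMap_expMap ⟨hyW', hV.subset_normalSet hw⟩]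

end IsRegularDomain

omit [IsManifold (𝓡 3) ∞ Ω] in
theorem IsParallel.congr {δ : ℝ} {v : TangentBundle (𝓡 3) Ω} (h : IsParallel V δ v)
    (hVV' : footMap V =ᶠ[𝓝 v.proj] footMap V') : IsParallel V' δ v := by
  have hderiv : (mfderiv (𝓡 3) (𝓡 3) (footMap V) v.proj : E3 →L[ℝ] E3) =
      mfderiv (𝓡 3) (𝓡 3) (footMap V') v.proj := hVV'.mfderiv_eq
  have hzero : ∀ w : TangentSpace (𝓡 3) v.proj,
      mfderiv (𝓡 3) (𝓡 3) (footMap V) v.proj w = 0 ↔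
        mfderiv (𝓡 3) (𝓡 3) (footMap V') v.proj w = 0 := fun w =>
    Eq.congr_left (congrArg (fun T : E3 →L[ℝ] E3 => T w) hderiv)
  have hnorm : ‖mfderiv (𝓡 3) (𝓡 3) (footMap V) v.proj v.2‖ =
      ‖mfderiv (𝓡 3) (𝓡 3) (footMap V') v.proj v.2‖ := by
    have himage : (⟨footMap V v.proj, mfderiv (𝓡 3) (𝓡 3) (footMap V) v.proj v.2⟩ :
        TangentBundle (𝓡 3) Ω) =
        ⟨footMap V' v.proj, mfderiv (𝓡 3) (𝓡 3) (footMap V') v.proj v.2⟩ :=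
      TotalSpace.ext hVV'.self_of_nhds
        (heq_of_eq (congrArg (fun T : E3 →L[ℝ] E3 => T v.2) hderiv))
    exact congrArg (fun u : TangentBundle (𝓡 3) Ω => ‖u.2‖) himage
  obtain ⟨a, b, hab, ha, hb, hnorm_a, hlower, hupper⟩ := h
  exact ⟨a, b, hab, (hzero a).1 ha, fun w hw => hb w ((hzero w).2 hw), hnorm_a,
    hnorm ▸ hlower, hnorm ▸ hupper⟩

omit [IsManifold (𝓡 3) ∞ Ω] in
theorem IsParallel.eq_zero_of_mfderiv_eq_zero {δ : ℝ} {v : TangentBundle (𝓡 3) Ω}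
    (h : IsParallel V δ v) (hδ : 0 < δ) (hδ1 : δ < 1)
    (hv : mfderiv (𝓡 3) (𝓡 3) (footMap V) v.proj v.2 = 0) : v.2 = 0 := by
  obtain ⟨a, b, hab, -, -, ha, hb, -⟩ := h
  rw [hv, norm_zero] at hb
  have hb0 : b = 0 := norm_le_zero_iff.1 (nonpos_of_mul_nonpos_right hb (by positivity))
  rw [hb0, add_zero] at hab
  rw [← hab] at ha
  by_contra hne
  nlinarith [norm_pos_iff.2 hne]

theorem exists_local_section (hS : IsEmbeddedSurface S) (hV : IsRegularDomain S V) {G : Set Ω}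
    (hG : IsEmbeddedSurface G) {δ : ℝ} (hδ : 0 < δ) (hδ1 : δ < 1)
    (hpar : ∀ v ∈ tangentSet G, IsParallel V δ v) {q : Ω} (hqG : q ∈ G) (hq : q ∈ expMap '' V) :
    ∃ σ : Ω → Ω, ContMDiffAt (𝓡 3) (𝓡 3) ∞ σ (footMap V q) ∧
      (∀ᶠ y in 𝓝 q, y ∈ G → σ (footMap V y) = y) ∧
      ∀ᶠ x in 𝓝 (footMap V q), x ∈ S → σ x ∈ G ∧ footMap V (σ x) = x :=
  exists_local_section_of_mfderiv_injective hS hG hqG (hV.contMDiffAt_footMap hq)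
    ((hV.isOpen_image.eventually_mem hq).mono fun _ hy => hV.footMap_mem hy)
    fun _ hv => (hpar _ hv).eq_zero_of_mfderiv_eq_zero hδ hδ1

end RegularDomain

section SignedCount

variable {X : Type*} [LinearOrder X] {H : Set X} {a b c : X}

/-- The number of elements of `H` in `[a, b)`, counted negatively when `b < a`. -/
noncomputable def signedCount (H : Set X) (a b : X) : ℤ :=
  (H ∩ Ico a b).ncard - (H ∩ Ico b a).ncard

theorem signedCount_of_le (hab : a ≤ b) : signedCount H a b = (H ∩ Ico a b).ncard := by
  simp [signedCount, Ico_eq_empty (not_lt.2 hab)]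

theorem signedCount_swap (a b : X) : signedCount H a b = -signedCount H b a := by
  simp [signedCount]

theorem signedCount_add_of_le (hfin : (H ∩ Ico a c).Finite) (hab : a ≤ b) (hbc : b ≤ c) :
    signedCount H a b + signedCount H b c = signedCount H a c := by
  rw [signedCount_of_le hab, signedCount_of_le hbc, signedCount_of_le (hab.trans hbc),
    ← Ico_union_Ico_eq_Ico hab hbc, inter_union_distrib_left, ncard_union_eq
      (Ico_disjoint_Ico_same.mono inter_subset_right inter_subset_right)
      (hfin.subset (inter_subset_inter_right _ (Ico_subset_Ico_right hbc)))
      (hfin.subset (inter_subset_inter_right _ (Ico_subset_Ico_left hab))), Nat.cast_add]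

theorem signedCount_eq_sub {m : X} (hfin : ∀ x ∈ H, (H ∩ Ico m x).Finite) (ha : a ∈ H)
    (hb : b ∈ H) (hma : m ≤ a) (hmb : m ≤ b) :
    signedCount H a b = signedCount H m b - signedCount H m a := by
  rcases le_total a b with hab | hba
  · rw [← signedCount_add_of_le (hfin b hb) hma hab, add_sub_cancel_left]
  · rw [← signedCount_add_of_le (hfin a ha) hmb hba, signedCount_swap a b, sub_add_cancel_left]

theorem signedCount_add (hfin : ∀ a ∈ H, ∀ b ∈ H, (H ∩ Ico a b).Finite) (ha : a ∈ H) (hb : b ∈ H)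
    (hc : c ∈ H) : signedCount H a b + signedCount H b c = signedCount H a c := by
  have hmin : ∀ {x y}, x ∈ H → y ∈ H → min x y ∈ H := fun {x y} hx hy => by
    rcases min_choice x y with h | h <;> rwa [h]
  have hm := hfin _ (hmin ha (hmin hb hc))
  have hma : min a (min b c) ≤ a := min_le_left _ _
  have hmb : min a (min b c) ≤ b := (min_le_right _ _).trans (min_le_left _ _)
  have hmc : min a (min b c) ≤ c := (min_le_right _ _).trans (min_le_right _ _)
  rw [signedCount_eq_sub hm ha hb hma hmb, signedCount_eq_sub hm hb hc hmb hmc,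
    signedCount_eq_sub hm ha hc hma hmc]
  ring

theorem signedCount_pos (hfin : (H ∩ Ico a b).Finite) (ha : a ∈ H) (hab : a < b) :
    0 < signedCount H a b := by
  rw [signedCount_of_le hab.le, Nat.cast_pos, ncard_pos hfin]
  exact ⟨a, ha, le_rfl, hab⟩

theorem eq_of_signedCount_eq_zero (hfin : ∀ a ∈ H, ∀ b ∈ H, (H ∩ Ico a b).Finite) (ha : a ∈ H)
    (hb : b ∈ H) (h : signedCount H a b = 0) : a = b := by
  rcases lt_trichotomy a b with hab | hab | hba
  · exact absurd h (signedCount_pos (hfin a ha b hb) ha hab).ne'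
  · exact hab
  · refine absurd ?_ (signedCount_pos (hfin b hb a ha) hb hba).ne'
    rw [signedCount_swap, h, neg_zero]

end SignedCount

section GraphFamily

variable {T X : Type*} [TopologicalSpace T] [TopologicalSpace X]

/-- Over the set `I` of times, `Q` agrees near `(t₀, z₀)` with the graph of `s`. -/
structure IsLocalSection (I : Set T) (Q : Set (T × X)) (t₀ : T) (z₀ : X) (s : T → X) : Prop where
  continuousWithinAt : ContinuousWithinAt s I t₀
  apply_eq : s t₀ = z₀
  eventually_mem_iff : ∀ᶠ r in 𝓝[I] t₀ ×ˢ 𝓝 z₀, r ∈ Q ↔ r.2 = s r.1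

/-- Over the set `I` of times, `Q` is locally the graph of a continuous function of the time. -/
def IsLocallyGraphOver (I : Set T) (Q : Set (T × X)) : Prop :=
  ∀ t₀ ∈ I, ∀ z₀, (t₀, z₀) ∈ Q → ∃ s : T → X, IsLocalSection I Q t₀ z₀ s

variable {I : Set T} {Q : Set (T × X)} {t₀ : T}

namespace IsLocalSection

variable {z₀ : X} {s u : T → X}

theorem eventually_graph_mem_iff (hs : IsLocalSection I Q t₀ z₀ s) (hu : ContinuousWithinAt u I t₀)
    (hut : u t₀ = z₀) : ∀ᶠ t in 𝓝[I] t₀, (t, u t) ∈ Q ↔ u t = s t := by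
  obtain rfl := hut
  exact (tendsto_id.prodMk hu).eventually hs.eventually_mem_iff

theorem eventually_mem (hs : IsLocalSection I Q t₀ z₀ s) : ∀ᶠ t in 𝓝[I] t₀, (t, s t) ∈ Q :=
  (hs.eventually_graph_mem_iff hs.continuousWithinAt hs.apply_eq).mono fun _ ht => ht.2 rfl

theorem eventually_eq (hs : IsLocalSection I Q t₀ z₀ s) (hu : ContinuousWithinAt u I t₀)
    (hut : u t₀ = z₀) (huQ : ∀ t ∈ I, (t, u t) ∈ Q) : ∀ᶠ t in 𝓝[I] t₀, u t = s t := by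
  filter_upwards [hs.eventually_graph_mem_iff hu hut, self_mem_nhdsWithin] with t ht htI
  exact ht.1 (huQ t htI)

theorem eventually_mem_fiber_iff (hs : IsLocalSection I Q t₀ z₀ s) (ht₀ : t₀ ∈ I) :
    ∀ᶠ z in 𝓝 z₀, (t₀, z) ∈ Q ↔ z = z₀ := by
  have hfiber : Tendsto (fun z => (t₀, z)) (𝓝 z₀) (𝓝[I] t₀ ×ˢ 𝓝 z₀) :=
    ((tendsto_pure.2 (.of_forall fun _ => rfl)).mono_right
      (pure_le_nhdsWithin ht₀)).prodMk tendsto_id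
  filter_upwards [hfiber.eventually hs.eventually_mem_iff] with z hz
  rw [hz, hs.apply_eq]

end IsLocalSection

theorem eventually_forall_fiber_of_isCompact [T2Space T] {K : Set (T × X)} (hK : IsCompact K)
    {P : T × X → Prop} (hP : ∀ z, (t₀, z) ∈ K → ∀ᶠ r in 𝓝[K] (t₀, z), P r) :
    ∀ᶠ t in 𝓝 t₀, ∀ z, (t, z) ∈ K → P (t, z) := by
  refine hK.induction_on (p := fun A => ∀ᶠ t in 𝓝 t₀, ∀ z, (t, z) ∈ A → P (t, z))
    (by simp) (fun A B hAB hB => hB.mono fun t ht z hz => ht z (hAB hz))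
    (fun A B hA hB => (hA.and hB).mono fun t ht z hz => hz.elim (ht.1 z) (ht.2 z)) ?_
  rintro ⟨t, z⟩ htz
  obtain rfl | hne := eq_or_ne t t₀
  · exact ⟨_, hP z htz, .of_forall fun t z htz => htz⟩
  · obtain ⟨A, B, hA, hB, htA, htB, hAB⟩ := t2_separation hne
    refine ⟨Prod.fst ⁻¹' A,
      nhdsWithin_le_nhds (continuous_fst.continuousAt.preimage_mem_nhds (hA.mem_nhds htA)), ?_⟩
    filter_upwards [hB.mem_nhds htB] with t' ht' z' hz'
    exact absurd ht' (disjoint_left.1 hAB hz')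

/-- The part between the graphs of `f` and `g` of the slice of `Q` at time `t`. -/
def sliceBetween [Preorder X] (Q : Set (T × X)) (f g : T → X) (t : T) : Set X :=
  {z | (t, z) ∈ Q} ∩ Icc (f t) (g t)

variable {f g : T → X}

theorem finite_sliceBetween [T1Space T] [Preorder X] (hQ : IsLocallyGraphOver I Q)
    (hK : IsCompact {r : T × X | r.1 ∈ I ∧ r.2 ∈ sliceBetween Q f g r.1}) {t : T} (ht : t ∈ I) :
    (sliceBetween Q f g t).Finite := by
  have hslice : sliceBetween Q f g t = Prod.snd ''
      ({r : T × X | r.1 ∈ I ∧ r.2 ∈ sliceBetween Q f g r.1} ∩ Prod.fst ⁻¹' {t}) := by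
    ext z
    constructor
    · exact fun hz => ⟨(t, z), ⟨⟨ht, hz⟩, rfl⟩, rfl⟩
    · rintro ⟨⟨_, _⟩, ⟨⟨-, hz⟩, rfl⟩, rfl⟩
      exact hz
  have hcompact : IsCompact (sliceBetween Q f g t) := by
    rw [hslice]
    exact (hK.inter_right (isClosed_singleton.preimage continuous_fst)).image continuous_snd
  refine hcompact.induction_on finite_empty (fun _ _ hAB hB => hB.subset hAB)
    (fun _ _ => Finite.union) fun z hz => ?_
  obtain ⟨s, hs⟩ := hQ t ht z hz.1
  refine ⟨{z}, ?_, finite_singleton z⟩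
  filter_upwards [nhdsWithin_le_nhds (hs.eventually_mem_fiber_iff ht), self_mem_nhdsWithin]
    with w hw hwslice
  exact hw.1 hwslice.1

theorem isCompact_setOf_mem_Icc [T2Space T] [LinearOrder X] [OrderTopology X] [CompactIccSpace X]
    (hI : IsCompact I) (hf : ContinuousOn f I) (hg : ContinuousOn g I) :
    IsCompact {r : T × X | r.1 ∈ I ∧ r.2 ∈ Icc (f r.1) (g r.1)} := by
  rcases I.eq_empty_or_nonempty with rfl | ⟨t, -⟩
  · simp
  have : Nonempty X := ⟨f t⟩
  obtain ⟨m, hm⟩ := hI.bddBelow_image hf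
  obtain ⟨M, hM⟩ := hI.bddAbove_image hg
  have hbox : IsClosed (I ×ˢ Icc m M) := hI.isClosed.prod isClosed_Icc
  have hfbox : ContinuousOn (fun r : T × X => f r.1) (I ×ˢ Icc m M) :=
    hf.comp continuousOn_fst fun r hr => hr.1
  have hgbox : ContinuousOn (fun r : T × X => g r.1) (I ×ˢ Icc m M) :=
    hg.comp continuousOn_fst fun r hr => hr.1
  have hsub : {r : T × X | r.1 ∈ I ∧ r.2 ∈ Icc (f r.1) (g r.1)} ⊆ I ×ˢ Icc m M := fun r hr =>
    ⟨hr.1, (hm (mem_image_of_mem f hr.1)).trans hr.2.1, hr.2.2.trans (hM (mem_image_of_mem g hr.1))⟩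
  refine (hI.prod isCompact_Icc).of_isClosed_subset ?_ hsub
  convert (hbox.isClosed_le hfbox continuousOn_snd).inter
    (hbox.isClosed_le continuousOn_snd hgbox) using 1
  ext r
  exact ⟨fun hr => ⟨⟨hsub hr, hr.2.1⟩, hsub hr, hr.2.2⟩, fun hr => ⟨hr.1.1.1, hr.1.2, hr.2.2⟩⟩

theorem eventually_strictMonoOn_of_finite {ι : Type*} [LinearOrder X] [OrderClosedTopology X]
    {F : Set X} (hF : F.Finite) {l : Filter ι} {s : X → ι → X}
    (hs : ∀ z ∈ F, Tendsto (s z) l (𝓝 z)) :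
    ∀ᶠ t in l, StrictMonoOn (fun z => s z t) F := by
  simp only [StrictMonoOn, eventually_all_finite hF]
  intro z hz z' hz'
  by_cases hzz' : z < z'
  · exact ((hs z hz).eventually_lt (hs z' hz') hzz').mono fun t ht _ => ht
  · exact .of_forall fun t h => absurd h hzz'

/-- Two continuous sections `f ≤ g` over `I` of a local graph `Q`, such that the part of `Q`
between them is compact. -/
structure IsBand [LinearOrder X] (I : Set T) (Q : Set (T × X)) (f g : T → X) : Prop where
  isLocallyGraphOver : IsLocallyGraphOver I Q
  isCompact : IsCompact {r : T × X | r.1 ∈ I ∧ r.2 ∈ sliceBetween Q f g r.1}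
  continuousOn_left : ContinuousOn f I
  continuousOn_right : ContinuousOn g I
  le : ∀ t ∈ I, f t ≤ g t
  left_mem : ∀ t ∈ I, (t, f t) ∈ Q
  right_mem : ∀ t ∈ I, (t, g t) ∈ Q

namespace IsBand

variable [T2Space T] [LinearOrder X] [OrderClosedTopology X]

omit [OrderClosedTopology X] in
theorem eventually_sliceBetween_subset_image (h : IsBand I Q f g) {s : X → T → X}
    (hs : ∀ z ∈ sliceBetween Q f g t₀, IsLocalSection I Q t₀ z (s z)) :
    ∀ᶠ t in 𝓝[I] t₀, sliceBetween Q f g t ⊆ (fun z => s z t) '' sliceBetween Q f g t₀ := by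
  have hnear := eventually_forall_fiber_of_isCompact h.isCompact (t₀ := t₀)
    (P := fun r => ∃ z ∈ sliceBetween Q f g t₀, s z r.1 = r.2) fun z hz => ?_
  · filter_upwards [nhdsWithin_le_nhds hnear, self_mem_nhdsWithin] with t ht htI z hz
    exact ht z ⟨htI, hz⟩
  · have hprod : 𝓝[{r : T × X | r.1 ∈ I ∧ r.2 ∈ sliceBetween Q f g r.1}] (t₀, z) ≤
        𝓝[I] t₀ ×ˢ 𝓝 z := by
      rw [← nhdsWithin_univ z, ← nhdsWithin_prod_eq]
      exact nhdsWithin_mono _ fun r hr => ⟨hr.1, mem_univ _⟩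
    filter_upwards [hprod (hs z hz.2).eventually_mem_iff, self_mem_nhdsWithin] with r hr hrK
    exact ⟨z, hz.2, (hr.1 hrK.2.1).symm⟩

theorem eventually_ncard_sliceBetween_eq (h : IsBand I Q f g) (ht₀ : t₀ ∈ I) :
    ∀ᶠ t in 𝓝[I] t₀, (sliceBetween Q f g t).ncard = (sliceBetween Q f g t₀).ncard := by
  set F := sliceBetween Q f g t₀
  have hfin : F.Finite := finite_sliceBetween h.isLocallyGraphOver h.isCompact ht₀
  have hfF : f t₀ ∈ F := ⟨h.left_mem t₀ ht₀, le_rfl, h.le t₀ ht₀⟩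
  have hgF : g t₀ ∈ F := ⟨h.right_mem t₀ ht₀, h.le t₀ ht₀, le_rfl⟩
  have : Nonempty (T → X) := ⟨f⟩
  choose! s hs using fun z (hz : z ∈ F) => h.isLocallyGraphOver t₀ ht₀ z hz.1
  have hmem : ∀ᶠ t in 𝓝[I] t₀, ∀ z ∈ F, (t, s z t) ∈ Q :=
    (eventually_all_finite hfin).2 fun z hz => (hs z hz).eventually_mem
  have hmono : ∀ᶠ t in 𝓝[I] t₀, StrictMonoOn (fun z => s z t) F :=
    eventually_strictMonoOn_of_finite hfin fun z hz => by
      simpa only [(hs z hz).apply_eq] using (hs z hz).continuousWithinAt.tendsto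
  filter_upwards [hmem, hmono, h.eventually_sliceBetween_subset_image hs,
    (hs _ hfF).eventually_eq (h.continuousOn_left t₀ ht₀) rfl h.left_mem,
    (hs _ hgF).eventually_eq (h.continuousOn_right t₀ ht₀) rfl h.right_mem]
    with t hmem hmono hsub hf hg
  have himage : sliceBetween Q f g t = (fun z => s z t) '' F := by
    refine hsub.antisymm (image_subset_iff.2 fun z hz => ⟨hmem z hz, ?_, ?_⟩)
    · exact hf.trans_le (hmono.monotoneOn hfF hz hz.2.1)
    · exact (hmono.monotoneOn hz hgF hz.2.2).trans_eq hg.symm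
  rw [himage, hmono.injOn.ncard_image]

theorem ncard_sliceBetween_eq (h : IsBand I Q f g) (hI : IsPreconnected I) {a b : T} (ha : a ∈ I)
    (hb : b ∈ I) : (sliceBetween Q f g a).ncard = (sliceBetween Q f g b).ncard :=
  hI.constant (f := fun t => (sliceBetween Q f g t).ncard) (fun _ ht =>
    continuousWithinAt_const.congr_of_eventuallyEq (h.eventually_ncard_sliceBetween_eq ht) rfl)
    ha hb

omit [T2Space T] [OrderClosedTopology X] in
theorem signedCount_eq_ncard_sub_one (h : IsBand I Q f g) {t : T} (ht : t ∈ I) :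
    signedCount {z | (t, z) ∈ Q} (f t) (g t) = ((sliceBetween Q f g t).ncard - 1 : ℕ) := by
  rw [signedCount_of_le (h.le t ht), ← ncard_sdiff_singleton_of_mem
    (show g t ∈ sliceBetween Q f g t from ⟨h.right_mem t ht, h.le t ht, le_rfl⟩),
    sliceBetween, inter_sdiff_assoc, Icc_sdiff_right]

theorem signedCount_eq (h : IsBand I Q f g) (hI : IsPreconnected I) {a b : T} (ha : a ∈ I)
    (hb : b ∈ I) :
    signedCount {z | (a, z) ∈ Q} (f a) (g a) = signedCount {z | (b, z) ∈ Q} (f b) (g b) := by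
  rw [h.signedCount_eq_ncard_sub_one ha, h.signedCount_eq_ncard_sub_one hb,
    h.ncard_sliceBetween_eq hI ha hb]

end IsBand

end GraphFamily

section NormalFrame

theorem continuousWithinAt_totalSpace_smul {X B F 𝕜 : Type*} {E : B → Type*} [TopologicalSpace X]
    [TopologicalSpace B] [NontriviallyNormedField 𝕜] [NormedAddCommGroup F] [NormedSpace 𝕜 F]
    [TopologicalSpace (TotalSpace F E)] [∀ b, TopologicalSpace (E b)] [∀ b, AddCommGroup (E b)]
    [∀ b, Module 𝕜 (E b)] [FiberBundle F E] [VectorBundle 𝕜 F E] {s : Set X} {x₀ : X} {ζ : X → 𝕜}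
    {v : X → TotalSpace F E} (hζ : ContinuousWithinAt ζ s x₀) (hv : ContinuousWithinAt v s x₀) :
    ContinuousWithinAt (fun x => (⟨(v x).proj, ζ x • (v x).2⟩ : TotalSpace F E)) s x₀ := by
  rw [FiberBundle.continuousWithinAt_totalSpace] at hv ⊢
  refine ⟨hv.1, ?_⟩
  set e := trivializationAt F E (v x₀).proj
  have hbase : ∀ {x : X}, (v x).proj ∈ e.baseSet →
      (e ⟨(v x).proj, ζ x • (v x).2⟩).2 = ζ x • (e (v x)).2 := fun hx =>
    (e.linear 𝕜 hx).map_smul _ _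
  refine (hζ.smul hv.2).congr_of_eventuallyEq ?_ (hbase (mem_baseSet_trivializationAt F E _))
  filter_upwards [hv.1.eventually
    (e.open_baseSet.mem_nhds (mem_baseSet_trivializationAt F E _))] with x hx using hbase hx

variable {Ω : Type*} [TopologicalSpace Ω] [ChartedSpace E3 Ω] [IsManifold (𝓡 3) ∞ Ω]

/-- The multiple `z • ν x` of the vector field `ν`, as a tangent vector at `x`. -/
noncomputable def frameVec (ν : (x : Ω) → TangentSpace (𝓡 3) x) (x : Ω) (z : ℝ) :
    TangentBundle (𝓡 3) Ω :=
  ⟨x, z • ν x⟩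

theorem continuousWithinAt_frameVec {ν : (x : Ω) → TangentSpace (𝓡 3) x} {U : Set Ω}
    (hν : ContinuousOn (fun x => (⟨x, ν x⟩ : TangentBundle (𝓡 3) Ω)) U) {X : Type*}
    [TopologicalSpace X] {s : Set X} {x₀ : X} {c : X → Ω} {ζ : X → ℝ}
    (hc : ContinuousWithinAt c s x₀) (hcU : MapsTo c s U) (hx₀ : x₀ ∈ s)
    (hζ : ContinuousWithinAt ζ s x₀) :
    ContinuousWithinAt (fun x => frameVec ν (c x) (ζ x)) s x₀ :=
  continuousWithinAt_totalSpace_smul hζ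
    (ContinuousWithinAt.comp (f := c) (hν _ (hcU hx₀)) hc hcU)

variable [RiemannianBundle (fun x : Ω => TangentSpace (𝓡 3) x)]

/-- `ν` is a continuous nowhere vanishing normal vector field of `S` over `U`. -/
structure IsNormalFrame (S U : Set Ω) (ν : (x : Ω) → TangentSpace (𝓡 3) x) : Prop where
  continuousOn : ContinuousOn (fun x => (⟨x, ν x⟩ : TangentBundle (𝓡 3) Ω)) U
  mem_normalSet : ∀ x ∈ U, (⟨x, ν x⟩ : TangentBundle (𝓡 3) Ω) ∈ normalSet S
  ne_zero : ∀ x ∈ U, ν x ≠ 0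

omit [IsManifold (𝓡 3) ∞ Ω] in
theorem smul_mem_normalSet {S : Set Ω} {x : Ω} {v : TangentSpace (𝓡 3) x}
    (hv : (⟨x, v⟩ : TangentBundle (𝓡 3) Ω) ∈ normalSet S) (z : ℝ) :
    (⟨x, z • v⟩ : TangentBundle (𝓡 3) Ω) ∈ normalSet S :=
  ⟨hv.1, fun w hw => (real_inner_smul_left _ _ _).trans (mul_eq_zero_of_right z (hv.2 w hw))⟩

namespace IsNormalFrame

variable {S U : Set Ω} {ν : (x : Ω) → TangentSpace (𝓡 3) x} {ε : ℝ}

theorem frameVec_mem_normalDisc (hν : IsNormalFrame S U ν) {x : Ω} (hx : x ∈ U) {z : ℝ}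
    (hz : |z| * ‖ν x‖ < ε) : frameVec ν x z ∈ normalDisc S U ε := by
  refine ⟨smul_mem_normalSet (hν.mem_normalSet x hx) z, hx, ?_⟩
  change ‖z • ν x‖ < ε
  rwa [norm_smul, Real.norm_eq_abs]

theorem exists_eq_frameVec (hν : IsNormalFrame S U ν) (hS : IsEmbeddedSurface S)
    {v : TangentBundle (𝓡 3) Ω} (hv : v ∈ normalDisc S U ε) :
    ∃ z : ℝ, |z| * ‖ν v.proj‖ < ε ∧ v = frameVec ν v.proj z := by
  obtain ⟨x, v⟩ := v
  obtain ⟨hvS, hxU, hvε⟩ := hv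
  have hmul := eq_smul_of_mem_normalSet hS (hν.mem_normalSet x hxU) (hν.ne_zero x hxU) hvS
  refine ⟨inner ℝ v (ν x) / inner ℝ (ν x) (ν x), ?_, congrArg (TotalSpace.mk x) hmul⟩
  rw [← Real.norm_eq_abs, ← norm_smul, ← hmul]
  exact hvε

theorem continuousOn_norm [IsContinuousRiemannianBundle E3 (fun x : Ω => TangentSpace (𝓡 3) x)]
    (hν : IsNormalFrame S U ν) : ContinuousOn (fun x => ‖ν x‖) U :=
  (hν.continuousOn.inner_bundle hν.continuousOn).sqrt.congr fun _ _ =>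
    norm_eq_sqrt_real_inner _

end IsNormalFrame

end NormalFrame

section FramedCover

variable {Ω : Type*} [TopologicalSpace Ω] [ChartedSpace E3 Ω] [IsManifold (𝓡 3) ∞ Ω]
  [RiemannianBundle (fun x : Ω => TangentSpace (𝓡 3) x)]

/-- A connected `δ`-graph `carrier` over `U`, together with the data that witness it: the radius of
the tube that contains it, a regular domain `dom` and a normal frame `ν` of `S` over `U`. -/
structure FramedCover (S U : Set Ω) (δ : ℝ) where
  radius : ℝ
  dom : Set (TangentBundle (𝓡 3) Ω)
  carrier : Set Ω
  ν : (x : Ω) → TangentSpace (𝓡 3) x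
  isEmbeddedSurface : IsEmbeddedSurface S
  isDeltaGraphIn : IsDeltaGraphIn S U δ radius dom carrier
  isPreconnected : IsPreconnected carrier
  isNormalFrame : IsNormalFrame S U ν
  delta_pos : 0 < δ
  delta_lt_one : δ < 1
  radius_pos : 0 < radius

namespace FramedCover

variable {S U : Set Ω} {δ : ℝ} (H : FramedCover S U δ)

theorem isRegularDomain : IsRegularDomain S H.dom := H.isDeltaGraphIn.1

theorem normalDisc_subset : normalDisc S U H.radius ⊆ H.dom := H.isDeltaGraphIn.2.1

theorem tube_subset : tube S U H.radius ⊆ expMap '' H.dom := image_mono H.normalDisc_subset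

theorem carrier_subset_tube : H.carrier ⊆ tube S U H.radius :=
  H.isDeltaGraphIn.2.2.2.1.elim And.left fun h => h.1.trans sdiff_subset

theorem carrier_subset : H.carrier ⊆ expMap '' H.dom := H.carrier_subset_tube.trans H.tube_subset

theorem isEmbeddedSurface_carrier : IsEmbeddedSurface H.carrier := H.isDeltaGraphIn.2.2.1

theorem isParallel {v : TangentBundle (𝓡 3) Ω} (hv : v ∈ tangentSet H.carrier) :
    IsParallel H.dom δ v := H.isDeltaGraphIn.2.2.2.2 v hv

/-- The foot point of `y` on `S`. -/
noncomputable def foot (y : Ω) : Ω := footMap H.dom y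

/-- The signed height of `y` above `S`, measured in multiples of the normal frame. -/
noncomputable def height (y : Ω) : ℝ :=
  inner ℝ (normalLog H.dom y).2 (H.ν (normalLog H.dom y).proj) /
    inner ℝ (H.ν (normalLog H.dom y).proj) (H.ν (normalLog H.dom y).proj)

/-- The point at height `z` above `x`. -/
noncomputable def point (x : Ω) (z : ℝ) : Ω := expMap (frameVec H.ν x z)

/-- The heights of the points of the tube above `x`. -/
def fibre (x : Ω) : Set ℝ := {z | |z| * ‖H.ν x‖ < H.radius}

/-- The heights of the points of the cover above `x`. -/
def sheetHeights (x : Ω) : Set ℝ := {z | z ∈ H.fibre x ∧ H.point x z ∈ H.carrier}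

/-- The points of the cover above `x`. -/
def pointsOver (x : Ω) : Set Ω := {y | y ∈ H.carrier ∧ H.foot y = x}

/-- The signed number of sheets of the cover crossed when one moves along a fibre from `y` to `y'`.
It only has a meaning for two points of the cover over the same point. -/
noncomputable def sheetCount (y y' : Ω) : ℤ :=
  signedCount (H.sheetHeights (H.foot y)) (H.height y) (H.height y')

theorem zero_mem_fibre (x : Ω) : 0 ∈ H.fibre x := by
  simpa only [fibre, mem_ofPred_eq, abs_zero, zero_mul] using H.radius_pos

theorem ordConnected_fibre (x : Ω) : (H.fibre x).OrdConnected := by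
  refine ⟨fun a ha b hb z hz => ?_⟩
  rcases le_max_iff.1 (abs_le_max_abs_abs hz.1 hz.2) with h | h
  · exact (mul_le_mul_of_nonneg_right h (norm_nonneg _)).trans_lt ha
  · exact (mul_le_mul_of_nonneg_right h (norm_nonneg _)).trans_lt hb

variable {H} {x y : Ω} {z : ℝ}

theorem frameVec_mem_dom (hx : x ∈ U) (hz : z ∈ H.fibre x) : frameVec H.ν x z ∈ H.dom :=
  H.normalDisc_subset (H.isNormalFrame.frameVec_mem_normalDisc hx hz)

theorem point_mem_tube (hx : x ∈ U) (hz : z ∈ H.fibre x) : H.point x z ∈ tube S U H.radius :=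
  mem_image_of_mem _ (H.isNormalFrame.frameVec_mem_normalDisc hx hz)

theorem foot_point (hx : x ∈ U) (hz : z ∈ H.fibre x) : H.foot (H.point x z) = x :=
  H.isRegularDomain.footMap_expMap (frameVec_mem_dom hx hz)

theorem height_point (hx : x ∈ U) (hz : z ∈ H.fibre x) : H.height (H.point x z) = z := by
  rw [height, point, H.isRegularDomain.normalLog_expMap (frameVec_mem_dom hx hz)]
  change inner ℝ (z • H.ν x) (H.ν x) / inner ℝ (H.ν x) (H.ν x) = z
  rw [real_inner_smul_left,
    mul_div_cancel_right₀ _ (inner_self_eq_zero.not.2 (H.isNormalFrame.ne_zero x hx))]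

theorem exists_eq_point (hy : y ∈ tube S U H.radius) :
    ∃ x ∈ U, ∃ z ∈ H.fibre x, y = H.point x z := by
  obtain ⟨v, hv, rfl⟩ := hy
  obtain ⟨z, hz, hvz⟩ := H.isNormalFrame.exists_eq_frameVec H.isEmbeddedSurface hv
  exact ⟨v.proj, hv.2.1, z, hz, congrArg expMap hvz⟩

theorem foot_mem (hy : y ∈ tube S U H.radius) : H.foot y ∈ U := by
  obtain ⟨x, hx, z, hz, rfl⟩ := exists_eq_point hy
  rwa [foot_point hx hz]

theorem height_mem_fibre (hy : y ∈ tube S U H.radius) : H.height y ∈ H.fibre (H.foot y) := by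
  obtain ⟨x, hx, z, hz, rfl⟩ := exists_eq_point hy
  rwa [foot_point hx hz, height_point hx hz]

theorem point_foot_height (hy : y ∈ tube S U H.radius) : H.point (H.foot y) (H.height y) = y := by
  obtain ⟨x, hx, z, hz, rfl⟩ := exists_eq_point hy
  rw [foot_point hx hz, height_point hx hz]

theorem foot_mem_of_mem_carrier (hy : y ∈ H.carrier) : H.foot y ∈ U :=
  foot_mem (H.carrier_subset_tube hy)

theorem height_mem_sheetHeights (hy : y ∈ H.carrier) :
    H.height y ∈ H.sheetHeights (H.foot y) :=
  ⟨height_mem_fibre (H.carrier_subset_tube hy),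
    by rwa [point_foot_height (H.carrier_subset_tube hy)]⟩

theorem eq_of_foot_eq_of_height_eq {y' : Ω} (hy : y ∈ H.carrier) (hy' : y' ∈ H.carrier)
    (hfoot : H.foot y = H.foot y') (hheight : H.height y = H.height y') : y = y' := by
  rw [← point_foot_height (H.carrier_subset_tube hy), hfoot, hheight,
    point_foot_height (H.carrier_subset_tube hy')]

theorem contMDiffAt_foot (hy : y ∈ H.carrier) : ContMDiffAt (𝓡 3) (𝓡 3) ∞ H.foot y :=
  H.isRegularDomain.contMDiffAt_footMap (H.carrier_subset hy)

theorem continuousOn_foot_comp {X : Type*} [TopologicalSpace X] {l : X → Ω} {I : Set X}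
    (hl : ContinuousOn l I) (hlG : MapsTo l I H.carrier) :
    ContinuousOn (fun t => H.foot (l t)) I := fun t ht =>
  (contMDiffAt_foot (hlG ht)).continuousAt.comp_continuousWithinAt (hl t ht)

theorem exists_section (hy : y ∈ H.carrier) :
    ∃ σ : Ω → Ω, ContMDiffAt (𝓡 3) (𝓡 3) ∞ σ (H.foot y) ∧
      (∀ᶠ y' in 𝓝 y, y' ∈ H.carrier → σ (H.foot y') = y') ∧
      ∀ᶠ x in 𝓝 (H.foot y), x ∈ S → σ x ∈ H.carrier ∧ H.foot (σ x) = x :=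
  exists_local_section H.isEmbeddedSurface H.isRegularDomain H.isEmbeddedSurface_carrier
    H.delta_pos H.delta_lt_one (fun _ => H.isParallel) hy (H.carrier_subset hy)

theorem contMDiffOn_of_foot_comp {E' H' M : Type*} [NormedAddCommGroup E'] [NormedSpace ℝ E']
    [TopologicalSpace H'] {I' : ModelWithCorners ℝ E' H'} [TopologicalSpace M] [ChartedSpace H' M]
    {l : M → Ω} {J : Set M} (hl : ContinuousOn l J) (hlG : MapsTo l J H.carrier)
    (hfoot : ContMDiffOn I' (𝓡 3) ∞ (fun t => H.foot (l t)) J) :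
    ContMDiffOn I' (𝓡 3) ∞ l J := by
  intro t ht
  obtain ⟨σ, hσ, hσG, -⟩ := exists_section (hlG ht)
  have hlσ : ∀ᶠ s in 𝓝[J] t, l s = σ (H.foot (l s)) := by
    filter_upwards [(hl t ht).eventually hσG, self_mem_nhdsWithin] with s hs hsJ
    exact (hs (hlG hsJ)).symm
  exact (hσ.comp_contMDiffWithinAt t (hfoot t ht)).congr_of_eventuallyEq hlσ
    (hlσ.self_of_nhdsWithin ht)

theorem eventually_eq_of_foot_eq {X : Type*} [TopologicalSpace X] {l m : X → Ω} {I : Set X}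
    {t : X} (hl : ContinuousWithinAt l I t) (hm : ContinuousWithinAt m I t)
    (hlG : MapsTo l I H.carrier) (hmG : MapsTo m I H.carrier)
    (hlm : ∀ s ∈ I, H.foot (l s) = H.foot (m s)) (ht : t ∈ I) (heq : l t = m t) :
    ∀ᶠ s in 𝓝[I] t, l s = m s := by
  obtain ⟨σ, -, hσ, -⟩ := exists_section (hlG ht)
  filter_upwards [hl.eventually hσ, hm.eventually (heq ▸ hσ), self_mem_nhdsWithin]
    with s hls hms hs
  rw [← hls (hlG hs), ← hms (hmG hs), hlm s hs]

theorem eqOn_of_foot_eq [T2Space Ω] {X : Type*} [TopologicalSpace X] {l m : X → Ω} {I : Set X}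
    (hI : IsPreconnected I) (hl : ContinuousOn l I) (hm : ContinuousOn m I)
    (hlG : MapsTo l I H.carrier) (hmG : MapsTo m I H.carrier)
    (hlm : ∀ t ∈ I, H.foot (l t) = H.foot (m t)) {t₀ : X} (ht₀ : t₀ ∈ I) (heq : l t₀ = m t₀) :
    EqOn l m I := by
  classical
  have hlocal : ContinuousOn (fun t => decide (l t = m t)) I := by
    intro t ht
    refine continuousWithinAt_const.congr_of_eventuallyEq ?_ rfl
    by_cases h : l t = m t
    · filter_upwards [eventually_eq_of_foot_eq (hl t ht) (hm t ht) hlG hmG hlm ht h] with s hs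
      simp only [hs, h]
    · filter_upwards [((hl t ht).prodMk (hm t ht)).eventually
        (isClosed_diagonal.isOpen_compl.mem_nhds h)] with s hs
      exact decide_eq_decide.2 (iff_of_false hs h)
  exact fun t ht => (decide_eq_decide.1 (hI.constant hlocal ht ht₀)).2 heq

theorem point_zero [IsContMDiffRiemannianBundle (𝓡 3) ∞ E3 (fun x : Ω => TangentSpace (𝓡 3) x)]
    [T2Space Ω] (hx : x ∈ U) : H.point x 0 = x := by
  have hvec : frameVec H.ν x 0 = ⟨x, 0⟩ := congrArg (TotalSpace.mk x) (zero_smul ℝ (H.ν x))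
  have hdom := H.isRegularDomain.2.1 (frameVec_mem_dom hx (H.zero_mem_fibre x))
  rw [point, hvec]
  exact expMap_zero (hvec ▸ hdom)

theorem height_eq_zero_iff
    [IsContMDiffRiemannianBundle (𝓡 3) ∞ E3 (fun x : Ω => TangentSpace (𝓡 3) x)] [T2Space Ω]
    (hy : y ∈ tube S U H.radius) : H.height y = 0 ↔ y ∈ U := by
  constructor
  · intro hzero
    rw [← point_foot_height hy, hzero, point_zero (foot_mem hy)]
    exact foot_mem hy
  · intro hyU
    rw [← point_zero (H := H) hyU, height_point hyU (H.zero_mem_fibre y)]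

theorem mem_sheetHeights_iff (hy : y ∈ H.carrier) (hyx : H.foot y = x)
    (hz : z ∈ H.sheetHeights x → H.point x z = y) : z ∈ H.sheetHeights x ↔ z = H.height y := by
  constructor
  · intro hzx
    rw [← hz hzx, height_point (hyx ▸ foot_mem_of_mem_carrier hy) hzx.1]
  · rintro rfl
    exact hyx ▸ height_mem_sheetHeights hy

/-- The sheets of the cover above the map `c`: the pairs `(t, z)` such that `z` is the height of a
point of the cover above `c t`. -/
def sheetsOver (H : FramedCover S U δ) {X : Type*} (c : X → Ω) : Set (X × ℝ) :=
  {r | r.2 ∈ H.sheetHeights (c r.1)}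

variable [IsContMDiffRiemannianBundle (𝓡 3) ∞ E3 (fun x : Ω => TangentSpace (𝓡 3) x)]

variable (H) in
theorem continuousOn_height : ContinuousOn H.height (tube S U H.radius) := by
  have hlog : ContinuousOn (normalLog H.dom) (tube S U H.radius) :=
    H.isRegularDomain.contMDiffOn_normalLog.continuousOn.mono H.tube_subset
  have hproj : ContinuousOn (fun y => (normalLog H.dom y).proj) (tube S U H.radius) :=
    (FiberBundle.continuous_proj E3 (TangentSpace (𝓡 3) : Ω → Type _)).comp_continuousOn hlog
  have hmaps : MapsTo (fun y => (normalLog H.dom y).proj) (tube S U H.radius) U := fun y hy => by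
    simpa only [proj_normalLog, foot] using foot_mem hy
  have hν := H.isNormalFrame.continuousOn.comp hproj hmaps
  exact (hlog.inner_bundle hν).div (hν.inner_bundle hν) fun y hy =>
    inner_self_eq_zero.not.2 (H.isNormalFrame.ne_zero _ (hmaps hy))

theorem continuousWithinAt_point {X : Type*} [TopologicalSpace X] {s : Set X} {x₀ : X}
    {c : X → Ω} {ζ : X → ℝ} (hc : ContinuousWithinAt c s x₀) (hcU : MapsTo c s U) (hx₀ : x₀ ∈ s)
    (hζ : ContinuousWithinAt ζ s x₀) (hmem : ζ x₀ ∈ H.fibre (c x₀)) :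
    ContinuousWithinAt (fun x => H.point (c x) (ζ x)) s x₀ := by
  have hvec := continuousWithinAt_frameVec H.isNormalFrame.continuousOn hc hcU hx₀ hζ
  have hnorm : ContinuousWithinAt (fun x => |ζ x| * ‖H.ν (c x)‖) s x₀ :=
    hζ.abs.mul (ContinuousWithinAt.comp (f := c)
      (H.isNormalFrame.continuousOn_norm _ (hcU hx₀)) hc hcU)
  have hdom : ∀ᶠ x in 𝓝[s] x₀, frameVec H.ν (c x) (ζ x) ∈ H.dom := by
    filter_upwards [hnorm.eventually (gt_mem_nhds hmem), self_mem_nhdsWithin] with x hx hxs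
    exact frameVec_mem_dom (hcU hxs) hx
  exact Tendsto.comp (H.isRegularDomain.2.2.1.continuousOn _ (frameVec_mem_dom (hcU hx₀) hmem))
    (tendsto_nhdsWithin_iff.2 ⟨hvec, hdom⟩)

theorem mem_sheetHeights_of_mem_closure [T2Space Ω]
    {z₁ z₂ : ℝ} (hx : x ∈ U) (h₁ : z₁ ∈ H.sheetHeights x) (h₂ : z₂ ∈ H.sheetHeights x)
    (hz : z ∈ Icc z₁ z₂) (hcl : H.point x z ∈ closure H.carrier) : z ∈ H.sheetHeights x := by
  have hfib : z ∈ H.fibre x := (H.ordConnected_fibre x).out h₁.1 h₂.1 hz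
  refine ⟨hfib, ?_⟩
  have htube := point_mem_tube hx hfib
  rcases H.isDeltaGraphIn.2.2.2.1 with ⟨-, hclosed⟩ | ⟨hsub, hclosed⟩
  · exact hclosed ⟨hcl, htube⟩
  · refine hclosed ⟨hcl, htube, fun hU => ?_⟩
    have hz₀ : z = 0 := by rw [← height_point hx hfib, (height_eq_zero_iff htube).2 hU]
    have hconn : IsPreconnected (H.height '' H.carrier) := H.isPreconnected.image _
      (H.continuousOn_height.mono H.carrier_subset_tube)
    obtain ⟨y, hy, hy₀⟩ : z ∈ H.height '' H.carrier := hconn.ordConnected.out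
      ⟨_, h₁.2, height_point hx h₁.1⟩ ⟨_, h₂.2, height_point hx h₂.1⟩ hz
    exact (hsub hy).2 ((height_eq_zero_iff (hsub hy).1).1 (hy₀.trans hz₀))

variable {X : Type*} [TopologicalSpace X] {I : Set X} {c : X → Ω}

theorem isLocallyGraphOver (hc : ContinuousOn c I) (hcU : MapsTo c I U) :
    IsLocallyGraphOver I (H.sheetsOver c) := by
  rintro t₀ ht₀ z₀ ⟨hz₀, hz₀G⟩
  obtain ⟨σ, hσ, hσG, hGσ⟩ := exists_section hz₀G
  have hσz₀ : σ (c t₀) = H.point (c t₀) z₀ := by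
    simpa only [foot_point (hcU ht₀) hz₀] using hσG.self_of_nhds hz₀G
  rw [foot_point (hcU ht₀) hz₀] at hσ hGσ
  have hσc : ∀ᶠ t in 𝓝[I] t₀, σ (c t) ∈ H.carrier ∧ H.foot (σ (c t)) = c t := by
    filter_upwards [(hc t₀ ht₀).eventually hGσ, self_mem_nhdsWithin] with t ht htI
    exact ht (H.isNormalFrame.mem_normalSet _ (hcU htI)).1
  refine ⟨fun t => H.height (σ (c t)), ?_, ?_, ?_⟩
  · exact Tendsto.comp (H.continuousOn_height _ (hσz₀ ▸ point_mem_tube (hcU ht₀) hz₀))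
      (tendsto_nhdsWithin_iff.2 ⟨hσ.continuousAt.comp_continuousWithinAt (hc t₀ ht₀),
        hσc.mono fun t ht => H.carrier_subset_tube ht.1⟩)
  · rw [hσz₀, height_point (hcU ht₀) hz₀]
  · have hpoint : ContinuousWithinAt (fun r : X × ℝ => H.point (c r.1) r.2) (I ×ˢ univ) (t₀, z₀) :=
      continuousWithinAt_point (c := fun r : X × ℝ => c r.1)
        ((hc t₀ ht₀).comp continuousWithinAt_fst fun r hr => hr.1) (fun r hr => hcU hr.1)
        ⟨ht₀, mem_univ _⟩ continuousWithinAt_snd hz₀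
    rw [ContinuousWithinAt, nhdsWithin_prod_eq, nhdsWithin_univ] at hpoint
    filter_upwards [hpoint.eventually hσG, hσc.prod_inl _, eventually_mem_nhdsWithin.prod_inl _]
      with r hr hσr hrI
    refine mem_sheetHeights_iff hσr.1 hσr.2 fun hz => ?_
    rw [← hr hz.2, foot_point (hcU hrI) hz.1]

variable [T2Space Ω]

theorem isCompact_sliceBetween_sheetsOver [T2Space X] (hI : IsCompact I) (hc : ContinuousOn c I)
    (hcU : MapsTo c I U) {f g : X → ℝ} (hf : ContinuousOn f I) (hg : ContinuousOn g I)
    (hfH : ∀ t ∈ I, f t ∈ H.sheetHeights (c t)) (hgH : ∀ t ∈ I, g t ∈ H.sheetHeights (c t)) :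
    IsCompact {r : X × ℝ | r.1 ∈ I ∧ r.2 ∈ sliceBetween (H.sheetsOver c) f g r.1} := by
  set strip : Set (X × ℝ) := {r | r.1 ∈ I ∧ r.2 ∈ Icc (f r.1) (g r.1)}
  have hstrip : IsCompact strip := isCompact_setOf_mem_Icc hI hf hg
  have hpoint : ContinuousOn (fun r : X × ℝ => H.point (c r.1) r.2) strip := fun r hr =>
    continuousWithinAt_point (c := fun r : X × ℝ => c r.1)
      ((hc _ hr.1).comp continuousWithinAt_fst fun r hr => hr.1) (fun r hr => hcU hr.1) hr
      continuousWithinAt_snd ((H.ordConnected_fibre _).out (hfH _ hr.1).1 (hgH _ hr.1).1 hr.2)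
  refine hstrip.of_isClosed_subset (?_ : IsClosed _) fun r hr => ⟨hr.1, hr.2.2⟩
  convert hpoint.preimage_isClosed_of_isClosed hstrip.isClosed (isClosed_closure (s := H.carrier))
    using 1
  ext ⟨t, z⟩
  constructor
  · rintro ⟨ht, hz, hfg⟩
    exact ⟨⟨ht, hfg⟩, subset_closure hz.2⟩
  · rintro ⟨⟨ht, hfg⟩, hcl⟩
    have hz : z ∈ H.sheetHeights (c t) :=
      mem_sheetHeights_of_mem_closure (hcU ht) (hfH t ht) (hgH t ht) hfg hcl
    exact ⟨ht, hz, hfg⟩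

theorem finite_sheetHeights_inter_Icc {a b : ℝ} (hx : x ∈ U) (ha : a ∈ H.sheetHeights x)
    (hb : b ∈ H.sheetHeights x) : (H.sheetHeights x ∩ Icc a b).Finite :=
  finite_sliceBetween (T := Unit) (I := univ) (t := ()) (f := fun _ => a) (g := fun _ => b)
    (isLocallyGraphOver (c := fun _ => x) continuousOn_const fun _ _ => hx)
    (isCompact_sliceBetween_sheetsOver isCompact_univ continuousOn_const (fun _ _ => hx)
      continuousOn_const continuousOn_const (fun _ _ => ha) fun _ _ => hb) (mem_univ _)

variable {l m : X → Ω}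

omit [T2Space Ω] in
theorem continuousOn_height_comp (hl : ContinuousOn l I) (hlG : MapsTo l I H.carrier) :
    ContinuousOn (fun t => H.height (l t)) I :=
  H.continuousOn_height.comp hl fun _ ht => H.carrier_subset_tube (hlG ht)

theorem isBand [T2Space X] (hI : IsCompact I) (hl : ContinuousOn l I) (hm : ContinuousOn m I)
    (hlG : MapsTo l I H.carrier) (hmG : MapsTo m I H.carrier)
    (hlm : ∀ t ∈ I, H.foot (l t) = H.foot (m t)) (hle : ∀ t ∈ I, H.height (l t) ≤ H.height (m t)) :
    IsBand I (H.sheetsOver fun t => H.foot (l t)) (fun t => H.height (l t))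
      (fun t => H.height (m t)) := by
  have hU : MapsTo (fun t => H.foot (l t)) I U := fun t ht => foot_mem_of_mem_carrier (hlG ht)
  have hlH : ∀ t ∈ I, H.height (l t) ∈ H.sheetHeights (H.foot (l t)) := fun t ht =>
    height_mem_sheetHeights (hlG ht)
  have hmH : ∀ t ∈ I, H.height (m t) ∈ H.sheetHeights (H.foot (l t)) := fun t ht =>
    hlm t ht ▸ height_mem_sheetHeights (hmG ht)
  have hfoot := continuousOn_foot_comp hl hlG
  have hhl := continuousOn_height_comp hl hlG
  have hhm := continuousOn_height_comp hm hmG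
  exact ⟨isLocallyGraphOver hfoot hU,
    isCompact_sliceBetween_sheetsOver hI hfoot hU hhl hhm hlH hmH, hhl, hhm, hle, hlH, hmH⟩

theorem height_le_or_le (hI : IsPreconnected I) (hl : ContinuousOn l I) (hm : ContinuousOn m I)
    (hlG : MapsTo l I H.carrier) (hmG : MapsTo m I H.carrier)
    (hlm : ∀ t ∈ I, H.foot (l t) = H.foot (m t)) :
    (∀ t ∈ I, H.height (l t) ≤ H.height (m t)) ∨ ∀ t ∈ I, H.height (m t) ≤ H.height (l t) := by
  by_contra! h
  obtain ⟨⟨s, hs, hlt⟩, t, ht, hgt⟩ := h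
  obtain ⟨u, hu, hlmu⟩ := hI.intermediate_value₂ hs ht (continuousOn_height_comp hm hmG)
    (continuousOn_height_comp hl hlG) hlt.le hgt.le
  have heq := eqOn_of_foot_eq hI hl hm hlG hmG hlm hu
    (eq_of_foot_eq_of_height_eq (hlG hu) (hmG hu) (hlm u hu) hlmu.symm)
  exact hlt.ne (congrArg H.height (heq hs).symm)

theorem sheetCount_comp_eq [T2Space X] (hI : IsCompact I) (hI' : IsPreconnected I)
    (hl : ContinuousOn l I) (hm : ContinuousOn m I) (hlG : MapsTo l I H.carrier)
    (hmG : MapsTo m I H.carrier) (hlm : ∀ t ∈ I, H.foot (l t) = H.foot (m t)) {a b : X}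
    (ha : a ∈ I) (hb : b ∈ I) : H.sheetCount (l a) (m a) = H.sheetCount (l b) (m b) := by
  rcases height_le_or_le hI' hl hm hlG hmG hlm with hle | hle
  · exact (isBand hI hl hm hlG hmG hlm hle).signedCount_eq hI' ha hb
  · rw [sheetCount, sheetCount, signedCount_swap, signedCount_swap (H.height (l b)), hlm a ha,
      hlm b hb]
    exact congrArg Neg.neg ((isBand hI hm hl hmG hlG (fun t ht => (hlm t ht).symm)
      hle).signedCount_eq hI' ha hb)

theorem finite_sheetHeights_inter_Ico (hx : x ∈ U) :
    ∀ a ∈ H.sheetHeights x, ∀ b ∈ H.sheetHeights x, (H.sheetHeights x ∩ Ico a b).Finite :=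
  fun _ ha _ hb => (finite_sheetHeights_inter_Icc hx ha hb).subset
    (inter_subset_inter_right _ Ico_subset_Icc_self)

variable {y₁ y₂ y₃ : Ω}

theorem sheetCount_add (h₁ : y₁ ∈ H.pointsOver x) (h₂ : y₂ ∈ H.pointsOver x)
    (h₃ : y₃ ∈ H.pointsOver x) :
    H.sheetCount y₁ y₂ + H.sheetCount y₂ y₃ = H.sheetCount y₁ y₃ := by
  rw [sheetCount, sheetCount, sheetCount, h₁.2, h₂.2]
  exact signedCount_add (finite_sheetHeights_inter_Ico (h₁.2 ▸ foot_mem_of_mem_carrier h₁.1))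
    (h₁.2 ▸ height_mem_sheetHeights h₁.1) (h₂.2 ▸ height_mem_sheetHeights h₂.1)
    (h₃.2 ▸ height_mem_sheetHeights h₃.1)

theorem eq_of_sheetCount_eq_zero (h₁ : y₁ ∈ H.pointsOver x) (h₂ : y₂ ∈ H.pointsOver x)
    (h : H.sheetCount y₁ y₂ = 0) : y₁ = y₂ := by
  have hfoot : H.foot y₁ = H.foot y₂ := h₁.2.trans h₂.2.symm
  exact eq_of_foot_eq_of_height_eq h₁.1 h₂.1 hfoot <| eq_of_signedCount_eq_zero
    (finite_sheetHeights_inter_Ico (foot_mem_of_mem_carrier h₁.1)) (height_mem_sheetHeights h₁.1)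
    (hfoot ▸ height_mem_sheetHeights h₂.1) h

end FramedCover

end FramedCover

section Curves

variable {Ω : Type*}

theorem concatCurve_of_le (c d : ℝ → Ω) {t : ℝ} (ht : t ≤ 1 / 2) :
    concatCurve c d t = c (2 * t) := if_pos ht

theorem concatCurve_of_lt (c d : ℝ → Ω) {t : ℝ} (ht : 1 / 2 < t) :
    concatCurve c d t = d (2 * t - 1) := if_neg (not_le.2 ht)

theorem concatCurve_of_ge {c d : ℝ → Ω} (hcd : c 1 = d 0) {t : ℝ} (ht : 1 / 2 ≤ t) :
    concatCurve c d t = d (2 * t - 1) := by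
  rcases ht.eq_or_lt with rfl | ht
  · rw [concatCurve_of_le c d le_rfl]
    norm_num [hcd]
  · exact concatCurve_of_lt c d ht

theorem concatCurve_zero (c d : ℝ → Ω) : concatCurve c d 0 = c 0 := by
  rw [concatCurve_of_le c d (by norm_num), mul_zero]

theorem concatCurve_one (c d : ℝ → Ω) : concatCurve c d 1 = d 1 := by
  rw [concatCurve_of_lt c d (by norm_num)]
  norm_num

theorem isClosedCurve_concatCurve {c d : ℝ → Ω} :
    IsClosedCurve (concatCurve c d) ↔ c 0 = d 1 := by
  rw [IsClosedCurve, concatCurve_zero, concatCurve_one]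

theorem revCurve_zero (c : ℝ → Ω) : revCurve c 0 = c 1 := congrArg c (sub_zero 1)

theorem revCurve_one (c : ℝ → Ω) : revCurve c 1 = c 0 := congrArg c (sub_self 1)

theorem revCurve_revCurve (c : ℝ → Ω) : revCurve (revCurve c) = c :=
  funext fun t => congrArg c (sub_sub_cancel 1 t)

theorem two_mul_mem_unitInterval {t : ℝ} (ht : t ∈ Icc (0 : ℝ) (1 / 2)) :
    2 * t ∈ Icc (0 : ℝ) 1 :=
  ⟨by linarith [ht.1], by linarith [ht.2]⟩

theorem two_mul_sub_one_mem_unitInterval {t : ℝ} (ht : t ∈ Icc (1 / 2 : ℝ) 1) :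
    2 * t - 1 ∈ Icc (0 : ℝ) 1 :=
  ⟨by linarith [ht.1], by linarith [ht.2]⟩

theorem forall_concatCurve₂ {Ω' : Type*} {P : Ω → Ω' → Prop} {c d : ℝ → Ω} {l m : ℝ → Ω'}
    (hcl : ∀ t ∈ Icc (0 : ℝ) 1, P (c t) (l t)) (hdm : ∀ t ∈ Icc (0 : ℝ) 1, P (d t) (m t)) :
    ∀ t ∈ Icc (0 : ℝ) 1, P (concatCurve c d t) (concatCurve l m t) := by
  intro t ht
  rcases le_or_gt t (1 / 2) with h | h
  · rw [concatCurve_of_le c d h, concatCurve_of_le l m h]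
    exact hcl _ (two_mul_mem_unitInterval ⟨ht.1, h⟩)
  · rw [concatCurve_of_lt c d h, concatCurve_of_lt l m h]
    exact hdm _ (two_mul_sub_one_mem_unitInterval ⟨h.le, ht.2⟩)

theorem mapsTo_concatCurve {c d : ℝ → Ω} {A : Set Ω} (hc : MapsTo c (Icc 0 1) A)
    (hd : MapsTo d (Icc 0 1) A) : MapsTo (concatCurve c d) (Icc 0 1) A :=
  forall_concatCurve₂ (P := fun x _ => x ∈ A) (l := c) (m := d) hc hd

theorem mapsTo_revCurve {c : ℝ → Ω} {A : Set Ω} (hc : MapsTo c (Icc 0 1) A) :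
    MapsTo (revCurve c) (Icc 0 1) A := fun _ ht => hc (Icc.one_sub_mem ht)

theorem continuousOn_concatCurve [TopologicalSpace Ω] {c d : ℝ → Ω} (hc : ContinuousOn c (Icc 0 1))
    (hd : ContinuousOn d (Icc 0 1)) (hcd : c 1 = d 0) :
    ContinuousOn (concatCurve c d) (Icc 0 1) := by
  have hleft : ContinuousOn (concatCurve c d) (Icc 0 (1 / 2)) :=
    (hc.comp (f := fun t : ℝ => 2 * t) (by fun_prop) fun _ => two_mul_mem_unitInterval).congr
      fun t ht => concatCurve_of_le c d ht.2
  have hright : ContinuousOn (concatCurve c d) (Icc (1 / 2) 1) :=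
    (hd.comp (f := fun t : ℝ => 2 * t - 1) (by fun_prop)
      fun _ => two_mul_sub_one_mem_unitInterval).congr fun t ht => concatCurve_of_ge hcd ht.1
  have hunion := hleft.union_of_isClosed hright isClosed_Icc isClosed_Icc
  rwa [Icc_union_Icc_eq_Icc (by norm_num) (by norm_num)] at hunion

theorem continuousOn_revCurve [TopologicalSpace Ω] {c : ℝ → Ω} (hc : ContinuousOn c (Icc 0 1)) :
    ContinuousOn (revCurve c) (Icc 0 1) :=
  hc.comp (f := fun t : ℝ => 1 - t) (by fun_prop) fun _ => Icc.one_sub_mem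

theorem exists_seq_of_reflTransGen {X : Type*} {r : X → X → Prop} {a b : X}
    (h : Relation.ReflTransGen r a b) :
    ∃ (k : ℕ) (s : ℕ → X), s 0 = a ∧ s k = b ∧ ∀ i < k, r (s i) (s (i + 1)) := by
  induction h using Relation.ReflTransGen.head_induction_on with
  | refl => exact ⟨0, fun _ => b, rfl, rfl, fun i hi => absurd hi i.not_lt_zero⟩
  | @head a c hac _ ih =>
    obtain ⟨k, s, rfl, hsk, hs⟩ := ih
    refine ⟨k + 1, fun i => i.casesOn a s, rfl, hsk, fun i hi => ?_⟩
    cases i with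
    | zero => exact hac
    | succ i => exact hs i (Nat.lt_of_succ_lt_succ hi)

theorem continuousOn_Icc_of_pieces [TopologicalSpace Ω] {l : ℝ → Ω} {k : ℕ} {s : ℕ → ℝ}
    (hle : ∀ i < k, s i ≤ s (i + 1))
    (hl : ∀ i < k, ContinuousOn l (Icc (s i) (s (i + 1)))) :
    s 0 ≤ s k ∧ ContinuousOn l (Icc (s 0) (s k)) := by
  induction k with
  | zero => exact ⟨le_rfl, Icc_self (s 0) ▸ continuousOn_singleton l (s 0)⟩
  | succ k ih =>
    obtain ⟨h0k, hlk⟩ := ih (fun i hi => hle i (hi.trans k.lt_succ_self))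
      fun i hi => hl i (hi.trans k.lt_succ_self)
    have hkk := hle k k.lt_succ_self
    have hunion := hlk.union_of_isClosed (hl k k.lt_succ_self) isClosed_Icc isClosed_Icc
    rw [Icc_union_Icc_eq_Icc h0k hkk] at hunion
    exact ⟨h0k.trans hkk, hunion⟩

variable [TopologicalSpace Ω] [ChartedSpace E3 Ω] {c d : ℝ → Ω}

/-- `[a, b]` is a non-trivial subinterval of `[0, 1]` on which `c` is smooth. -/
structure IsSmoothPiece (c : ℝ → Ω) (a b : ℝ) : Prop where
  nonneg : 0 ≤ a
  lt : a < b
  le_one : b ≤ 1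
  contMDiffOn : ContMDiffOn 𝓘(ℝ, ℝ) (𝓡 3) ∞ c (Icc a b)

/-- `c : [0, 1] → Ω` is piecewise smooth: one can pass from `0` to `1` along finitely many
subintervals on which `c` is smooth. -/
def IsPiecewiseSmooth (c : ℝ → Ω) : Prop := Relation.ReflTransGen (IsSmoothPiece c) 0 1

theorem IsPiecewiseSmooth.of_contMDiffOn
    (hc : ContMDiffOn 𝓘(ℝ, ℝ) (𝓡 3) ∞ c (Icc 0 1)) : IsPiecewiseSmooth c :=
  .single ⟨le_rfl, zero_lt_one, le_rfl, hc⟩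

theorem contMDiffOn_revCurve (hc : ContMDiffOn 𝓘(ℝ, ℝ) (𝓡 3) ∞ c (Icc 0 1)) :
    ContMDiffOn 𝓘(ℝ, ℝ) (𝓡 3) ∞ (revCurve c) (Icc 0 1) :=
  hc.comp (contMDiff_iff_contDiff.2 (contDiff_const.sub contDiff_id)).contMDiffOn
    fun _ => Icc.one_sub_mem

theorem IsSmoothPiece.concatCurve_left {a b : ℝ} (h : IsSmoothPiece c a b) (d : ℝ → Ω) :
    IsSmoothPiece (concatCurve c d) (a / 2) (b / 2) := by
  have hdouble : ContMDiff 𝓘(ℝ, ℝ) 𝓘(ℝ, ℝ) ∞ (fun t : ℝ => 2 * t) :=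
    contMDiff_iff_contDiff.2 (by fun_prop)
  refine ⟨by linarith [h.nonneg], by linarith [h.lt], by linarith [h.le_one], ?_⟩
  refine (h.contMDiffOn.comp (hdouble.contMDiffOn (s := Icc (a / 2) (b / 2))) fun t ht =>
    ⟨by linarith [ht.1], by linarith [ht.2]⟩).congr fun t ht => concatCurve_of_le c d ?_
  linarith [ht.2, h.le_one]

theorem IsSmoothPiece.concatCurve_right {a b : ℝ} (h : IsSmoothPiece d a b) (hcd : c 1 = d 0) :
    IsSmoothPiece (concatCurve c d) ((1 + a) / 2) ((1 + b) / 2) := by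
  have hdouble : ContMDiff 𝓘(ℝ, ℝ) 𝓘(ℝ, ℝ) ∞ (fun t : ℝ => 2 * t - 1) :=
    contMDiff_iff_contDiff.2 (by fun_prop)
  refine ⟨by linarith [h.nonneg], by linarith [h.lt], by linarith [h.le_one], ?_⟩
  refine (h.contMDiffOn.comp (hdouble.contMDiffOn (s := Icc ((1 + a) / 2) ((1 + b) / 2)))
    fun t ht => ⟨by linarith [ht.1], by linarith [ht.2]⟩).congr fun t ht =>
      concatCurve_of_ge hcd ?_
  linarith [ht.1, h.nonneg]

theorem IsPiecewiseSmooth.concat (hc : IsPiecewiseSmooth c) (hd : IsPiecewiseSmooth d)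
    (hcd : c 1 = d 0) : IsPiecewiseSmooth (concatCurve c d) := by
  have hleft : Relation.ReflTransGen (IsSmoothPiece (concatCurve c d)) (0 / 2) (1 / 2) :=
    hc.lift (· / 2) fun _ _ h => h.concatCurve_left d
  have hright : Relation.ReflTransGen (IsSmoothPiece (concatCurve c d))
      ((1 + 0) / 2) ((1 + 1) / 2) :=
    hd.lift (fun t => (1 + t) / 2) fun _ _ h => h.concatCurve_right hcd
  norm_num only at hleft hright
  exact hleft.trans hright

end Curves

section LiftSheet

variable {Ω : Type*} [TopologicalSpace Ω] [ChartedSpace E3 Ω] [IsManifold (𝓡 3) ∞ Ω]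
  [RiemannianBundle (fun x : Ω => TangentSpace (𝓡 3) x)]

/-- The component `carrier` of `disk ∩ tube S U diskRadius` which carries the curves of a
generalised simple `δ`-lift in `U`, with a normal frame of `S` over `U` and a regular domain `nbhd`
which witnesses that the `δ`-neighbourhood of `U` is regular. -/
structure LiftSheet (S U : Set Ω) (δ : ℝ) extends FramedCover S U δ where
  diskRadius : ℝ
  disk : Set Ω
  nbhd : Set (TangentBundle (𝓡 3) Ω)
  isPrecompactOpenIn : IsPrecompactOpenIn S U
  diskRadius_pos : 0 < diskRadius
  isEmbeddedDisk : IsEmbeddedDisk disk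
  isDeltaGraph : IsDeltaGraph S U δ (disk ∩ tube S U diskRadius)
  isDeltaCover : IsDeltaCover S U δ carrier
  exists_eq_component : ∃ x, carrier = connectedComponentIn (disk ∩ tube S U diskRadius) x
  isRegularDomain_nbhd : IsRegularDomain S nbhd
  normalDisc_subset_nbhd : normalDisc S U δ ⊆ nbhd

/-- `l` is a continuous curve in `G` which projects to `c` along normal vectors of `S` of length
less than `δ`. -/
structure IsContLift (S G : Set Ω) (δ : ℝ) (c l : ℝ → Ω) : Prop where
  continuousOn : ContinuousOn l (Icc 0 1)
  mapsTo : MapsTo l (Icc 0 1) G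
  mem_tube : ∀ t ∈ Icc (0 : ℝ) 1, l t ∈ tube S {c t} δ

variable {S U G : Set Ω} {δ : ℝ} {c d l m : ℝ → Ω}

omit [IsManifold (𝓡 3) ∞ Ω] in
theorem IsContLift.concat (hl : IsContLift S G δ c l) (hm : IsContLift S G δ d m)
    (h : l 1 = m 0) : IsContLift S G δ (concatCurve c d) (concatCurve l m) :=
  ⟨continuousOn_concatCurve hl.continuousOn hm.continuousOn h,
    mapsTo_concatCurve hl.mapsTo hm.mapsTo,
    forall_concatCurve₂ (P := fun x y => y ∈ tube S {x} δ) hl.mem_tube hm.mem_tube⟩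

omit [IsManifold (𝓡 3) ∞ Ω] in
theorem IsContLift.rev (hl : IsContLift S G δ c l) :
    IsContLift S G δ (revCurve c) (revCurve l) :=
  ⟨continuousOn_revCurve hl.continuousOn, mapsTo_revCurve hl.mapsTo,
    fun _ ht => hl.mem_tube _ (Icc.one_sub_mem ht)⟩

omit [IsManifold (𝓡 3) ∞ Ω] in
theorem IsContLift.of_rev (hl : IsContLift S G δ (revCurve c) l) :
    IsContLift S G δ c (revCurve l) := by
  simpa only [revCurve_revCurve] using hl.rev

namespace LiftSheet

variable {L : LiftSheet S U δ} {x y : Ω}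

/-- The normal vector over `x` which leads to `y` is unique, since both radii are regular: hence a
point close to `x` which lies in some tube over `U` is reached by a short vector from `x`. -/
theorem exists_mem_normalDisc (hx : x ∈ U) (hy : y ∈ tube S {x} δ) {η : ℝ}
    (hyη : y ∈ tube S U η) :
    ∃ w ∈ normalDisc S U η, w ∈ L.nbhd ∧ w.proj = x ∧ expMap w = y := by
  obtain ⟨w, ⟨hwS, hwx, hwδ⟩, rfl⟩ := hy
  obtain rfl : w.proj = x := hwx
  have hw : w ∈ L.nbhd := L.normalDisc_subset_nbhd ⟨hwS, hx, hwδ⟩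
  refine ⟨w, ?_, hw, rfl, rfl⟩
  obtain ⟨v, ⟨hvS, hvU, hvη⟩, hvw⟩ := hyη
  rcases le_or_gt η δ with h | h
  · have hv : v ∈ L.nbhd := L.normalDisc_subset_nbhd ⟨hvS, hvU, hvη.trans_le h⟩
    exact L.isRegularDomain_nbhd.injOn hv hw hvw ▸ ⟨hvS, hvU, hvη⟩
  · exact ⟨hwS, hx, hwδ.trans h⟩

theorem exists_mem_dom (hx : x ∈ U) (hy : y ∈ tube S {x} δ) (hyL : y ∈ L.carrier) :
    ∃ w ∈ L.dom, w ∈ L.nbhd ∧ w.proj = x ∧ expMap w = y := by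
  obtain ⟨w, hw, hw'⟩ := exists_mem_normalDisc hx hy (L.carrier_subset_tube hyL)
  exact ⟨w, L.normalDisc_subset hw, hw'⟩

theorem foot_eq (hx : x ∈ U) (hy : y ∈ tube S {x} δ) (hyL : y ∈ L.carrier) : L.foot y = x := by
  obtain ⟨w, hw, -, rfl, rfl⟩ := exists_mem_dom hx hy hyL
  exact L.isRegularDomain.footMap_expMap hw

theorem footMap_nbhd_eventuallyEq (hx : x ∈ U) (hy : y ∈ tube S {x} δ) (hyL : y ∈ L.carrier) :
    L.foot =ᶠ[𝓝 y] footMap L.nbhd := by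
  obtain ⟨w, hw, hw', rfl, rfl⟩ := exists_mem_dom hx hy hyL
  exact L.isRegularDomain.footMap_eventuallyEq L.isRegularDomain_nbhd hw hw'

variable (L) in
theorem carrier_subset_disk_inter_tube : L.carrier ⊆ L.disk ∩ tube S U L.diskRadius := by
  obtain ⟨x, hx⟩ := L.exists_eq_component
  exact hx ▸ connectedComponentIn_subset _ _

theorem connectedComponentIn_eq_carrier (hy : y ∈ L.carrier) :
    connectedComponentIn (L.disk ∩ tube S U L.diskRadius) y = L.carrier := by
  obtain ⟨x, hx⟩ := L.exists_eq_component
  rw [hx]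
  exact (connectedComponentIn_eq (hx ▸ hy)).symm

theorem foot_apply (hl : IsContLift S L.carrier δ c l) (hcU : MapsTo c (Icc 0 1) U) {t : ℝ}
    (ht : t ∈ Icc (0 : ℝ) 1) : L.foot (l t) = c t :=
  foot_eq (hcU ht) (hl.mem_tube t ht) (hl.mapsTo ht)

theorem contMDiffOn (hl : IsContLift S L.carrier δ c l) (hcU : MapsTo c (Icc 0 1) U) {J : Set ℝ}
    (hJ : J ⊆ Icc 0 1) (hc : ContMDiffOn 𝓘(ℝ, ℝ) (𝓡 3) ∞ c J) :
    ContMDiffOn 𝓘(ℝ, ℝ) (𝓡 3) ∞ l J :=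
  FramedCover.contMDiffOn_of_foot_comp (hl.continuousOn.mono hJ) (hl.mapsTo.mono_left hJ)
    (hc.congr fun _ ht => foot_apply hl hcU (hJ ht))

theorem isParallel_velocity (hl : IsContLift S L.carrier δ c l) (hcU : MapsTo c (Icc 0 1) U)
    {a b t : ℝ} (hab : IsSmoothPiece c a b) (ht : t ∈ Icc a b) :
    IsParallel L.nbhd δ (velocity l (Icc a b) t) := by
  have hJ : Icc a b ⊆ Icc (0 : ℝ) 1 := Icc_subset_Icc hab.nonneg hab.le_one
  have htangent : velocity l (Icc a b) t ∈ tangentSet L.carrier :=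
    velocity_mem_tangentSet L.isEmbeddedSurface_carrier (uniqueDiffOn_Icc hab.lt t ht) ht
      (hl.mapsTo.mono_left hJ)
      ((contMDiffOn hl hcU hJ hab.contMDiffOn t ht).mdifferentiableWithinAt (by simp))
  exact (L.isParallel htangent).congr
    (footMap_nbhd_eventuallyEq (hcU (hJ ht)) (hl.mem_tube t (hJ ht)) (hl.mapsTo (hJ ht)))

theorem isDeltaLift (hl : IsContLift S L.carrier δ c l) (hcU : MapsTo c (Icc 0 1) U)
    (hc : IsPiecewiseSmooth c) : IsDeltaLift S δ c l := by
  have hcU' : curveImage c ⊆ U := hcU.image_subset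
  have htube : ∀ t ∈ Icc (0 : ℝ) 1, tube S {c t} δ ⊆ tube S (curveImage c) δ := fun _ ht =>
    image_mono fun v hv => ⟨hv.1, hv.2.1 ▸ mem_image_of_mem c ht, hv.2.2⟩
  obtain ⟨k, s, hs0, hsk, hs⟩ := exists_seq_of_reflTransGen hc
  refine ⟨L.nbhd, L.isRegularDomain_nbhd,
    fun v hv => L.normalDisc_subset_nbhd ⟨hv.1, hcU' hv.2.1, hv.2.2⟩,
    fun _ ht => htube _ ht (hl.mem_tube _ ht), fun t ht => ?_, k, s, hs0, hsk, fun i hi =>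
    ⟨(hs i hi).lt, contMDiffOn hl hcU (Icc_subset_Icc (hs i hi).nonneg (hs i hi).le_one)
      (hs i hi).contMDiffOn, fun _ => isParallel_velocity hl hcU (hs i hi)⟩⟩
  have hfoot := footMap_nbhd_eventuallyEq (hcU ht) (hl.mem_tube t ht) (hl.mapsTo ht)
  exact hfoot.self_of_nhds.symm.trans (foot_apply hl hcU ht)

theorem isSimpleLift (hl : IsContLift S L.carrier δ c l) (hcU : MapsTo c (Icc 0 1) U)
    (hc : IsPiecewiseSmooth c) : IsSimpleLift S δ c l := by
  have h0 : (0 : ℝ) ∈ Icc (0 : ℝ) 1 := unitInterval.zero_mem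
  have hl0 := L.carrier_subset_disk_inter_tube (hl.mapsTo h0)
  obtain ⟨w, hw, -, hwc, hwl⟩ := exists_mem_normalDisc (L := L) (hcU h0) (hl.mem_tube 0 h0) hl0.2
  exact ⟨U, L.isPrecompactOpenIn, hcU.image_subset, L.diskRadius, L.diskRadius_pos, L.disk, c 0,
    l 0, mem_image_of_mem c h0,
    { disk := L.isEmbeddedDisk
      lift := fun _ => isDeltaLift hl hcU hc
      mapsTo := fun _ => hl.mapsTo.mono_right L.carrier_subset_disk_inter_tube
      graph := L.isDeltaGraph
      point_mem := ⟨⟨w, ⟨hw.1, hwc, hw.2.2⟩, hwl⟩, hl0.1⟩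
      pointed := fun _ => mem_image_of_mem l h0
      cover := fun _ => (connectedComponentIn_eq_carrier (hl.mapsTo h0)).symm ▸ L.isDeltaCover }⟩

theorem apply_eq_of_eq (hl : IsContLift S L.carrier δ c l) (hm : IsContLift S L.carrier δ d m)
    (hcU : MapsTo c (Icc 0 1) U) (hdU : MapsTo d (Icc 0 1) U) {s t : ℝ}
    (hs : s ∈ Icc (0 : ℝ) 1) (ht : t ∈ Icc (0 : ℝ) 1) (h : l s = m t) : c s = d t := by
  rw [← foot_apply hl hcU hs, h, foot_apply hm hdU ht]

theorem foot_eq_foot (hl : IsContLift S L.carrier δ c l) (hm : IsContLift S L.carrier δ c m)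
    (hcU : MapsTo c (Icc 0 1) U) : ∀ t ∈ Icc (0 : ℝ) 1, L.foot (l t) = L.foot (m t) :=
  fun _ ht => (foot_apply hl hcU ht).trans (foot_apply hm hcU ht).symm

variable [T2Space Ω]

theorem eqOn_of_eq (hl : IsContLift S L.carrier δ c l) (hm : IsContLift S L.carrier δ c m)
    (hcU : MapsTo c (Icc 0 1) U) {t : ℝ} (ht : t ∈ Icc (0 : ℝ) 1) (h : l t = m t) :
    EqOn l m (Icc 0 1) :=
  FramedCover.eqOn_of_foot_eq isPreconnected_Icc hl.continuousOn hm.continuousOn hl.mapsTo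
    hm.mapsTo (foot_eq_foot hl hm hcU) ht h

variable [IsContMDiffRiemannianBundle (𝓡 3) ∞ E3 (fun x : Ω => TangentSpace (𝓡 3) x)]

theorem sheetCount_zero_eq_one (hl : IsContLift S L.carrier δ c l)
    (hm : IsContLift S L.carrier δ c m) (hcU : MapsTo c (Icc 0 1) U) :
    L.sheetCount (l 0) (m 0) = L.sheetCount (l 1) (m 1) :=
  FramedCover.sheetCount_comp_eq isCompact_Icc isPreconnected_Icc hl.continuousOn hm.continuousOn
    hl.mapsTo hm.mapsTo (foot_eq_foot hl hm hcU) unitInterval.zero_mem unitInterval.one_mem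

end LiftSheet

/-- `l₁, l₂, l₃, l₄` are consecutive lifts to `G` of `c`, `d`, the reverse of `c` and the reverse of
`d`, the four legs of `commutatorCurve c d`. -/
structure IsCommutatorLift (S G : Set Ω) (δ : ℝ) (c d l₁ l₂ l₃ l₄ : ℝ → Ω) : Prop where
  first : IsContLift S G δ c l₁
  second : IsContLift S G δ d l₂
  third : IsContLift S G δ (revCurve c) l₃
  fourth : IsContLift S G δ (revCurve d) l₄
  first_second : l₁ 1 = l₂ 0
  second_third : l₂ 1 = l₃ 0
  third_fourth : l₃ 1 = l₄ 0

namespace IsCommutatorLift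

variable {l₁ l₂ l₃ l₄ : ℝ → Ω}

omit [IsManifold (𝓡 3) ∞ Ω] in
theorem isContLift (h : IsCommutatorLift S G δ c d l₁ l₂ l₃ l₄) :
    IsContLift S G δ (commutatorCurve c d) (concatCurve (concatCurve l₁ l₂) (concatCurve l₃ l₄)) :=
  (h.first.concat h.second h.first_second).concat (h.third.concat h.fourth h.third_fourth)
    (by rw [concatCurve_one, concatCurve_zero, h.second_third])

variable [T2Space Ω]
  [IsContMDiffRiemannianBundle (𝓡 3) ∞ E3 (fun x : Ω => TangentSpace (𝓡 3) x)]
  {L : LiftSheet S U δ}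

/-- If `N y y'` is the signed number of sheets from `y` to `y'` and `y₀, …, y₄` are the successive
end points of the legs, then the lifts of `c` give `N y₀ y₃ = N y₁ y₂`, those of `d` give
`N y₁ y₄ = N y₂ y₃`, and these force `N y₀ y₄ = 0`. -/
theorem apply_one_eq_apply_zero (h : IsCommutatorLift S L.carrier δ c d l₁ l₂ l₃ l₄)
    (hcU : MapsTo c (Icc 0 1) U) (hdU : MapsTo d (Icc 0 1) U) (hc : c 0 = c 1) (hd : d 0 = d 1)
    (hcd : c 0 = d 0) : l₄ 1 = l₁ 0 := by
  have hcount_c := LiftSheet.sheetCount_zero_eq_one h.first h.third.of_rev hcU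
  have hcount_d := LiftSheet.sheetCount_zero_eq_one h.second h.fourth.of_rev hdU
  rw [revCurve_zero, revCurve_one, ← h.second_third] at hcount_c
  rw [revCurve_zero, revCurve_one, ← h.first_second, ← h.third_fourth] at hcount_d
  have hmem : ∀ {e l : ℝ → Ω}, IsContLift S L.carrier δ e l → MapsTo e (Icc 0 1) U →
      ∀ {t : ℝ}, t ∈ Icc (0 : ℝ) 1 → e t = c 0 → l t ∈ L.pointsOver (c 0) :=
    fun hl heU _ ht het => ⟨hl.mapsTo ht, (LiftSheet.foot_apply hl heU ht).trans het⟩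
  have hy₀ := hmem h.first hcU unitInterval.zero_mem rfl
  have hy₁ := hmem h.first hcU unitInterval.one_mem hc.symm
  have hy₂ := hmem h.second hdU unitInterval.one_mem (hd.symm.trans hcd.symm)
  have hy₃ := hmem h.third (mapsTo_revCurve hcU) unitInterval.one_mem (revCurve_one c)
  have hy₄ := hmem h.fourth (mapsTo_revCurve hdU) unitInterval.one_mem
    ((revCurve_one d).trans hcd.symm)
  refine (FramedCover.eq_of_sheetCount_eq_zero hy₀ hy₄ ?_).symm
  calc L.sheetCount (l₁ 0) (l₄ 1)
      = L.sheetCount (l₁ 0) (l₃ 1) - L.sheetCount (l₄ 1) (l₃ 1) := by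
        rw [← FramedCover.sheetCount_add hy₀ hy₄ hy₃, add_sub_cancel_right]
    _ = L.sheetCount (l₁ 1) (l₂ 1) - L.sheetCount (l₄ 1) (l₃ 1) := by rw [hcount_c]
    _ = L.sheetCount (l₁ 1) (l₄ 1) -
          (L.sheetCount (l₂ 1) (l₄ 1) + L.sheetCount (l₄ 1) (l₃ 1)) := by
        rw [← FramedCover.sheetCount_add hy₁ hy₂ hy₄]
        ring
    _ = 0 := by rw [FramedCover.sheetCount_add hy₂ hy₄ hy₃, hcount_d, sub_self]

end IsCommutatorLift

end LiftSheet

section Component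

variable {Ω : Type*} [TopologicalSpace Ω] [ChartedSpace E3 Ω] {S U W : Set Ω}

theorem IsEmbeddedSurface.exists_isOpen_isPreconnected_inter (hS : IsEmbeddedSurface S) {x : Ω}
    (hx : x ∈ S) (hW : IsOpen W) (hxW : x ∈ W) :
    ∃ O ⊆ W, IsOpen O ∧ x ∈ O ∧ IsPreconnected (O ∩ S) := by
  obtain ⟨e, he, hxe⟩ := hS.exists_isSliceChart hx
  have hex : e x ∈ e.target ∩ e.symm ⁻¹' W :=
    ⟨e.map_source hxe, by rwa [mem_preimage, e.left_inv hxe]⟩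
  obtain ⟨r, hr, hball⟩ := Metric.isOpen_iff.1 (e.symm.isOpen_inter_preimage hW) _ hex
  refine ⟨e.source ∩ e ⁻¹' Metric.ball (e x) r, ?_, e.isOpen_inter_preimage Metric.isOpen_ball,
    ⟨hxe, Metric.mem_ball_self hr⟩, ?_⟩
  · rintro y ⟨hye, hyr⟩
    have hyW : e.symm (e y) ∈ W := (hball hyr).2
    rwa [e.left_inv hye] at hyW
  · have himage : e.source ∩ e ⁻¹' Metric.ball (e x) r ∩ S =
        e.symm '' (Metric.ball (e x) r ∩ {y : E3 | y 2 = 0}) := by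
      ext y
      constructor
      · rintro ⟨⟨hye, hyr⟩, hyS⟩
        exact ⟨e y, ⟨hyr, (he.apply_mem_iff hye).2 hyS⟩, e.left_inv hye⟩
      · rintro ⟨z, ⟨hzr, hz⟩, rfl⟩
        have hze : z ∈ e.target := (hball hzr).1
        exact ⟨⟨e.map_target hze, by rwa [mem_preimage, e.right_inv hze]⟩,
          (he.symm_mem_iff hze).2 hz⟩
    have hconvex : Convex ℝ (Metric.ball (e x) r ∩ {y : E3 | y 2 = 0}) := by
      refine (convex_ball _ _).inter fun y (hy : y 2 = 0) z (hz : z 2 = 0) a b _ _ _ => ?_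
      simp [hy, hz]
    rw [himage]
    exact hconvex.isPreconnected.image _ (e.continuousOn_symm.mono fun y hy => (hball hy.1).1)

theorem IsPrecompactOpenIn.component (hS : IsEmbeddedSurface S) (hU : IsPrecompactOpenIn S U)
    (p : Ω) : IsPrecompactOpenIn S (connectedComponentIn U p) := by
  obtain ⟨⟨W, hW, rfl⟩, K, hK, hKS, hUK⟩ := hU
  have hsub := connectedComponentIn_subset (W ∩ S) p
  refine ⟨⟨⋃₀ {O | IsOpen O ∧ O ∩ S ⊆ connectedComponentIn (W ∩ S) p},
    isOpen_sUnion fun O hO => hO.1, Subset.antisymm (fun x hx => ?_) ?_⟩, K, hK, hKS,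
    hsub.trans hUK⟩
  · obtain ⟨hxW, hxS⟩ := hsub hx
    obtain ⟨O, hOW, hO, hxO, hOS⟩ := hS.exists_isOpen_isPreconnected_inter hxS hW hxW
    have hOp : O ∩ S ⊆ connectedComponentIn (W ∩ S) p := by
      rw [connectedComponentIn_eq hx]
      exact hOS.subset_connectedComponentIn ⟨hxO, hxS⟩ (inter_subset_inter_left S hOW)
    exact ⟨mem_sUnion_of_mem hxO ⟨hO, hOp⟩, hxS⟩
  · rintro x ⟨⟨O, ⟨-, hOp⟩, hxO⟩, hxS⟩
    exact hOp ⟨hxO, hxS⟩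

end Component

section SmoothStep

theorem strictMonoOn_expNegInvGlue : StrictMonoOn expNegInvGlue (Ici 0) := by
  intro x hx y _ hxy
  rcases (mem_Ici.1 hx).eq_or_lt with rfl | hx
  · rw [expNegInvGlue.zero]
    exact expNegInvGlue.pos_of_pos hxy
  · simp only [expNegInvGlue, hx.not_ge, (hx.trans hxy).not_ge, if_false]
    exact Real.exp_lt_exp.2 (neg_lt_neg (inv_strictAnti₀ hx hxy))

theorem strictMonoOn_smoothTransition : StrictMonoOn Real.smoothTransition (Icc 0 1) := by
  intro x hx y hy hxy
  have hlt := strictMonoOn_expNegInvGlue (mem_Ici.2 hx.1) (mem_Ici.2 hy.1) hxy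
  have hlt' := strictMonoOn_expNegInvGlue (mem_Ici.2 (sub_nonneg.2 hy.2))
    (mem_Ici.2 (sub_nonneg.2 hx.2)) (sub_lt_sub_left hxy 1)
  rw [Real.smoothTransition, Real.smoothTransition,
    div_lt_div_iff₀ (Real.smoothTransition.pos_denom x) (Real.smoothTransition.pos_denom y)]
  nlinarith [expNegInvGlue.nonneg x, expNegInvGlue.nonneg (1 - y)]

/-- A smooth monotone step from `0` to `1`, constant outside `[1/3, 2/3]`: composing a curve with it
makes the curve stationary near both ends. -/
noncomputable def smoothStep (x : ℝ) : ℝ := Real.smoothTransition (3 * x - 1)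

theorem contDiff_smoothStep : ContDiff ℝ ∞ smoothStep :=
  Real.smoothTransition.contDiff.comp (by fun_prop : ContDiff ℝ ∞ fun x : ℝ => 3 * x - 1)

theorem smoothStep_mem_Icc (x : ℝ) : smoothStep x ∈ Icc (0 : ℝ) 1 :=
  ⟨Real.smoothTransition.nonneg _, Real.smoothTransition.le_one _⟩

theorem smoothStep_of_le {x : ℝ} (hx : x ≤ 1 / 3) : smoothStep x = 0 :=
  Real.smoothTransition.zero_of_nonpos (by linarith)

theorem smoothStep_of_ge {x : ℝ} (hx : 2 / 3 ≤ x) : smoothStep x = 1 :=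
  Real.smoothTransition.one_of_one_le (by linarith)

theorem injOn_smoothStep : InjOn smoothStep (Icc (1 / 3) (2 / 3)) := by
  intro x hx y hy h
  have := strictMonoOn_smoothTransition.injOn (show 3 * x - 1 ∈ Icc (0 : ℝ) 1 from
    ⟨by linarith [hx.1], by linarith [hx.2]⟩) (show 3 * y - 1 ∈ Icc (0 : ℝ) 1 from
    ⟨by linarith [hy.1], by linarith [hy.2]⟩) h
  linarith

theorem surjOn_smoothStep : SurjOn smoothStep (Icc (1 / 3) (2 / 3)) (Icc 0 1) := by
  have hivt := intermediate_value_Icc (by norm_num : (1 / 3 : ℝ) ≤ 2 / 3)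
    contDiff_smoothStep.continuous.continuousOn
  rwa [smoothStep_of_le le_rfl, smoothStep_of_ge le_rfl] at hivt

theorem continuousOn_of_rightInvOn {X Y : Type*} [TopologicalSpace X] [TopologicalSpace Y]
    [T2Space Y] {f : X → Y} {g : Y → X} {K : Set X} {A : Set Y} (hK : IsCompact K)
    (hf : ContinuousOn f K) (hinj : InjOn f K) (hg : MapsTo g A K) (hfg : RightInvOn g f A) :
    ContinuousOn g A := by
  rw [continuousOn_iff_isClosed]
  intro C hC
  refine ⟨f '' (K ∩ C), ((hK.inter_right hC).image_of_continuousOn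
    (hf.mono inter_subset_left)).isClosed, ?_⟩
  ext y
  constructor
  · rintro ⟨hgC, hy⟩
    exact ⟨⟨g y, ⟨hg hy, hgC⟩, hfg hy⟩, hy⟩
  · rintro ⟨⟨x, ⟨hxK, hxC⟩, rfl⟩, hy⟩
    refine ⟨?_, hy⟩
    rwa [mem_preimage, hinj (hg hy) hxK (hfg hy)]

theorem exists_rightInvOn_smoothStep : ∃ ρ : ℝ → ℝ, ContinuousOn ρ (Icc 0 1) ∧
    MapsTo ρ (Icc 0 1) (Icc (1 / 3) (2 / 3)) ∧ RightInvOn ρ smoothStep (Icc 0 1) ∧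
    ρ 0 = 1 / 3 ∧ ρ 1 = 2 / 3 := by
  have hρ := surjOn_smoothStep.mapsTo_invFunOn
  have hinv := surjOn_smoothStep.rightInvOn_invFunOn
  refine ⟨_, continuousOn_of_rightInvOn isCompact_Icc contDiff_smoothStep.continuous.continuousOn
    injOn_smoothStep hρ hinv, hρ, hinv, ?_, ?_⟩
  · exact injOn_smoothStep (hρ unitInterval.zero_mem) (by norm_num)
      ((hinv unitInterval.zero_mem).trans (smoothStep_of_le le_rfl).symm)
  · exact injOn_smoothStep (hρ unitInterval.one_mem) (by norm_num)
      ((hinv unitInterval.one_mem).trans (smoothStep_of_ge le_rfl).symm)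

end SmoothStep

section FlatLoops

variable {Ω : Type*} [TopologicalSpace Ω] [ChartedSpace E3 Ω]

/-- `c` is a smooth loop at `p` which is constant near its end points, so that concatenations of
such loops are smooth. -/
structure IsFlatLoop (p : Ω) (c : ℝ → Ω) : Prop where
  contMDiff : ContMDiff 𝓘(ℝ, ℝ) (𝓡 3) ∞ c
  eventually_nhds_zero : ∀ᶠ t in 𝓝 0, c t = p
  eventually_nhds_one : ∀ᶠ t in 𝓝 1, c t = p

variable {p : Ω} {c d : ℝ → Ω}

theorem isFlatLoop_comp_smoothStep (hc : ContMDiffOn 𝓘(ℝ, ℝ) (𝓡 3) ∞ c (Icc 0 1)) (h0 : c 0 = p)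
    (h1 : c 1 = p) : IsFlatLoop p (c ∘ smoothStep) where
  contMDiff := hc.comp_contMDiff (contMDiff_iff_contDiff.2 contDiff_smoothStep) smoothStep_mem_Icc
  eventually_nhds_zero := by
    filter_upwards [Iic_mem_nhds (by norm_num : (0 : ℝ) < 1 / 3)] with t ht
    rw [Function.comp_apply, smoothStep_of_le ht, h0]
  eventually_nhds_one := by
    filter_upwards [Ici_mem_nhds (by norm_num : (2 / 3 : ℝ) < 1)] with t ht
    rw [Function.comp_apply, smoothStep_of_ge ht, h1]

theorem IsFlatLoop.concat (hc : IsFlatLoop p c) (hd : IsFlatLoop p d) :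
    IsFlatLoop p (concatCurve c d) := by
  have hleft : ContMDiff 𝓘(ℝ, ℝ) (𝓡 3) ∞ fun t => c (2 * t) :=
    hc.contMDiff.comp (contMDiff_iff_contDiff.2 (by fun_prop : ContDiff ℝ ∞ fun t : ℝ => 2 * t))
  have hright : ContMDiff 𝓘(ℝ, ℝ) (𝓡 3) ∞ fun t => d (2 * t - 1) :=
    hd.contMDiff.comp
      (contMDiff_iff_contDiff.2 (by fun_prop : ContDiff ℝ ∞ fun t : ℝ => 2 * t - 1))
  have hdouble : ∀ {t s : ℝ}, 2 * t = s → Tendsto (fun t : ℝ => 2 * t) (𝓝 t) (𝓝 s) :=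
    fun h => h ▸ (continuous_const_mul 2).tendsto _
  have hdouble' : ∀ {t s : ℝ}, 2 * t - 1 = s → Tendsto (fun t : ℝ => 2 * t - 1) (𝓝 t) (𝓝 s) :=
    fun h => h ▸ ((continuous_const_mul 2).sub continuous_const).tendsto _
  refine ⟨fun t => ?_, ?_, ?_⟩
  · rcases lt_trichotomy t (1 / 2) with h | rfl | h
    · refine (hleft t).congr_of_eventuallyEq ?_
      filter_upwards [Iic_mem_nhds h] with s hs using concatCurve_of_le c d hs
    · refine (contMDiffAt_const (c := p)).congr_of_eventuallyEq ?_
      filter_upwards [(hdouble (by norm_num)).eventually hc.eventually_nhds_one,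
        (hdouble' (by norm_num)).eventually hd.eventually_nhds_zero] with s hcs hds
      rcases le_or_gt s (1 / 2) with h | h
      · rw [concatCurve_of_le c d h, hcs]
      · rw [concatCurve_of_lt c d h, hds]
    · refine (hright t).congr_of_eventuallyEq ?_
      filter_upwards [Ioi_mem_nhds h] with s hs using concatCurve_of_lt c d hs
  · filter_upwards [(hdouble (mul_zero 2)).eventually hc.eventually_nhds_zero,
      Iic_mem_nhds (by norm_num : (0 : ℝ) < 1 / 2)] with t hct ht
    rw [concatCurve_of_le c d ht, hct]
  · filter_upwards [(hdouble' (by norm_num)).eventually hd.eventually_nhds_one,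
      Ioi_mem_nhds (by norm_num : (1 / 2 : ℝ) < 1)] with t hdt ht
    rw [concatCurve_of_lt c d ht, hdt]

/-- The commutator of two curves, slowed down at the ends of its four legs: unlike
`commutatorCurve c d` it is smooth for smooth loops `c` and `d`. -/
noncomputable def flatCommutator (c d : ℝ → Ω) : ℝ → Ω :=
  concatCurve (concatCurve (c ∘ smoothStep) (d ∘ smoothStep))
    (concatCurve (revCurve c ∘ smoothStep) (revCurve d ∘ smoothStep))

theorem isSmoothCurveIn_flatCommutator {U : Set Ω} (hcU : IsSmoothCurveIn U c)
    (hdU : IsSmoothCurveIn U d) (hc : c 0 = c 1) (hd : d 0 = d 1) (hcd : c 0 = d 0) :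
    IsSmoothCurveIn U (flatCommutator c d) := by
  have hslow : ∀ {e : ℝ → Ω}, MapsTo e (Icc 0 1) U → MapsTo (e ∘ smoothStep) (Icc 0 1) U :=
    fun he t _ => he (smoothStep_mem_Icc t)
  have hflat_c := isFlatLoop_comp_smoothStep hcU.1 rfl hc.symm
  have hflat_d := isFlatLoop_comp_smoothStep hdU.1 hcd.symm (hd.symm.trans hcd.symm)
  have hflat_c' := isFlatLoop_comp_smoothStep (contMDiffOn_revCurve hcU.1)
    ((revCurve_zero c).trans hc.symm) (revCurve_one c)
  have hflat_d' := isFlatLoop_comp_smoothStep (contMDiffOn_revCurve hdU.1)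
    ((revCurve_zero d).trans (hd.symm.trans hcd.symm)) ((revCurve_one d).trans hcd.symm)
  exact ⟨((hflat_c.concat hflat_d).concat (hflat_c'.concat hflat_d')).contMDiff.contMDiffOn,
    mapsTo_concatCurve (mapsTo_concatCurve (hslow hcU.2) (hslow hdU.2)) (mapsTo_concatCurve
      (hslow (mapsTo_revCurve hcU.2)) (hslow (mapsTo_revCurve hdU.2)))⟩

end FlatLoops

section Existence

variable {Ω : Type*} [TopologicalSpace Ω] [ChartedSpace E3 Ω] [IsManifold (𝓡 3) ∞ Ω]
  [RiemannianBundle (fun x : Ω => TangentSpace (𝓡 3) x)] {S U G : Set Ω} {δ : ℝ}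
  {c d l : ℝ → Ω}

omit [IsManifold (𝓡 3) ∞ Ω] in
theorem IsContLift.exists_halves (h : IsContLift S G δ (concatCurve c d) l) (hcd : c 1 = d 0) :
    ∃ l₁ l₂ : ℝ → Ω, IsContLift S G δ c l₁ ∧ IsContLift S G δ d l₂ ∧ l₁ 0 = l 0 ∧ l₁ 1 = l₂ 0 ∧
      l₂ 1 = l 1 := by
  have hleft : MapsTo (fun t : ℝ => t / 2) (Icc 0 1) (Icc 0 1) := fun t ht =>
    ⟨by linarith [ht.1], by linarith [ht.2]⟩
  have hright : MapsTo (fun t : ℝ => (1 + t) / 2) (Icc 0 1) (Icc 0 1) := fun t ht =>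
    ⟨by linarith [ht.1], by linarith [ht.2]⟩
  refine ⟨fun t => l (t / 2), fun t => l ((1 + t) / 2),
    ⟨h.continuousOn.comp (by fun_prop) hleft, h.mapsTo.comp hleft, fun t ht => ?_⟩,
    ⟨h.continuousOn.comp (by fun_prop) hright, h.mapsTo.comp hright, fun t ht => ?_⟩, by simp,
    by simp, by norm_num⟩
  · have hmem := h.mem_tube _ (hleft ht)
    rwa [concatCurve_of_le c d (by linarith [ht.2]), show 2 * (t / 2) = t by ring] at hmem
  · have hmem := h.mem_tube _ (hright ht)
    rwa [concatCurve_of_ge hcd (by linarith [ht.1]),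
      show 2 * ((1 + t) / 2) - 1 = t by ring] at hmem

theorem LiftSheet.apply_eq_of_const [T2Space Ω] {L : LiftSheet S U δ}
    (hl : IsContLift S L.carrier δ c l) (hcU : MapsTo c (Icc 0 1) U) {I : Set ℝ}
    (hI : IsPreconnected I) (hI1 : I ⊆ Icc 0 1) {x : Ω} (hx : ∀ t ∈ I, c t = x) {a b : ℝ}
    (ha : a ∈ I) (hb : b ∈ I) : l a = l b :=
  FramedCover.eqOn_of_foot_eq (m := fun _ => l b) hI (hl.continuousOn.mono hI1)
    continuousOn_const (hl.mapsTo.mono_left hI1) (fun _ _ => hl.mapsTo (hI1 hb))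
    (fun t ht => by
      rw [foot_apply hl hcU (hI1 ht), foot_apply hl hcU (hI1 hb), hx t ht, hx b hb]) hb rfl ha

/-- Undo the slow-down with a continuous right inverse of `smoothStep`; nothing is lost, since the
lift is constant where the slowed down curve is. -/
theorem LiftSheet.exists_isContLift_of_comp_smoothStep [T2Space Ω] {L : LiftSheet S U δ}
    (hl : IsContLift S L.carrier δ (c ∘ smoothStep) l) (hcU : MapsTo c (Icc 0 1) U) :
    ∃ m : ℝ → Ω, IsContLift S L.carrier δ c m ∧ m 0 = l 0 ∧ m 1 = l 1 := by
  obtain ⟨ρ, hρ, hρmaps, hinv, hρ0, hρ1⟩ := exists_rightInvOn_smoothStep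
  have hmaps : MapsTo ρ (Icc 0 1) (Icc 0 1) :=
    hρmaps.mono_right (Icc_subset_Icc (by norm_num) (by norm_num))
  have hslowU : MapsTo (c ∘ smoothStep) (Icc 0 1) U := fun t _ => hcU (smoothStep_mem_Icc t)
  have hstart : l (1 / 3) = l 0 :=
    apply_eq_of_const hl hslowU isPreconnected_Icc (Icc_subset_Icc le_rfl (by norm_num))
      (fun t ht => congrArg c (smoothStep_of_le ht.2)) (right_mem_Icc.2 (by norm_num))
      (left_mem_Icc.2 (by norm_num))
  have hfinish : l (2 / 3) = l 1 :=
    apply_eq_of_const hl hslowU isPreconnected_Icc (Icc_subset_Icc (by norm_num) le_rfl)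
      (fun t ht => congrArg c (smoothStep_of_ge ht.1)) (left_mem_Icc.2 (by norm_num))
      (right_mem_Icc.2 (by norm_num))
  refine ⟨l ∘ ρ, ⟨hl.continuousOn.comp hρ hmaps, hl.mapsTo.comp hmaps, fun t ht => ?_⟩,
    (congrArg l hρ0).trans hstart, (congrArg l hρ1).trans hfinish⟩
  have hmem := hl.mem_tube _ (hmaps ht)
  rwa [Function.comp_apply, hinv ht] at hmem

theorem IsDeltaLift.isContLift (h : IsDeltaLift S δ c l) {A : Set Ω}
    (hl : MapsTo l (Icc 0 1) A) : IsContLift S (connectedComponentIn A (l 0)) δ c l := by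
  obtain ⟨V, hV, hcV, hmaps, hfoot, k, s, hs0, hs1, hs⟩ := h
  have hcont := (continuousOn_Icc_of_pieces (fun i hi => (hs i hi).1.le)
    fun i hi => (hs i hi).2.1.continuousOn).2
  rw [hs0, hs1] at hcont
  refine ⟨hcont, ?_, fun t ht => ?_⟩
  · rw [mapsTo_iff_image_subset]
    exact (isPreconnected_Icc.image l hcont).subset_connectedComponentIn
      (mem_image_of_mem l unitInterval.zero_mem) hl.image_subset
  · obtain ⟨w, hw, hwl⟩ := hmaps ht
    have hwc := hfoot t ht
    rw [← hwl, hV.footMap_expMap (hcV hw)] at hwc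
    exact ⟨w, ⟨hw.1, hwc, hw.2.2⟩, hwl⟩

theorem IsGenSimpleLift.exists_liftSheet {n : ℕ} {ε : ℝ} {D : Set Ω} {p q : Ω}
    {c l : Fin n → ℝ → Ω} (h : IsGenSimpleLift S U δ ε D p q c l) (i : Fin n)
    (hS : IsEmbeddedSurface S) (hU : IsPrecompactOpenIn S U) (hU2 : IsTwoSided S U) (hδ : 0 < δ)
    (hδ1 : δ < 1) (hε : 0 < ε) {V₀ : Set (TangentBundle (𝓡 3) Ω)} (hV₀ : IsRegularDomain S V₀)
    (hUV₀ : normalDisc S U δ ⊆ V₀) :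
    ∃ L : LiftSheet S U δ, IsContLift S L.carrier δ (c i) (l i) := by
  have hcover := h.cover i
  obtain ⟨ε', hε', V, hG, hGc, -⟩ := id hcover
  obtain ⟨ν, hν⟩ := hU2
  exact ⟨{
    radius := ε'
    dom := V
    carrier := connectedComponentIn (D ∩ tube S U ε) (l i 0)
    ν := ν
    isEmbeddedSurface := hS
    isDeltaGraphIn := hG
    isPreconnected := hGc.isPreconnected
    isNormalFrame := ⟨hν.1, fun x hx => (hν.2 x hx).1, fun x hx => (hν.2 x hx).2⟩
    delta_pos := hδ
    delta_lt_one := hδ1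
    radius_pos := hε'
    diskRadius := ε
    disk := D
    nbhd := V₀
    isPrecompactOpenIn := hU
    diskRadius_pos := hε
    isEmbeddedDisk := h.disk
    isDeltaGraph := h.graph
    isDeltaCover := hcover
    exists_eq_component := ⟨_, rfl⟩
    isRegularDomain_nbhd := hV₀
    normalDisc_subset_nbhd := hUV₀ }, (h.lift i).isContLift (h.mapsTo i)⟩

theorem HasGenSimpleLiftProperty.exists_isRegularDomain (hlift : HasGenSimpleLiftProperty S)
    (hU : IsPrecompactOpenIn S U) (hUc : IsConnected U) :
    ∃ ε > 0, ∃ V, IsRegularDomain S V ∧ normalDisc S U ε ⊆ V := by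
  obtain ⟨p, hp⟩ := hUc.nonempty
  obtain ⟨δ₁, hδ₁, h⟩ := hlift U hU hUc
  obtain ⟨_, -, _, _, _, hl⟩ := h (δ₁ / 2) (by linarith) (by linarith) p hp 1 (fun _ _ => p)
    one_pos (fun _ => ⟨contMDiffOn_const, fun _ _ => hp⟩)
    fun _ => ⟨0, unitInterval.zero_mem, rfl⟩
  obtain ⟨ε, hε, V, hG, -⟩ := hl.cover 0
  exact ⟨ε, hε, V, hG.1, hG.2.1⟩

theorem HasGenSimpleLiftProperty.eventually_exists_liftSheet (hlift : HasGenSimpleLiftProperty S)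
    (hS : IsEmbeddedSurface S) (hU : IsPrecompactOpenIn S U) (hUc : IsConnected U)
    (hU2 : IsTwoSided S U) :
    ∀ᶠ δ in 𝓝[>] (0 : ℝ), ∀ c, IsSmoothCurveIn U c →
      ∃ (L : LiftSheet S U δ) (l : ℝ → Ω), IsContLift S L.carrier δ c l := by
  obtain ⟨ε₀, hε₀, V₀, hV₀, hUV₀⟩ := hlift.exists_isRegularDomain hU hUc
  obtain ⟨δ₁, hδ₁, h⟩ := hlift U hU hUc
  filter_upwards [Ioo_mem_nhdsGT hδ₁, Ioo_mem_nhdsGT hε₀, Ioo_mem_nhdsGT one_pos]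
    with δ hδδ₁ hδε₀ hδ1 c hc
  obtain ⟨ε, hε, D, q, l, hl⟩ := h δ hδδ₁.1 hδδ₁.2 (c 0) (hc.2 unitInterval.zero_mem) 1 (fun _ => c)
    one_pos (fun _ => hc) fun _ => mem_image_of_mem c unitInterval.zero_mem
  obtain ⟨L, hL⟩ := hl.exists_liftSheet 0 hS hU hU2 hδ1.1 hδ1.2 hε hV₀
    fun v hv => hUV₀ ⟨hv.1, hv.2.1, hv.2.2.trans hδε₀.2⟩
  exact ⟨L, l 0, hL⟩

theorem LiftSheet.exists_isCommutatorLift_of_flatCommutator [T2Space Ω] {L : LiftSheet S U δ}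
    (hl : IsContLift S L.carrier δ (flatCommutator c d) l) (hcU : MapsTo c (Icc 0 1) U)
    (hdU : MapsTo d (Icc 0 1) U) (hc : c 0 = c 1) (hd : d 0 = d 1) (hcd : c 0 = d 0) :
    ∃ l₁ l₂ l₃ l₄ : ℝ → Ω, IsCommutatorLift S L.carrier δ c d l₁ l₂ l₃ l₄ := by
  have hstart : ∀ e : ℝ → Ω, (e ∘ smoothStep) 0 = e 0 :=
    fun e => congrArg e (smoothStep_of_le (by norm_num))
  have hfinish : ∀ e : ℝ → Ω, (e ∘ smoothStep) 1 = e 1 :=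
    fun e => congrArg e (smoothStep_of_ge (by norm_num))
  obtain ⟨k₁₂, k₃₄, hk₁₂, hk₃₄, -, e₁₂₃₄, -⟩ := hl.exists_halves (by
    rw [concatCurve_one, concatCurve_zero, hfinish, hstart, revCurve_zero, ← hd, ← hc, hcd])
  obtain ⟨k₁, k₂, hk₁, hk₂, -, e₁₂, e₂⟩ := hk₁₂.exists_halves (by
    rw [hfinish, hstart, ← hc, hcd])
  obtain ⟨k₃, k₄, hk₃, hk₄, e₃, e₃₄, -⟩ := hk₃₄.exists_halves (by
    rw [hfinish, hstart, revCurve_one, revCurve_zero, ← hd, hcd])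
  obtain ⟨l₁, hl₁, -, f₁⟩ := exists_isContLift_of_comp_smoothStep hk₁ hcU
  obtain ⟨l₂, hl₂, g₂, f₂⟩ := exists_isContLift_of_comp_smoothStep hk₂ hdU
  obtain ⟨l₃, hl₃, g₃, f₃⟩ := exists_isContLift_of_comp_smoothStep hk₃ (mapsTo_revCurve hcU)
  obtain ⟨l₄, hl₄, g₄, -⟩ := exists_isContLift_of_comp_smoothStep hk₄ (mapsTo_revCurve hdU)
  exact ⟨l₁, l₂, l₃, l₄, hl₁, hl₂, hl₃, hl₄, by rw [f₁, g₂, e₁₂],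
    by rw [f₂, g₃, e₂, e₁₂₃₄, e₃], by rw [f₃, g₄, e₃₄]⟩

theorem HasGenSimpleLiftProperty.eventually_exists_isCommutatorLift [T2Space Ω]
    (hlift : HasGenSimpleLiftProperty S) (hS : IsEmbeddedSurface S) (hU : IsPrecompactOpenIn S U)
    (hUc : IsConnected U) (hU2 : IsTwoSided S U) (hcU : IsSmoothCurveIn U c)
    (hdU : IsSmoothCurveIn U d) (hc : c 0 = c 1) (hd : d 0 = d 1) (hcd : c 0 = d 0) :
    ∀ᶠ δ in 𝓝[>] (0 : ℝ), ∃ (L : LiftSheet S U δ) (l₁ l₂ l₃ l₄ : ℝ → Ω),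
      IsCommutatorLift S L.carrier δ c d l₁ l₂ l₃ l₄ := by
  filter_upwards [hlift.eventually_exists_liftSheet hS hU hUc hU2] with δ h
  obtain ⟨L, l, hl⟩ := h _ (isSmoothCurveIn_flatCommutator hcU hdU hc hd hcd)
  exact ⟨L, LiftSheet.exists_isCommutatorLift_of_flatCommutator hl hcU.2 hdU.2 hc hd hcd⟩

end Existence

section Embedded

variable {Ω : Type*} {c d l m l₁ l₂ l₃ l₄ : ℝ → Ω}

/-- The curves `l` and `m` meet at most at their end points. -/
def MeetOnlyAtEnds (l m : ℝ → Ω) : Prop :=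
  ∀ s ∈ Icc (0 : ℝ) 1, ∀ t ∈ Icc (0 : ℝ) 1, l s = m t → (s = 0 ∨ s = 1) ∧ (t = 0 ∨ t = 1)

theorem MeetOnlyAtEnds.symm (h : MeetOnlyAtEnds l m) : MeetOnlyAtEnds m l :=
  fun s hs t ht hst => (h t ht s hs hst.symm).symm

theorem MeetOnlyAtEnds.rev_right (h : MeetOnlyAtEnds l m) : MeetOnlyAtEnds l (revCurve m) := by
  intro s hs t ht hst
  obtain ⟨hs01, ht01⟩ := h s hs (1 - t) (Icc.one_sub_mem ht) hst
  exact ⟨hs01, ht01.symm.imp (fun ht1 => by linarith) fun ht0 => by linarith⟩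

theorem MeetOnlyAtEnds.rev_left (h : MeetOnlyAtEnds l m) : MeetOnlyAtEnds (revCurve l) m :=
  h.symm.rev_right.symm

theorem MeetOnlyAtEnds.eq_one_and_eq_zero (h : MeetOnlyAtEnds l m) (hl : InjOn l (Icc 0 1))
    (hm : InjOn m (Icc 0 1)) (hlm : l 1 = m 0) (hlm' : l 0 ≠ m 1) {s t : ℝ}
    (hs : s ∈ Icc (0 : ℝ) 1) (ht : t ∈ Icc (0 : ℝ) 1) (hst : l s = m t) : s = 1 ∧ t = 0 := by
  obtain ⟨rfl | rfl, rfl | rfl⟩ := h s hs t ht hst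
  · exact absurd (hl hs unitInterval.one_mem (hst.trans hlm.symm)) zero_ne_one
  · exact absurd hst hlm'
  · exact ⟨rfl, rfl⟩
  · exact absurd (hm ht unitInterval.zero_mem (hst.symm.trans hlm)) one_ne_zero

theorem concatCurve_eq_left_or_right (c d : ℝ → Ω) {t : ℝ} (ht : t ∈ Icc (0 : ℝ) 1) :
    (2 * t ∈ Icc (0 : ℝ) 1 ∧ concatCurve c d t = c (2 * t)) ∨
      (2 * t - 1 ∈ Ioc (0 : ℝ) 1 ∧ concatCurve c d t = d (2 * t - 1)) := by
  rcases le_or_gt t (1 / 2) with h | h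
  · exact .inl ⟨two_mul_mem_unitInterval ⟨ht.1, h⟩, concatCurve_of_le c d h⟩
  · exact .inr ⟨⟨by linarith, by linarith [ht.2]⟩, concatCurve_of_lt c d h⟩

theorem injOn_concatCurve (hl : InjOn l (Icc 0 1)) (hm : InjOn m (Icc 0 1))
    (h : MeetOnlyAtEnds l m) (hlm : l 1 = m 0) (hlm' : l 0 ≠ m 1) :
    InjOn (concatCurve l m) (Icc 0 1) := by
  intro s hs t ht hst
  rcases concatCurve_eq_left_or_right l m hs with ⟨hs', hsl⟩ | ⟨hs', hsm⟩ <;>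
    rcases concatCurve_eq_left_or_right l m ht with ⟨ht', htl⟩ | ⟨ht', htm⟩
  · rw [hsl, htl] at hst
    linarith [hl hs' ht' hst]
  · rw [hsl, htm] at hst
    have ht0 := (h.eq_one_and_eq_zero hl hm hlm hlm' hs' (Ioc_subset_Icc_self ht') hst).2
    exact absurd ht0 ht'.1.ne'
  · rw [hsm, htl] at hst
    have hs0 := (h.eq_one_and_eq_zero hl hm hlm hlm' ht' (Ioc_subset_Icc_self hs') hst.symm).2
    exact absurd hs0 hs'.1.ne'
  · rw [hsm, htm] at hst
    linarith [hm (Ioc_subset_Icc_self hs') (Ioc_subset_Icc_self ht') hst]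

theorem MeetOnlyAtEnds.eq_zero_and_eq_one_of_pos (h : MeetOnlyAtEnds l m)
    (hm : InjOn m (Icc 0 1)) (hlm : l 1 = m 0) {s t : ℝ} (hs : s ∈ Icc (0 : ℝ) 1)
    (ht : t ∈ Ioc (0 : ℝ) 1) (hst : l s = m t) : s = 0 ∧ t = 1 := by
  obtain ⟨hs01, ht0 | rfl⟩ := h s hs t (Ioc_subset_Icc_self ht) hst
  · exact absurd ht0 ht.1.ne'
  rcases hs01 with rfl | rfl
  · exact ⟨rfl, rfl⟩
  · exact absurd (hm unitInterval.zero_mem unitInterval.one_mem (hlm.symm.trans hst)) zero_ne_one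

theorem isEmbeddedCurve_concatCurve (hl : InjOn l (Icc 0 1)) (hm : InjOn m (Icc 0 1))
    (h : MeetOnlyAtEnds l m) (hlm : l 1 = m 0) : IsEmbeddedCurve (concatCurve l m) := by
  intro s hs t ht hst
  rcases concatCurve_eq_left_or_right l m hs with ⟨hs', hsl⟩ | ⟨hs', hsm⟩ <;>
    rcases concatCurve_eq_left_or_right l m ht with ⟨ht', htl⟩ | ⟨ht', htm⟩
  · rw [hsl, htl] at hst
    exact .inl (by linarith [hl hs' ht' hst])
  · rw [hsl, htm] at hst
    obtain ⟨hs0, ht1⟩ := h.eq_zero_and_eq_one_of_pos hm hlm hs' ht' hst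
    exact .inr (.inl ⟨by linarith, by linarith⟩)
  · rw [hsm, htl] at hst
    obtain ⟨ht0, hs1⟩ := h.eq_zero_and_eq_one_of_pos hm hlm ht' hs' hst.symm
    exact .inr (.inr ⟨by linarith, by linarith⟩)
  · rw [hsm, htm] at hst
    exact .inl (by linarith [hm (Ioc_subset_Icc_self hs') (Ioc_subset_Icc_self ht') hst])

theorem IsEmbeddedCurve.rev (hc : IsEmbeddedCurve c) : IsEmbeddedCurve (revCurve c) := by
  intro s hs t ht hst
  rcases hc _ (Icc.one_sub_mem hs) _ (Icc.one_sub_mem ht) hst with h | ⟨hs0, ht1⟩ | ⟨hs1, ht0⟩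
  · exact .inl (by linarith)
  · exact .inr (.inr ⟨by linarith, by linarith⟩)
  · exact .inr (.inl ⟨by linarith, by linarith⟩)

theorem IsEmbeddedCurve.eq_zero_or_one (hc : IsEmbeddedCurve c) {s : ℝ}
    (hs : s ∈ Icc (0 : ℝ) 1) (h : c s = c 0) : s = 0 ∨ s = 1 := by
  rcases hc s hs 0 unitInterval.zero_mem h with h | ⟨h, -⟩ | ⟨h, -⟩
  · exact .inl h
  · exact .inl h
  · exact .inr h

theorem IsEmbeddedCurve.meetOnlyAtEnds (hc : IsEmbeddedCurve c) (hd : IsEmbeddedCurve d)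
    (hcd : c 0 = d 0) (h : curveImage c ∩ curveImage d ⊆ {c 0}) : MeetOnlyAtEnds c d := by
  intro s hs t ht hst
  have hs0 : c s = c 0 := h ⟨mem_image_of_mem c hs, t, ht, hst.symm⟩
  exact ⟨hc.eq_zero_or_one hs hs0, hd.eq_zero_or_one ht (hst.symm.trans (hs0.trans hcd))⟩

theorem isEmbeddedCurve_concatCurve₄ (hl₁ : InjOn l₁ (Icc 0 1)) (hl₂ : InjOn l₂ (Icc 0 1))
    (hl₃ : InjOn l₃ (Icc 0 1)) (hl₄ : InjOn l₄ (Icc 0 1)) (h₁₂ : MeetOnlyAtEnds l₁ l₂)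
    (h₂₃ : MeetOnlyAtEnds l₂ l₃) (h₃₄ : MeetOnlyAtEnds l₃ l₄) (h₄₁ : MeetOnlyAtEnds l₄ l₁)
    (h₁₃ : Disjoint (curveImage l₁) (curveImage l₃))
    (h₂₄ : Disjoint (curveImage l₂) (curveImage l₄)) (e₁₂ : l₁ 1 = l₂ 0) (e₂₃ : l₂ 1 = l₃ 0)
    (e₃₄ : l₃ 1 = l₄ 0) (e₄₁ : l₄ 1 = l₁ 0) :
    IsEmbeddedCurve (concatCurve (concatCurve l₁ l₂) (concatCurve l₃ l₄)) := by
  have hmem : ∀ (l : ℝ → Ω) {t : ℝ}, t ∈ Icc (0 : ℝ) 1 → l t ∈ curveImage l :=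
    fun l _ ht => mem_image_of_mem l ht
  have n₀₂ : l₁ 0 ≠ l₂ 1 :=
    e₂₃ ▸ h₁₃.ne_of_mem (hmem l₁ unitInterval.zero_mem) (hmem l₃ unitInterval.zero_mem)
  have n₁₃ : l₁ 1 ≠ l₃ 1 :=
    h₁₃.ne_of_mem (hmem l₁ unitInterval.one_mem) (hmem l₃ unitInterval.one_mem)
  refine isEmbeddedCurve_concatCurve (injOn_concatCurve hl₁ hl₂ h₁₂ e₁₂ n₀₂)
    (injOn_concatCurve hl₃ hl₄ h₃₄ e₃₄ (e₂₃ ▸ e₄₁ ▸ n₀₂.symm)) (fun s hs t ht hst => ?_)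
    (by rw [concatCurve_one, concatCurve_zero, e₂₃])
  rcases concatCurve_eq_left_or_right l₁ l₂ hs with ⟨hs', hsl⟩ | ⟨hs', hsl⟩ <;>
    rcases concatCurve_eq_left_or_right l₃ l₄ ht with ⟨ht', htl⟩ | ⟨ht', htl⟩ <;>
    rw [hsl, htl] at hst
  · exact absurd hst (h₁₃.ne_of_mem (hmem l₁ hs') (hmem l₃ ht'))
  · obtain ⟨ht1, hs0⟩ := h₄₁.eq_one_and_eq_zero hl₄ hl₁ e₄₁ (e₃₄ ▸ n₁₃.symm)
      (Ioc_subset_Icc_self ht') hs' hst.symm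
    exact ⟨.inl (by linarith), .inr (by linarith)⟩
  · obtain ⟨hs1, ht0⟩ := h₂₃.eq_one_and_eq_zero hl₂ hl₃ e₂₃ (e₁₂ ▸ n₁₃)
      (Ioc_subset_Icc_self hs') ht' hst
    exact ⟨.inr (by linarith), .inl (by linarith)⟩
  · exact absurd hst (h₂₄.ne_of_mem (hmem l₂ (Ioc_subset_Icc_self hs'))
      (hmem l₄ (Ioc_subset_Icc_self ht')))

end Embedded

section EmbeddedLifts

variable {Ω : Type*} [TopologicalSpace Ω] [ChartedSpace E3 Ω] [IsManifold (𝓡 3) ∞ Ω]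
  [RiemannianBundle (fun x : Ω => TangentSpace (𝓡 3) x)]
  {S U : Set Ω} {δ : ℝ} {L : LiftSheet S U δ} {c d l m l₁ l₂ l₃ l₄ : ℝ → Ω}

namespace LiftSheet

theorem meetOnlyAtEnds (hl : IsContLift S L.carrier δ c l) (hm : IsContLift S L.carrier δ d m)
    (hcU : MapsTo c (Icc 0 1) U) (hdU : MapsTo d (Icc 0 1) U) (h : MeetOnlyAtEnds c d) :
    MeetOnlyAtEnds l m :=
  fun s hs t ht hst => h s hs t ht (apply_eq_of_eq hl hm hcU hdU hs ht hst)

theorem injOn_of_isEmbeddedCurve (hl : IsContLift S L.carrier δ c l)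
    (hcU : MapsTo c (Icc 0 1) U) (hc : IsEmbeddedCurve c) (h : l 0 ≠ l 1) :
    InjOn l (Icc 0 1) := by
  intro s hs t ht hst
  rcases hc s hs t ht (apply_eq_of_eq hl hl hcU hcU hs ht hst) with
    hst' | ⟨rfl, rfl⟩ | ⟨rfl, rfl⟩
  · exact hst'
  · exact absurd hst h
  · exact absurd hst.symm h

theorem disjoint_curveImage_of_rev [T2Space Ω] (hl : IsContLift S L.carrier δ c l)
    (hm : IsContLift S L.carrier δ (revCurve c) m) (hcU : MapsTo c (Icc 0 1) U)
    (hc : IsEmbeddedCurve c) (h01 : l 0 ≠ m 1) (h00 : l 0 ≠ m 0) (h11 : l 1 ≠ m 1) :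
    Disjoint (curveImage l) (curveImage m) := by
  rw [disjoint_left]
  rintro - ⟨s, hs, rfl⟩ ⟨t, ht, hst⟩
  have hcst : c s = c (1 - t) := apply_eq_of_eq hl hm hcU (mapsTo_revCurve hcU) hs ht hst.symm
  rcases hc s hs _ (Icc.one_sub_mem ht) hcst with rfl | ⟨rfl, ht1⟩ | ⟨rfl, ht0⟩
  · have hst' : l (1 - t) = revCurve m (1 - t) :=
      hst.symm.trans (congrArg m (sub_sub_cancel 1 t).symm)
    exact h01 ((eqOn_of_eq hl hm.of_rev hcU hs hst' unitInterval.zero_mem).trans (revCurve_zero m))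
  · obtain rfl : t = 0 := by linarith
    exact h00 hst.symm
  · obtain rfl : t = 1 := by linarith
    exact h11 hst.symm

end LiftSheet

/-- If the lifts of `c` and `d` are not closed, consecutive vertices of the closed quadrilateral
`l₁ l₂ l₃ l₄` are distinct. If two opposite vertices coincide, two adjacent legs already form a
closed embedded curve; otherwise opposite legs are disjoint and the quadrilateral is embedded. -/
theorem IsCommutatorLift.closed_embedded_trichotomy [T2Space Ω]
    (h : IsCommutatorLift S L.carrier δ c d l₁ l₂ l₃ l₄)
    (hcU : MapsTo c (Icc 0 1) U) (hdU : MapsTo d (Icc 0 1) U) (hc : IsEmbeddedCurve c)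
    (hd : IsEmbeddedCurve d) (hcd : MeetOnlyAtEnds c d) (e₄₁ : l₄ 1 = l₁ 0)
    (hc_open : ∀ l, IsContLift S L.carrier δ c l → l 0 ≠ l 1)
    (hd_open : ∀ l, IsContLift S L.carrier δ d l → l 0 ≠ l 1) :
    IsEmbeddedCurve (concatCurve (concatCurve l₁ l₂) (concatCurve l₃ l₄)) ∨
      (IsClosedCurve (concatCurve l₁ l₂) ∧ IsEmbeddedCurve (concatCurve l₁ l₂)) ∨
      (IsClosedCurve (concatCurve l₂ l₃) ∧ IsEmbeddedCurve (concatCurve l₂ l₃)) := by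
  have hcrU := mapsTo_revCurve hcU
  have hdrU := mapsTo_revCurve hdU
  have n₁ := hc_open l₁ h.first
  have n₂ := hd_open l₂ h.second
  have n₃ := (hc_open _ h.third.of_rev).symm
  have n₄ := (hd_open _ h.fourth.of_rev).symm
  rw [revCurve_zero, revCurve_one] at n₃ n₄
  have hl₁ := LiftSheet.injOn_of_isEmbeddedCurve h.first hcU hc n₁
  have hl₂ := LiftSheet.injOn_of_isEmbeddedCurve h.second hdU hd n₂
  have hl₃ := LiftSheet.injOn_of_isEmbeddedCurve h.third hcrU hc.rev n₃
  have hl₄ := LiftSheet.injOn_of_isEmbeddedCurve h.fourth hdrU hd.rev n₄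
  have h₁₂ := LiftSheet.meetOnlyAtEnds h.first h.second hcU hdU hcd
  have h₂₃ := LiftSheet.meetOnlyAtEnds h.second h.third hdU hcrU hcd.symm.rev_right
  have h₃₄ := LiftSheet.meetOnlyAtEnds h.third h.fourth hcrU hdrU hcd.rev_left.rev_right
  have h₄₁ := LiftSheet.meetOnlyAtEnds h.fourth h.first hdrU hcU hcd.symm.rev_left
  have e₁₂ := h.first_second
  have e₂₃ := h.second_third
  have e₃₄ := h.third_fourth
  by_cases e₀₂ : l₁ 0 = l₂ 1
  · exact .inr (.inl ⟨isClosedCurve_concatCurve.2 e₀₂,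
      isEmbeddedCurve_concatCurve hl₁ hl₂ h₁₂ e₁₂⟩)
  by_cases e₁₃ : l₂ 0 = l₃ 1
  · exact .inr (.inr ⟨isClosedCurve_concatCurve.2 e₁₃,
      isEmbeddedCurve_concatCurve hl₂ hl₃ h₂₃ e₂₃⟩)
  refine .inl (isEmbeddedCurve_concatCurve₄ hl₁ hl₂ hl₃ hl₄ h₁₂ h₂₃ h₃₄ h₄₁
    (LiftSheet.disjoint_curveImage_of_rev h.first h.third hcU hc ?_ (e₂₃ ▸ e₀₂) (e₁₂ ▸ e₁₃))
    (LiftSheet.disjoint_curveImage_of_rev h.second h.fourth hdU hd ?_ (e₃₄ ▸ e₁₃) ?_)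
    e₁₂ e₂₃ e₃₄ e₄₁)
  · exact e₃₄ ▸ e₄₁ ▸ n₄.symm
  · exact e₁₂ ▸ e₄₁ ▸ n₁.symm
  · exact e₄₁ ▸ Ne.symm e₀₂

end EmbeddedLifts

section LiftingLemma

variable {Ω : Type*} [TopologicalSpace Ω] [ChartedSpace E3 Ω] {S U : Set Ω} {c d : ℝ → Ω}

theorem IsSmoothCurveIn.component {x : Ω} (hc : IsSmoothCurveIn S c)
    (hcU : curveImage c ⊆ U) (hx : c 0 = x) :
    IsSmoothCurveIn (connectedComponentIn U x) c := by
  have hconn : IsPreconnected (curveImage c) := isPreconnected_Icc.image c hc.1.continuousOn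
  refine ⟨hc.1, mapsTo_iff_image_subset.2 (hconn.subset_connectedComponentIn ?_ hcU)⟩
  exact hx ▸ mem_image_of_mem c unitInterval.zero_mem

theorem isPiecewiseSmooth_commutatorCurve (hc : ContMDiffOn 𝓘(ℝ, ℝ) (𝓡 3) ∞ c (Icc 0 1))
    (hd : ContMDiffOn 𝓘(ℝ, ℝ) (𝓡 3) ∞ d (Icc 0 1)) (hcl : IsClosedCurve c) (hdl : IsClosedCurve d)
    (hcd : c 0 = d 0) : IsPiecewiseSmooth (commutatorCurve c d) := by
  have hc' : IsPiecewiseSmooth c := .of_contMDiffOn hc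
  have hd' : IsPiecewiseSmooth d := .of_contMDiffOn hd
  have hcr : IsPiecewiseSmooth (revCurve c) := .of_contMDiffOn (contMDiffOn_revCurve hc)
  have hdr : IsPiecewiseSmooth (revCurve d) := .of_contMDiffOn (contMDiffOn_revCurve hd)
  refine (hc'.concat hd' (hcl ▸ hcd)).concat (hcr.concat hdr ?_) ?_
  · rw [revCurve_one, revCurve_zero, ← hdl, hcd]
  · rw [concatCurve_one, concatCurve_zero, revCurve_zero, ← hcl, ← hdl, hcd]

variable [IsManifold (𝓡 3) ∞ Ω] [RiemannianBundle (fun x : Ω => TangentSpace (𝓡 3) x)]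

theorem IsTwoSided.mono {V : Set Ω} (hU : IsTwoSided S U) (hV : V ⊆ U) : IsTwoSided S V :=
  let ⟨ν, hν, h⟩ := hU
  ⟨ν, hν.mono hV, fun x hx => h x (hV hx)⟩

theorem hasOpenLiftProperty_iff_eventually : HasOpenLiftProperty S c ↔
    ∀ᶠ δ in 𝓝[>] (0 : ℝ), ∀ l, IsSimpleLift S δ c l → ¬ IsClosedCurve l := by
  simp only [Filter.Eventually, mem_nhdsGT_iff_exists_Ioo_subset, HasOpenLiftProperty,
    subset_def, mem_Ioo, and_imp, not_exists, not_and, mem_Ioi, mem_ofPred_eq, gt_iff_lt]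

theorem hasClosedLiftProperty_of_frequently
    (h : ∃ᶠ δ in 𝓝[>] (0 : ℝ), ∃ l, IsSimpleLift S δ c l ∧ IsClosedCurve l) :
    HasClosedLiftProperty S c := fun hopen =>
  h <| (hasOpenLiftProperty_iff_eventually.1 hopen).mono fun _ hδ ⟨l, hl, hcl⟩ => hδ l hl hcl

theorem hasEmbeddedClosedLiftProperty_of_frequently
    (h : ∃ᶠ δ in 𝓝[>] (0 : ℝ),
      ∃ l, IsSimpleLift S δ c l ∧ IsClosedCurve l ∧ IsEmbeddedCurve l) :
    HasEmbeddedClosedLiftProperty S c := by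
  obtain ⟨δ, hδ, hl⟩ := exists_seq_forall_of_frequently (h.and_eventually self_mem_nhdsWithin)
  obtain ⟨hl, hpos⟩ := forall_and.1 hl
  choose l hl using hl
  exact ⟨δ, l, hpos, tendsto_nhds_of_tendsto_nhdsWithin hδ, hl⟩

variable [T2Space Ω] [IsContMDiffRiemannianBundle (𝓡 3) ∞ E3 (fun x : Ω => TangentSpace (𝓡 3) x)]

namespace IsCommutatorLift

variable {δ : ℝ} {L : LiftSheet S U δ} {l₁ l₂ l₃ l₄ : ℝ → Ω}

theorem isClosedCurve (h : IsCommutatorLift S L.carrier δ c d l₁ l₂ l₃ l₄)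
    (hcU : MapsTo c (Icc 0 1) U) (hdU : MapsTo d (Icc 0 1) U) (hc : IsClosedCurve c)
    (hd : IsClosedCurve d) (hcd : c 0 = d 0) :
    IsClosedCurve (concatCurve (concatCurve l₁ l₂) (concatCurve l₃ l₄)) := by
  rw [isClosedCurve_concatCurve, concatCurve_zero, concatCurve_one,
    h.apply_one_eq_apply_zero hcU hdU hc hd hcd]

omit [T2Space Ω] [IsContMDiffRiemannianBundle (𝓡 3) ∞ E3 (fun x : Ω => TangentSpace (𝓡 3) x)] in
theorem isSimpleLift (h : IsCommutatorLift S L.carrier δ c d l₁ l₂ l₃ l₄)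
    (hcU : IsSmoothCurveIn U c) (hdU : IsSmoothCurveIn U d) (hc : IsClosedCurve c)
    (hd : IsClosedCurve d) (hcd : c 0 = d 0) :
    IsSimpleLift S δ (commutatorCurve c d)
      (concatCurve (concatCurve l₁ l₂) (concatCurve l₃ l₄)) :=
  LiftSheet.isSimpleLift h.isContLift
    (mapsTo_concatCurve (mapsTo_concatCurve hcU.2 hdU.2)
      (mapsTo_concatCurve (mapsTo_revCurve hcU.2) (mapsTo_revCurve hdU.2)))
    (isPiecewiseSmooth_commutatorCurve hcU.1 hdU.1 hc hd hcd)

end IsCommutatorLift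

namespace HasGenSimpleLiftProperty

theorem hasClosedLiftProperty_commutatorCurve (hlift : HasGenSimpleLiftProperty S)
    (hS : IsEmbeddedSurface S) (hU : IsPrecompactOpenIn S U) (hUc : IsConnected U)
    (hU2 : IsTwoSided S U) (hcU : IsSmoothCurveIn U c) (hdU : IsSmoothCurveIn U d)
    (hc : IsClosedCurve c) (hd : IsClosedCurve d) (hcd : c 0 = d 0) :
    HasClosedLiftProperty S (commutatorCurve c d) := by
  have hlifts := hlift.eventually_exists_isCommutatorLift hS hU hUc hU2 hcU hdU hc hd hcd
  refine hasClosedLiftProperty_of_frequently (hlifts.mono ?_).frequently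
  rintro δ ⟨L, l₁, l₂, l₃, l₄, h⟩
  exact ⟨_, h.isSimpleLift hcU hdU hc hd hcd, h.isClosedCurve hcU.2 hdU.2 hc hd hcd⟩

theorem hasEmbeddedClosedLiftProperty_trichotomy (hlift : HasGenSimpleLiftProperty S)
    (hS : IsEmbeddedSurface S) (hU : IsPrecompactOpenIn S U) (hUc : IsConnected U)
    (hU2 : IsTwoSided S U) (hcU : IsSmoothCurveIn U c) (hdU : IsSmoothCurveIn U d)
    (hc : IsClosedCurve c) (hd : IsClosedCurve d) (hcd : c 0 = d 0)
    (hc_open : HasOpenLiftProperty S c) (hd_open : HasOpenLiftProperty S d)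
    (hc_emb : IsEmbeddedCurve c) (hd_emb : IsEmbeddedCurve d)
    (hinter : curveImage c ∩ curveImage d ⊆ {c 0}) :
    HasEmbeddedClosedLiftProperty S (commutatorCurve c d) ∨
      HasEmbeddedClosedLiftProperty S (concatCurve c d) ∨
      HasEmbeddedClosedLiftProperty S (concatCurve d (revCurve c)) := by
  have hcs : IsPiecewiseSmooth c := .of_contMDiffOn hcU.1
  have hds : IsPiecewiseSmooth d := .of_contMDiffOn hdU.1
  have hcrs : IsPiecewiseSmooth (revCurve c) := .of_contMDiffOn (contMDiffOn_revCurve hcU.1)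
  have hcdU := mapsTo_concatCurve hcU.2 hdU.2
  have hdcU := mapsTo_concatCurve hdU.2 (mapsTo_revCurve hcU.2)
  have hdc : d 1 = revCurve c 0 := by rw [revCurve_zero, ← hc, ← hd, hcd]
  suffices hlifts : ∀ᶠ δ in 𝓝[>] (0 : ℝ),
      (∃ l, IsSimpleLift S δ (commutatorCurve c d) l ∧ IsClosedCurve l ∧ IsEmbeddedCurve l) ∨
      (∃ l, IsSimpleLift S δ (concatCurve c d) l ∧ IsClosedCurve l ∧ IsEmbeddedCurve l) ∨
      ∃ l, IsSimpleLift S δ (concatCurve d (revCurve c)) l ∧ IsClosedCurve l ∧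
        IsEmbeddedCurve l by
    have hfreq := hlifts.frequently
    rw [frequently_or_distrib, frequently_or_distrib] at hfreq
    exact hfreq.imp hasEmbeddedClosedLiftProperty_of_frequently
      (Or.imp hasEmbeddedClosedLiftProperty_of_frequently
        hasEmbeddedClosedLiftProperty_of_frequently)
  filter_upwards [hlift.eventually_exists_isCommutatorLift hS hU hUc hU2 hcU hdU hc hd hcd,
    hasOpenLiftProperty_iff_eventually.1 hc_open, hasOpenLiftProperty_iff_eventually.1 hd_open]
  rintro δ ⟨L, l₁, l₂, l₃, l₄, h⟩ hcδ hdδ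
  rcases h.closed_embedded_trichotomy hcU.2 hdU.2 hc_emb hd_emb
    (hc_emb.meetOnlyAtEnds hd_emb hcd hinter) (h.apply_one_eq_apply_zero hcU.2 hdU.2 hc hd hcd)
    (fun l hl => hcδ l (LiftSheet.isSimpleLift hl hcU.2 hcs))
    (fun l hl => hdδ l (LiftSheet.isSimpleLift hl hdU.2 hds)) with hμ | hcd' | hdc'
  · exact .inl ⟨_, h.isSimpleLift hcU hdU hc hd hcd, h.isClosedCurve hcU.2 hdU.2 hc hd hcd, hμ⟩
  · exact .inr (.inl ⟨_, LiftSheet.isSimpleLift (h.first.concat h.second h.first_second) hcdU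
      (hcs.concat hds (hc.symm.trans hcd)), hcd'⟩)
  · exact .inr (.inr ⟨_, LiftSheet.isSimpleLift (h.second.concat h.third h.second_third) hdcU
      (hds.concat hcrs hdc), hdc'⟩)

end HasGenSimpleLiftProperty

end LiftingLemma

end LiftProperty

theorem mainTheorem6_general {Ω : Type*} [TopologicalSpace Ω] [T2Space Ω]
    [ChartedSpace E3 Ω] [IsManifold (𝓡 3) ∞ Ω]
    [RiemannianBundle (fun x : Ω => TangentSpace (𝓡 3) x)]
    [IsContMDiffRiemannianBundle (𝓡 3) ∞ E3 (fun x : Ω => TangentSpace (𝓡 3) x)]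
    {S U : Set Ω} (hS : IsEmbeddedSurface S) (hlift : HasGenSimpleLiftProperty S)
    (hU : IsPrecompactOpenIn S U) (hU2 : IsTwoSided S U)
    {α β : ℝ → Ω} (hα : IsSmoothCurveIn S α) (hβ : IsSmoothCurveIn S β)
    (hαU : curveImage α ⊆ U) (hβU : curveImage β ⊆ U)
    (hαc : IsClosedCurve α) (hβc : IsClosedCurve β) (hαβ : α 0 = β 0) :
    HasClosedLiftProperty S (commutatorCurve α β) ∧
    (HasOpenLiftProperty S α → HasOpenLiftProperty S β →
      IsEmbeddedCurve α → IsEmbeddedCurve β → curveImage α ∩ curveImage β ⊆ {α 0} →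
      HasEmbeddedClosedLiftProperty S (commutatorCurve α β) ∨
      HasEmbeddedClosedLiftProperty S (concatCurve α β) ∨
      HasEmbeddedClosedLiftProperty S (concatCurve β (revCurve α))) := by
  have hUα : IsPrecompactOpenIn S (connectedComponentIn U (α 0)) := hU.component hS (α 0)
  have hconn : IsConnected (connectedComponentIn U (α 0)) :=
    isConnected_connectedComponentIn_iff.2 (hαU (mem_image_of_mem α unitInterval.zero_mem))
  have hUα2 : IsTwoSided S (connectedComponentIn U (α 0)) :=
    hU2.mono (connectedComponentIn_subset U (α 0))
  have hα' := hα.component hαU rfl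
  have hβ' := hβ.component hβU hαβ.symm
  exact ⟨hlift.hasClosedLiftProperty_commutatorCurve hS hUα hconn hUα2 hα' hβ' hαc hβc hαβ,
    hlift.hasEmbeddedClosedLiftProperty_trichotomy hS hUα hconn hUα2 hα' hβ' hαc hβc hαβ⟩

theorem mainTheorem6 {Ω : Type*} [TopologicalSpace Ω] [T2Space Ω] [SecondCountableTopology Ω]
    [ChartedSpace E3 Ω] [IsManifold (𝓡 3) ∞ Ω]
    [RiemannianBundle (fun x : Ω => TangentSpace (𝓡 3) x)]
    [IsContMDiffRiemannianBundle (𝓡 3) ∞ E3 (fun x : Ω => TangentSpace (𝓡 3) x)]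
    (S : Set Ω) (hS : IsEmbeddedSurface S) (hlift : HasGenSimpleLiftProperty S)
    (α β : ℝ → Ω) (hα : IsSmoothCurveIn S α) (hβ : IsSmoothCurveIn S β)
    (hαc : IsClosedCurve α) (hβc : IsClosedCurve β)
    (hαo : HasOpenLiftProperty S α) (hβo : HasOpenLiftProperty S β)
    (p : Ω) (hαp : α 0 = p) (hβp : β 0 = p) (hp : curveImage α ∩ curveImage β = {p})
    (U : Set Ω) (hU : IsPrecompactOpenIn S U) (hU2 : IsTwoSided S U)
    (hαU : curveImage α ⊆ U) (hβU : curveImage β ⊆ U) :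
    HasClosedLiftProperty S (commutatorCurve α β) ∧
    (IsEmbeddedCurve α → IsEmbeddedCurve β →
      HasEmbeddedLiftProperty S α → HasEmbeddedLiftProperty S β →
      HasEmbeddedClosedLiftProperty S (commutatorCurve α β) ∨
      HasEmbeddedClosedLiftProperty S (concatCurve α β) ∨
      HasEmbeddedClosedLiftProperty S (concatCurve β (revCurve α))) := by
  obtain ⟨hclosed, hembedded⟩ :=
    mainTheorem6_general hS hlift hU hU2 hα hβ hαU hβU hαc hβc (hαp.trans hβp.symm)
  exact ⟨hclosed, fun hα hβ _ _ => hembedded hαo hβo hα hβ (hαp ▸ hp.subset)⟩
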